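/- Let $d\ge 2$, let $\Omega\subset\mathbb{R}^d$ be a bounded connected domain with $C^\infty$ boundary $\Gamma=\partial\Omega$, and let $\nu$ be the Euclidean unit inner normal to $\Gamma$. Let $c,n\in L^\infty(\Omega)$ be real-valued with $c\ge b_0$ and $n\ge b_0$ almost everywhere in $\Omega$ for some constant $b_0>0$. Suppose that, for some $\delta>0$, all first order distributional partial derivatives of $c$ and $n$ belong to $L^\infty(\Omega_\delta)$, where $\Omega_\delta=\{x\in\Omega:\mathrm{dist}(x,\Gamma)<\delta\}$. For $z\in\mathbb{C}$ with $|z|=1$ set $\theta=|\mathrm{Im}\,z|$ if $\mathrm{Re}\,z\ge 0$ and $\theta=1$ if $\mathrm{Re}\,z<0$. Then there is a constant $C>0$, depending only on $d,\Omega,c,n,b_0,\delta$, such that the following holds for all $h>0$ and all $z\in\mathbb{C}$ with $|z|=1$ and $\theta\ge h$, all (complex-valued) $v\in L^2(\Omega)$ and all $u\in H^2(\Omega)$. If $$h^2\,\nabla\cdot(c\nabla u)+z\,n\,u=h\,v\quad\text{in }\Omega\ \text{(in the sense of distributions)},\qquad u=0\quad\text{on }\Gamma\ \text{(in the sense of traces)},$$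 then the normal derivative $\partial_\nu u|_\Gamma=\sum_i\nu_i\,(\partial_i u)|_\Gamma$ (defined through the traces of the $\partial_iu\in H^1(\Omega)$) exists in $L^2(\Gamma)$, and $g=h\,\partial_\nu u|_\Gamma$ satisfies $$\|g\|_{L^2(\Gamma)}\le C\,h^{1/2}\,\theta^{-1/2}\,\|v\|_{L^2(\Omega)}.$$ -/

import Mathlib

open MeasureTheory Filter Topology
open scoped ContDiff

noncomputable section

namespace SemiclassicalDirichlet

/-- `φ` is a real test function in the open set `U`. -/
structure IsTestFunction {d : ℕ} (U : Set (EuclideanSpace ℝ (Fin d)))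
    (φ : EuclideanSpace ℝ (Fin d) → ℝ) : Prop where
  contDiff : ContDiff ℝ ∞ φ
  hasCompactSupport : HasCompactSupport φ
  tsupport_subset : tsupport φ ⊆ U

/-- The classical partial derivative `∂f/∂xᵢ` at `x`. -/
def partialDeriv {d : ℕ} {F : Type*} [NormedAddCommGroup F] [NormedSpace ℝ F] (i : Fin d)
    (f : EuclideanSpace ℝ (Fin d) → F) (x : EuclideanSpace ℝ (Fin d)) : F :=
  fderiv ℝ f x (EuclideanSpace.single i (1 : ℝ))

/-- `f'` is the weak (distributional) partial derivative `∂f/∂xᵢ` in the open set `U`. -/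
def HasWeakPartial {d : ℕ} {F : Type*} [NormedAddCommGroup F] [NormedSpace ℝ F]
    (U : Set (EuclideanSpace ℝ (Fin d))) (i : Fin d)
    (f f' : EuclideanSpace ℝ (Fin d) → F) : Prop :=
  LocallyIntegrableOn f U ∧ LocallyIntegrableOn f' U ∧
    ∀ φ : EuclideanSpace ℝ (Fin d) → ℝ, IsTestFunction U φ →
      ∫ x in U, partialDeriv i φ x • f x = -∫ x in U, φ x • f' x

/-- `G` is the weak gradient of `f` in `U`. -/
def HasWeakGradient {d : ℕ} (U : Set (EuclideanSpace ℝ (Fin d)))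
    (f : EuclideanSpace ℝ (Fin d) → ℂ) (G : Fin d → EuclideanSpace ℝ (Fin d) → ℂ) : Prop :=
  ∀ i, HasWeakPartial U i f (G i)

/-- The Sobolev space `H¹(U)`. -/
def MemH1 {d : ℕ} (U : Set (EuclideanSpace ℝ (Fin d)))
    (f : EuclideanSpace ℝ (Fin d) → ℂ) : Prop :=
  MemLp f 2 (volume.restrict U) ∧
    ∃ G : Fin d → EuclideanSpace ℝ (Fin d) → ℂ,
      HasWeakGradient U f G ∧ ∀ i, MemLp (G i) 2 (volume.restrict U)

/-- The Sobolev space `H²(U)`. -/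
def MemH2 {d : ℕ} (U : Set (EuclideanSpace ℝ (Fin d)))
    (f : EuclideanSpace ℝ (Fin d) → ℂ) : Prop :=
  MemLp f 2 (volume.restrict U) ∧
    ∃ G : Fin d → EuclideanSpace ℝ (Fin d) → ℂ,
      HasWeakGradient U f G ∧ ∀ i, MemH1 U (G i)

/-- The space `C¹(U)` in the low-regularity convention: every first order (distributional) partial
derivative of `a` is in `L^∞(U)`. -/
def HasBoundedWeakPartials {d : ℕ} (U : Set (EuclideanSpace ℝ (Fin d)))
    (a : EuclideanSpace ℝ (Fin d) → ℝ) : Prop :=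
  ∀ i, ∃ a' : EuclideanSpace ℝ (Fin d) → ℝ,
    HasWeakPartial U i a a' ∧ MemLp a' ⊤ (volume.restrict U)

/-- In the ball of centre `x₀` and radius `r`, the set `Ω` is the region above the graph of a smooth
function. The graph is taken over the hyperplane orthogonal to the unit vector `e`: `γ` is a smooth
function of the component orthogonal to `e` only. -/
structure IsGraphChart {d : ℕ} (Ω : Set (EuclideanSpace ℝ (Fin d)))
    (x₀ : EuclideanSpace ℝ (Fin d)) (r : ℝ) (e : EuclideanSpace ℝ (Fin d))
    (γ : EuclideanSpace ℝ (Fin d) → ℝ) : Prop where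
  radius_pos : 0 < r
  norm_eq_one : ‖e‖ = 1
  contDiff : ContDiff ℝ ∞ γ
  add_smul : ∀ x (t : ℝ), γ (x + t • e) = γ x
  mem_iff : ∀ x ∈ Metric.ball x₀ r, (x ∈ Ω ↔ γ x < inner ℝ e x)

/-- `Ω` is a bounded connected domain with `C^∞` boundary. -/
structure IsSmoothBoundedDomain {d : ℕ} (Ω : Set (EuclideanSpace ℝ (Fin d))) : Prop where
  isOpen : IsOpen Ω
  isConnected : IsConnected Ω
  isBounded : Bornology.IsBounded Ω
  exists_chart : ∀ x₀ ∈ frontier Ω, ∃ r e γ, IsGraphChart Ω x₀ r e γ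

/-- `N` is the Euclidean unit inner normal to `∂Ω` at `x`. -/
def IsInnerUnitNormal {d : ℕ} (Ω : Set (EuclideanSpace ℝ (Fin d)))
    (x N : EuclideanSpace ℝ (Fin d)) : Prop :=
  ‖N‖ = 1 ∧ ∃ r e γ, IsGraphChart Ω x r e γ ∧ ∃ s : ℝ, 0 < s ∧ s • N = e - gradient γ x

/-- The surface measure on the boundary `∂Ω`, i.e. the `(d-1)`-dimensional Hausdorff measure
(normalized as in Euclidean space). -/
def surfaceMeasure {d : ℕ} (Ω : Set (EuclideanSpace ℝ (Fin d))) :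
    Measure (EuclideanSpace ℝ (Fin d)) :=
  (Measure.euclideanHausdorffMeasure (d - 1)).restrict (frontier Ω)

/-- `w ∈ L²(∂Ω)` is the trace on `∂Ω` of `f ∈ H¹(Ω)`: there are functions `φ_k`, smooth up to the
boundary, with `φ_k → f` in `H¹(Ω)` and `φ_k|_{∂Ω} → w` in `L²(∂Ω)`. -/
def HasTrace {d : ℕ} (Ω : Set (EuclideanSpace ℝ (Fin d)))
    (f w : EuclideanSpace ℝ (Fin d) → ℂ) : Prop :=
  MemH1 Ω f ∧ MemLp w 2 (surfaceMeasure Ω) ∧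
    ∃ G : Fin d → EuclideanSpace ℝ (Fin d) → ℂ, HasWeakGradient Ω f G ∧
    ∃ φ : ℕ → EuclideanSpace ℝ (Fin d) → ℂ,
      (∀ k, ContDiff ℝ ∞ (φ k)) ∧
      Tendsto (fun k => eLpNorm (fun x => φ k x - f x) 2 (volume.restrict Ω)) atTop (𝓝 0) ∧
      (∀ i, Tendsto (fun k => eLpNorm (fun x => partialDeriv i (φ k) x - G i x) 2
        (volume.restrict Ω)) atTop (𝓝 0)) ∧
      Tendsto (fun k => eLpNorm (fun x => φ k x - w x) 2 (surfaceMeasure Ω)) atTop (𝓝 0)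

/-- `q ∈ L²(∂Ω)` is the normal derivative `∂_ν u|_{∂Ω}` of `u ∈ H²(Ω)`, with respect to the inner
unit normal: `q = ∑ᵢ νᵢ (∂ᵢu)|_{∂Ω}`, the restrictions being traces. -/
def IsNormalDerivative {d : ℕ} (Ω : Set (EuclideanSpace ℝ (Fin d)))
    (u q : EuclideanSpace ℝ (Fin d) → ℂ) : Prop :=
  MemLp q 2 (surfaceMeasure Ω) ∧
    ∃ G w : Fin d → EuclideanSpace ℝ (Fin d) → ℂ,
      HasWeakGradient Ω u G ∧ (∀ i, HasTrace Ω (G i) (w i)) ∧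
      ∀ᵐ x ∂(surfaceMeasure Ω), ∃ N, IsInnerUnitNormal Ω x N ∧ q x = ∑ i, (N i : ℂ) * w i x

/-- The equation `(h² ∇c∇ + z n) u = h v` in `Ω`, in the sense of distributions. -/
def SolvesEquation {d : ℕ} (Ω : Set (EuclideanSpace ℝ (Fin d)))
    (c n : EuclideanSpace ℝ (Fin d) → ℝ) (h : ℝ) (z : ℂ)
    (u v : EuclideanSpace ℝ (Fin d) → ℂ) : Prop :=
  ∃ G : Fin d → EuclideanSpace ℝ (Fin d) → ℂ, HasWeakGradient Ω u G ∧
    ∀ φ : EuclideanSpace ℝ (Fin d) → ℝ, IsTestFunction Ω φ →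
      ∫ x in Ω, (-((h : ℂ) ^ 2 * (c x : ℂ) * ∑ i, ((partialDeriv i φ x : ℝ) : ℂ) * G i x) +
          z * (n x : ℂ) * u x * (φ x : ℂ)) =
        ∫ x in Ω, (h : ℂ) * v x * (φ x : ℂ)

/-- The part of `Ω` at distance less than `δ` from the boundary. -/
def collar {d : ℕ} (Ω : Set (EuclideanSpace ℝ (Fin d))) (δ : ℝ) :
    Set (EuclideanSpace ℝ (Fin d)) :=
  {x ∈ Ω | Metric.infDist x (frontier Ω) < δ}

/-- `θ = |Im z|` if `Re z ≥ 0` and `θ = 1` if `Re z < 0`; on the unit circle both expressions are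
`1` where `Re z = 0`. -/
def theta (z : ℂ) : ℝ := if 0 ≤ z.re then |z.im| else 1

end SemiclassicalDirichlet

end

/-!
The proof is a Rellich (multiplier) argument in the collar where the coefficients are regular,
combined with the energy estimate for the Dirichlet problem.

*Energy.* A function of `H¹(Ω)` with vanishing trace is a limit of test functions
(`BoundaryAtlas.exists_test_approx`), so the equation can be tested with the conjugate of `u`.
Real and imaginary parts give `‖u‖ ≤ C (h / θ) ‖v‖` and `‖∇u‖ ≤ C ‖v‖ / θ` (`energy_estimate`).
Only upper and lower bounds of the coefficients enter.

*Rellich identity.* Near a boundary point `Ω` lies above a graph over the hyperplane orthogonal to a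
unit vector `e`. For smooth `f` and a cutoff `χ`, the divergence of
`χ (2 Re (∇f ∂ₑf̄) - e |∇f|²)` is `2 χ Re (Δf ∂ₑf̄)` up to terms quadratic in `∇f`, and its flux
through the boundary dominates `χ |∇f|²` up to the tangential part of `∇f`
(`IsGraphChart.exists_rellich_le`). For an `H²` function with vanishing trace, approximated by smooth
functions, the tangential part tends to zero: integrating by parts along the boundary, it pairs
to zero with every test function (`BoundaryAtlas.tendsto_tangential`). Hence the traces of the
partial derivatives satisfy `∫_Γ |∇u|² ≤ K ∑ⱼ -4 Re ∫ χⱼ Δu ∂ₑū + C ‖∇u‖²`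
(`BoundaryAtlas.exists_sum_trace_sq_le`).

*The equation in the collar.* There `c` has bounded weak derivatives, so the equation holds almost
everywhere as `h² (c Δu + ∇c·∇u) + z n u = h v` (`SolvesEquation.ae_eq`). Replacing `h² Δu` in the
Rellich estimate gives terms bounded by `h ‖v‖ ‖∇u‖` and `h² ‖∇u‖²`, and the term
`z ∫ χ (n / c) u ∂ₑū`. Its part with `Im z` is bounded by `θ ‖u‖ ‖∇u‖`. In the part with `Re z` one
has `2 Re (u ∂ₑū) = ∂ₑ|u|²`, and integrating by parts, which uses the bounded derivatives of `n` and
`c`, bounds it by `‖u‖²` (`BoundedCoefficients.exists_principal_le`). By the energy estimate each of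
these is at most a constant times `(h / θ) ‖v‖²`; here `h ≤ θ` is used (`rellich_terms_le`).

The divergence theorem above a graph is proved from the fundamental theorem of calculus along `e`
and a shear (`setIntegral_aboveGraph_partialDeriv`). It involves the push-forward of Lebesgue measure
on the hyperplane, which is comparable with the Hausdorff measure on the boundary since the
parametrization and the projection are Lipschitz. Traces of `H¹` functions come from the trace
inequality and the completeness of `L²(Γ)`.
-/


namespace SemiclassicalDirichlet

/-! ### Integration over the region above a graph -/

/-- The parametrization `y ↦ y + γ(y) e` of the graph of `γ` over the hyperplane orthogonal
to `e`. -/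
noncomputable def graphMap {d : ℕ} (e : EuclideanSpace ℝ (Fin d)) (γ : EuclideanSpace ℝ (Fin d) → ℝ)
    (y : (Submodule.span ℝ {e})ᗮ) : EuclideanSpace ℝ (Fin d) :=
  (y : EuclideanSpace ℝ (Fin d)) + γ y • e

/-- The measure on the graph of `γ` obtained by pushing forward Lebesgue measure on the hyperplane
orthogonal to `e`. It is the surface measure without its Jacobian factor. -/
noncomputable def graphMeasure {d : ℕ} (e : EuclideanSpace ℝ (Fin d))
    (γ : EuclideanSpace ℝ (Fin d) → ℝ) : Measure (EuclideanSpace ℝ (Fin d)) :=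
  Measure.map (graphMap e γ) volume

/-- The region above the graph of `γ`. -/
def aboveGraph {d : ℕ} (e : EuclideanSpace ℝ (Fin d))
    (γ : EuclideanSpace ℝ (Fin d) → ℝ) : Set (EuclideanSpace ℝ (Fin d)) :=
  {x | γ x < inner ℝ e x}

/-- The `i`-th component of the inner normal `e - ∇γ` to the graph of `γ`, not normalized. -/
noncomputable def conormal {d : ℕ} (e : EuclideanSpace ℝ (Fin d))
    (γ : EuclideanSpace ℝ (Fin d) → ℝ) (i : Fin d) (x : EuclideanSpace ℝ (Fin d)) : ℝ :=
  e i - partialDeriv i γ x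

section Graph

variable {d : ℕ} {e : EuclideanSpace ℝ (Fin d)} {γ : EuclideanSpace ℝ (Fin d) → ℝ}
  {F : Type*} [NormedAddCommGroup F] [NormedSpace ℝ F]

lemma inner_eq_zero_of_orthogonal (y : (Submodule.span ℝ {e})ᗮ) :
    inner ℝ e (y : EuclideanSpace ℝ (Fin d)) = 0 :=
  Submodule.mem_orthogonal_singleton_iff_inner_right.1 y.2

lemma measurePreserving_orthogonal_add_smul (he : ‖e‖ = 1) :
    MeasurePreserving (fun p : (Submodule.span ℝ {e})ᗮ × ℝ =>
      (p.1 : EuclideanSpace ℝ (Fin d)) + p.2 • e) (volume.prod volume) volume := by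
  have h1 : MeasurePreserving (fun q : (Submodule.span ℝ {e}) × (Submodule.span ℝ {e})ᗮ =>
      (q.1 : EuclideanSpace ℝ (Fin d)) + q.2) (volume.prod volume) volume := by
    have h := ((Submodule.span ℝ {e}).measurePreserving_measurableEquivProd
      (0 : EuclideanSpace ℝ (Fin d))).symm
    rw [InnerProductSpace.euclideanHausdorffMeasure_eq_volume, Measure.volume_eq_prod] at h
    have heq : (fun q : (Submodule.span ℝ {e}) × (Submodule.span ℝ {e})ᗮ =>
        (q.1 : EuclideanSpace ℝ (Fin d)) + q.2) =
        ((Submodule.span ℝ {e}).measurableEquivProd (0 : EuclideanSpace ℝ (Fin d))).symm := by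
      funext q
      rw [Submodule.measurableEquivProd_symm_apply]
      simp
    rw [heq]
    exact h
  have h2 : MeasurePreserving (LinearIsometryEquiv.toSpanUnitSingleton e he) volume volume :=
    LinearIsometryEquiv.measurePreserving _
  have h3 := h2.prod (MeasurePreserving.id (volume : Measure (Submodule.span ℝ {e})ᗮ))
  have h4 := Measure.measurePreserving_swap (μ := (volume : Measure (Submodule.span ℝ {e})ᗮ))
    (ν := (volume : Measure ℝ))
  have h5 := h1.comp (h3.comp h4)
  convert h5 using 1
  ext1 p
  simp [add_comm]

lemma injective_graph_add_smul (he : ‖e‖ = 1) (f : (Submodule.span ℝ {e})ᗮ → ℝ) :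
    Function.Injective (fun p : (Submodule.span ℝ {e})ᗮ × ℝ =>
      (p.1 : EuclideanSpace ℝ (Fin d)) + (f p.1 + p.2) • e) := by
  rintro ⟨y, s⟩ ⟨y', t⟩ h
  have hin := congrArg (fun x => inner ℝ e x) h
  simp only [inner_add_right, inner_smul_right, inner_eq_zero_of_orthogonal,
    real_inner_self_eq_norm_sq, he] at hin
  simp only at h
  have h2 : f y + s = f y' + t := by linarith
  rw [h2] at h
  have h3 : y = y' := Subtype.ext (add_right_cancel h)
  subst h3
  simp only [Prod.mk.injEq, true_and]
  linarith

lemma continuous_graph_add_smul (hγ : Continuous γ) :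
    Continuous (fun p : (Submodule.span ℝ {e})ᗮ × ℝ =>
      (p.1 : EuclideanSpace ℝ (Fin d)) + (γ p.1 + p.2) • e) := by
  fun_prop

lemma measurePreserving_graph_add_smul (he : ‖e‖ = 1) (hγ : Continuous γ) :
    MeasurePreserving (fun p : (Submodule.span ℝ {e})ᗮ × ℝ =>
      (p.1 : EuclideanSpace ℝ (Fin d)) + (γ p.1 + p.2) • e) (volume.prod volume) volume := by
  have h : MeasurePreserving (fun p : (Submodule.span ℝ {e})ᗮ × ℝ => (p.1, γ p.1 + p.2))
      (volume.prod volume) (volume.prod volume) := by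
    refine (MeasurePreserving.id (volume : Measure (Submodule.span ℝ {e})ᗮ)).skew_product
      (μc := (volume : Measure ℝ)) (g := fun y t => γ y + t) ?_ ?_
    · exact (by fun_prop : Continuous fun p : (Submodule.span ℝ {e})ᗮ × ℝ => γ p.1 + p.2).measurable
    · exact Eventually.of_forall fun y => map_add_left_eq_self volume _
  exact (measurePreserving_orthogonal_add_smul he).comp h

lemma isOpen_aboveGraph (hγ : Continuous γ) : IsOpen (aboveGraph e γ) :=
  isOpen_lt hγ (by fun_prop)

lemma continuous_graphMap (hγ : Continuous γ) : Continuous (graphMap e γ) := by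
  unfold graphMap; fun_prop

lemma isClosedEmbedding_graphMap (hγ : Continuous γ) :
    IsClosedEmbedding (graphMap e γ) := by
  let P := (Submodule.span ℝ {e})ᗮ.orthogonalProjectionOnto
  have hP : ∀ y, P (graphMap e γ y) = y := fun y => by
    have he : P e = 0 := Submodule.orthogonalProjectionOnto_orthogonal_apply_eq_zero
      (Submodule.mem_span_singleton_self e)
    rw [graphMap, map_add, map_smul, he]
    simp [P]
  refine Topology.IsClosedEmbedding.of_continuous_injective_isClosedMap
    (continuous_graphMap hγ) ?_ ?_
  · intro y y' h
    rw [← hP y, ← hP y', h]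
  · intro S hS
    have : graphMap e γ '' S = {x | P x ∈ S ∧ graphMap e γ (P x) = x} := by
      ext x
      constructor
      · rintro ⟨y, hy, rfl⟩
        exact ⟨by rw [hP]; exact hy, by rw [hP]⟩
      · rintro ⟨h1, h2⟩
        exact ⟨_, h1, h2⟩
    rw [this]
    exact (hS.preimage P.continuous).inter
      (isClosed_eq ((continuous_graphMap hγ).comp P.continuous) continuous_id)

lemma integral_graphMeasure (hγ : Continuous γ) (G : EuclideanSpace ℝ (Fin d) → F) :
    ∫ x, G x ∂graphMeasure e γ = ∫ y, G (graphMap e γ y) :=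
  (isClosedEmbedding_graphMap hγ).measurableEmbedding.integral_map _

lemma setIntegral_aboveGraph (he : ‖e‖ = 1) (hγ : Continuous γ)
    (hγe : ∀ x (t : ℝ), γ (x + t • e) = γ x) {G : EuclideanSpace ℝ (Fin d) → F}
    (hG : Integrable G) :
    ∫ x in aboveGraph e γ, G x =
      ∫ y : (Submodule.span ℝ {e})ᗮ, ∫ t in Set.Ioi (0 : ℝ), G (graphMap e γ y + t • e) := by
  have hW := measurePreserving_graph_add_smul he hγ
  have hemb : MeasurableEmbedding (fun p : (Submodule.span ℝ {e})ᗮ × ℝ =>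
      (p.1 : EuclideanSpace ℝ (Fin d)) + (γ p.1 + p.2) • e) :=
    (continuous_graph_add_smul hγ).measurableEmbedding
      (injective_graph_add_smul he fun y => γ y)
  rw [← hW.setIntegral_preimage_emb hemb]
  have hpre : (fun p : (Submodule.span ℝ {e})ᗮ × ℝ =>
      (p.1 : EuclideanSpace ℝ (Fin d)) + (γ p.1 + p.2) • e) ⁻¹' aboveGraph e γ =
      Set.univ ×ˢ Set.Ioi (0 : ℝ) := by
    ext p
    simp [aboveGraph, hγe, inner_add_right, inner_smul_right, inner_eq_zero_of_orthogonal, he]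
  rw [hpre, setIntegral_prod]
  · simp [graphMap, add_smul, add_assoc]
  · exact ((hW.integrable_comp_emb hemb).2 hG).integrableOn

/-- The fundamental theorem of calculus along the lines in the direction `e`. -/
lemma setIntegral_aboveGraph_fderiv (he : ‖e‖ = 1) (hγ : Continuous γ)
    (hγe : ∀ x (t : ℝ), γ (x + t • e) = γ x) {G : EuclideanSpace ℝ (Fin d) → F}
    [CompleteSpace F] (hG : ContDiff ℝ 1 G) (hGs : HasCompactSupport G) :
    ∫ x in aboveGraph e γ, fderiv ℝ G x e = -∫ x, G x ∂graphMeasure e γ := by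
  rw [setIntegral_aboveGraph he hγ hγe, integral_graphMeasure hγ, ← integral_neg]
  · congr 1 with y
    have hc : IsClosedEmbedding (fun t : ℝ => graphMap e γ y + t • e) := by
      refine (Isometry.of_dist_eq fun s t => ?_).isClosedEmbedding
      simp [dist_eq_norm, ← sub_smul, norm_smul, he]
    have hd : ContDiff ℝ 1 (fun t : ℝ => G (graphMap e γ y + t • e)) := by fun_prop
    have := (hGs.comp_isClosedEmbedding hc).integral_Ioi_deriv_eq hd 0
    simp only [zero_smul, add_zero] at this
    rw [← this]
    congr 1 with t
    have h1 : HasDerivAt (fun t : ℝ => graphMap e γ y + t • e) e t := by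
      simpa using ((hasDerivAt_id t).smul_const e).const_add (graphMap e γ y)
    exact (((hG.differentiable one_ne_zero) _).hasFDerivAt.comp_hasDerivAt t h1).deriv.symm
  · exact ((hG.continuous_fderiv one_ne_zero).clm_apply continuous_const).integrable_of_hasCompactSupport
      (hGs.fderiv_apply (𝕜 := ℝ) e)

lemma measurePreserving_shear (he : ‖e‖ = 1) (hγ : Continuous γ)
    (hγe : ∀ x (t : ℝ), γ (x + t • e) = γ x) :
    MeasurePreserving (fun x => x + γ x • e) (volume : Measure (EuclideanSpace ℝ (Fin d)))
      volume := by
  have hT := measurePreserving_orthogonal_add_smul he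
  have hW := measurePreserving_graph_add_smul he hγ
  have hm : Continuous (fun x => x + γ x • e) := by fun_prop
  refine ⟨hm.measurable, ?_⟩
  conv_lhs => rw [← hT.map_eq]
  rw [Measure.map_map hm.measurable hT.measurable, ← hW.map_eq]
  congr 1 with p
  simp only [Function.comp_apply, hγe, add_smul]
  rw [add_assoc, add_comm (p.2 • e)]

lemma fderiv_add_smul (hγe : ∀ x (t : ℝ), γ (x + t • e) = γ x) (x : EuclideanSpace ℝ (Fin d))
    (t : ℝ) : fderiv ℝ γ (x + t • e) = fderiv ℝ γ x := by
  rw [← fderiv_comp_add_right]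
  congr 1 with x
  exact hγe x t

lemma fderiv_apply_self (hγ : ContDiff ℝ ∞ γ) (hγe : ∀ x (t : ℝ), γ (x + t • e) = γ x)
    (x : EuclideanSpace ℝ (Fin d)) : fderiv ℝ γ x e = 0 := by
  have h1 : HasDerivAt (fun t : ℝ => x + t • e) e 0 := by
    simpa using ((hasDerivAt_id (0 : ℝ)).smul_const e).const_add x
  have h2 := (((hγ.differentiable (by simp)) (x + (0 : ℝ) • e)).hasFDerivAt.comp_hasDerivAt 0 h1)
  have h3 : γ ∘ (fun t : ℝ => x + t • e) = fun _ => γ x := funext fun t => hγe x t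
  rw [h3] at h2
  simpa using h2.unique (hasDerivAt_const _ _)

/-- Above a graph, every first derivative of a compactly supported function has the same integral as
the derivative in the direction `e` weighted by a component of the conormal. With the fundamental
theorem of calculus in the direction `e`, this is the divergence theorem above a graph. -/
lemma setIntegral_aboveGraph_partialDeriv (he : ‖e‖ = 1) (hγ : ContDiff ℝ ∞ γ)
    (hγe : ∀ x (t : ℝ), γ (x + t • e) = γ x) {G : EuclideanSpace ℝ (Fin d) → F}
    [CompleteSpace F] (hG : ContDiff ℝ 1 G) (hGs : HasCompactSupport G) (i : Fin d) :
    ∫ x in aboveGraph e γ, partialDeriv i G x =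
      ∫ x in aboveGraph e γ, conormal e γ i x • fderiv ℝ G x e := by
  set v : EuclideanSpace ℝ (Fin d) := EuclideanSpace.single i (1 : ℝ) with hv
  set Φ : EuclideanSpace ℝ (Fin d) → EuclideanSpace ℝ (Fin d) := fun x => x + γ x • e with hΦ
  have hΦs : ContDiff ℝ ∞ Φ := by fun_prop
  have hMP := measurePreserving_shear he hγ.continuous hγe
  have hinj : Function.Injective Φ := by
    intro x y hxy
    have h1 : γ x = γ y := by
      have := congrArg γ hxy
      simpa [hΦ, hγe] using this
    simp only [hΦ, h1] at hxy
    exact add_right_cancel hxy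
  have hemb : MeasurableEmbedding Φ := hΦs.continuous.measurableEmbedding hinj
  have hcl : IsClosedEmbedding Φ := by
    let Ψ : EuclideanSpace ℝ (Fin d) ≃ₜ EuclideanSpace ℝ (Fin d) :=
      { toFun := Φ
        invFun := fun x => x - γ x • e
        left_inv := fun x => by simp [hΦ, hγe]
        right_inv := fun x => by
          have : γ (x - γ x • e) = γ x := by rw [sub_eq_add_neg, ← neg_smul, hγe]
          simp [hΦ, this]
        continuous_toFun := hΦs.continuous
        continuous_invFun := by have := hγ.continuous; fun_prop }
    exact Ψ.isClosedEmbedding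
  have hint : ∀ w, Integrable (fun x => fderiv ℝ G x w) := fun w =>
    ((hG.continuous_fderiv one_ne_zero).clm_apply continuous_const).integrable_of_hasCompactSupport
      (hGs.fderiv_apply (𝕜 := ℝ) w)
  have hint2 : Integrable (fun x => conormal e γ i x • fderiv ℝ G x e) := by
    refine Continuous.integrable_of_hasCompactSupport ?_ ?_
    · refine Continuous.smul ?_ ((hG.continuous_fderiv one_ne_zero).clm_apply continuous_const)
      have := (hγ.continuous_fderiv (by simp)).clm_apply (continuous_const (y := v))
      exact continuous_const.sub this
    · exact (hGs.fderiv_apply (𝕜 := ℝ) e).smul_left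
  change ∫ x in aboveGraph e γ, fderiv ℝ G x v = _
  rw [← sub_eq_zero, ← integral_sub (hint v).integrableOn hint2.integrableOn,
    ← hMP.setIntegral_preimage_emb hemb]
  -- the tangential part of the `i`-th basis vector
  set v' : EuclideanSpace ℝ (Fin d) := v - e i • e with hv'
  have hev : inner ℝ e v = e i := by simp [hv, EuclideanSpace.inner_single_right]
  have hev' : inner ℝ e v' = 0 := by
    rw [hv', inner_sub_right, inner_smul_right, hev, real_inner_self_eq_norm_sq, he]; ring
  have hpre : Φ ⁻¹' aboveGraph e γ = {x | 0 < inner ℝ e x} := by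
    ext x
    simp [aboveGraph, hΦ, hγe, inner_add_right, inner_smul_right, he]
  have hder : ∀ x, fderiv ℝ (G ∘ Φ) x v' =
      partialDeriv i G (Φ x) - conormal e γ i (Φ x) • fderiv ℝ G (Φ x) e := by
    intro x
    have h1 : HasFDerivAt Φ (ContinuousLinearMap.id ℝ _ + (fderiv ℝ γ x).smulRight e) x :=
      (hasFDerivAt_id x).add (((hγ.differentiable (by simp)) x).hasFDerivAt.smul_const e)
    have h2 := (((hG.differentiable one_ne_zero) (Φ x)).hasFDerivAt.comp x h1).fderiv
    rw [h2]
    have h3 : fderiv ℝ γ (Φ x) = fderiv ℝ γ x := fderiv_add_smul hγe x _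
    simp only [ContinuousLinearMap.comp_apply, add_apply,
      ContinuousLinearMap.id_apply, ContinuousLinearMap.smulRight_apply, partialDeriv, conormal,
      h3, hv', map_sub, map_smul, map_add, fderiv_apply_self hγ hγe, ← hv]
    simp only [zero_smul, add_zero, sub_smul]
    abel
  have hGΦ : HasCompactSupport (G ∘ Φ) := hGs.comp_isClosedEmbedding hcl
  have hGΦ1 : ContDiff ℝ 1 (G ∘ Φ) := hG.comp (hΦs.of_le (by simp))
  rw [hpre]
  have hcongr : (fun x => fderiv ℝ G (x + γ x • e) v - conormal e γ i (x + γ x • e) •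
      fderiv ℝ G (x + γ x • e) e) = fun x => fderiv ℝ (G ∘ Φ) x v' :=
    funext fun x => (hder x).symm
  rw [hcongr]
  rw [← integral_indicator (isOpen_lt continuous_const (by fun_prop)).measurableSet]
  have hI : Integrable (fun x => fderiv ℝ (G ∘ Φ) x v') :=
    ((hGΦ1.continuous_fderiv one_ne_zero).clm_apply continuous_const).integrable_of_hasCompactSupport
      (hGΦ.fderiv_apply (𝕜 := ℝ) v')
  have hms : MeasurableSet {x : EuclideanSpace ℝ (Fin d) | 0 < inner ℝ e x} :=
    (isOpen_lt continuous_const (by fun_prop)).measurableSet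
  have key := integral_bilinear_hasLineDerivAt_right_eq_neg_left_of_integrable
    (μ := (volume : Measure (EuclideanSpace ℝ (Fin d)))) (B := ContinuousLinearMap.lsmul ℝ ℝ)
    (f := Set.indicator {x : EuclideanSpace ℝ (Fin d) | 0 < inner ℝ e x} (fun _ => (1 : ℝ)))
    (f' := fun _ => 0) (g := G ∘ Φ) (g' := fun x => fderiv ℝ (G ∘ Φ) x v') (v := v')
    (by simp) ?_ ?_ ?_ ?_
  · simp only [ContinuousLinearMap.lsmul_apply, zero_smul, integral_zero, neg_zero] at key
    rw [← key]
    congr 1 with x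
    by_cases hx : 0 < inner ℝ e x <;> simp [Set.indicator, hx]
  · refine (hI.indicator hms).congr (Eventually.of_forall fun x => ?_)
    by_cases hx : 0 < inner ℝ e x <;> simp [Set.indicator, hx]
  · refine ((hGΦ1.continuous.integrable_of_hasCompactSupport hGΦ).indicator hms).congr
      (Eventually.of_forall fun x => ?_)
    by_cases hx : 0 < inner ℝ e x <;> simp [Set.indicator, hx]
  · intro x _
    -- the half space is invariant under translations along `v'`
    have : (fun t : ℝ => Set.indicator {x : EuclideanSpace ℝ (Fin d) | 0 < inner ℝ e x}
        (fun _ => (1 : ℝ)) (x + t • v')) = fun _ =>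
        Set.indicator {x : EuclideanSpace ℝ (Fin d) | 0 < inner ℝ e x} (fun _ => (1 : ℝ)) x := by
      funext t
      simp [Set.indicator, inner_add_right, inner_smul_right, hev']
    rw [HasLineDerivAt, this]
    exact hasDerivAt_const _ _
  · intro x _
    exact ((hGΦ1.differentiable one_ne_zero) x).hasFDerivAt.hasLineDerivAt v'

end Graph

/-! ### Surface measure in a chart -/

section Chart

variable {d : ℕ} {Ω : Set (EuclideanSpace ℝ (Fin d))} {x₀ e : EuclideanSpace ℝ (Fin d)} {r : ℝ}
  {γ : EuclideanSpace ℝ (Fin d) → ℝ}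

lemma frontier_aboveGraph (he : ‖e‖ = 1) (hγ : Continuous γ)
    (hγe : ∀ x (t : ℝ), γ (x + t • e) = γ x) :
    frontier (aboveGraph e γ) = {x | γ x = inner ℝ e x} := by
  refine (frontier_lt_subset_eq hγ (by fun_prop)).antisymm fun x (hx : γ x = inner ℝ e x) => ?_
  change x ∈ frontier (aboveGraph e γ)
  rw [(isOpen_aboveGraph hγ).frontier_eq]
  refine ⟨?_, fun h => absurd hx (ne_of_lt h)⟩
  have h1 : Tendsto (fun t : ℝ => x + t • e) (𝓝[>] 0) (𝓝 x) := by
    have : Tendsto (fun t : ℝ => x + t • e) (𝓝 0) (𝓝 (x + (0 : ℝ) • e)) :=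
      Continuous.tendsto (by fun_prop) 0
    rw [zero_smul, add_zero] at this
    exact this.mono_left nhdsWithin_le_nhds
  refine mem_closure_of_tendsto h1 ?_
  filter_upwards [self_mem_nhdsWithin] with t (ht : 0 < t)
  simp [aboveGraph, hγe, inner_add_right, inner_smul_right, he, hx, ht]

lemma IsGraphChart.inter_ball (h : IsGraphChart Ω x₀ r e γ) :
    Ω ∩ Metric.ball x₀ r = aboveGraph e γ ∩ Metric.ball x₀ r := by
  ext x
  exact ⟨fun hx => ⟨(h.mem_iff x hx.2).1 hx.1, hx.2⟩, fun hx => ⟨(h.mem_iff x hx.2).2 hx.1, hx.2⟩⟩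

lemma IsGraphChart.mem_frontier_iff (h : IsGraphChart Ω x₀ r e γ) {x : EuclideanSpace ℝ (Fin d)}
    (hx : x ∈ Metric.ball x₀ r) : x ∈ frontier Ω ↔ γ x = inner ℝ e x := by
  have h1 := frontier_inter_open_inter (s := Ω) (Metric.isOpen_ball (x := x₀) (ε := r))
  rw [h.inter_ball, frontier_inter_open_inter Metric.isOpen_ball,
    frontier_aboveGraph h.norm_eq_one h.contDiff.continuous h.add_smul] at h1
  have h2 := Set.ext_iff.1 h1 x
  simp only [Set.mem_inter_iff, hx, and_true] at h2
  exact h2.symm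

lemma finrank_orthogonal_span (he : ‖e‖ = 1) :
    Module.finrank ℝ (Submodule.span ℝ {e})ᗮ = d - 1 := by
  have h0 : e ≠ 0 := fun h => by simp [h] at he
  have h1 := (Submodule.span ℝ {e}).finrank_add_finrank_orthogonal
  rw [finrank_span_singleton h0, finrank_euclideanSpace_fin] at h1
  omega

lemma volume_orthogonal_span (he : ‖e‖ = 1) :
    (volume : Measure (Submodule.span ℝ {e})ᗮ) = Measure.euclideanHausdorffMeasure (d - 1) := by
  rw [← InnerProductSpace.euclideanHausdorffMeasure_eq_volume, finrank_orthogonal_span he]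

lemma euclideanHausdorffMeasure_image_le {X Y : Type*} [MetricSpace X] [MeasurableSpace X]
    [BorelSpace X] [MetricSpace Y] [MeasurableSpace Y] [BorelSpace Y] {f : X → Y} {K : NNReal}
    {s : Set X} (hf : LipschitzOnWith K f s) (m : ℕ) :
    Measure.euclideanHausdorffMeasure m (f '' s) ≤
      (K : ENNReal) ^ m * Measure.euclideanHausdorffMeasure m s := by
  have h := hf.hausdorffMeasure_image_le (d := m) (by positivity)
  simp only [Measure.euclideanHausdorffMeasure_def, Measure.smul_apply, ENNReal.smul_def,
    smul_eq_mul]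
  rw [mul_left_comm]
  gcongr
  simpa using h

/-- In a chart, the graph measure is bounded by surface measure: the projection along `e` does not
increase distances. -/
lemma IsGraphChart.graphMeasure_restrict_le (h : IsGraphChart Ω x₀ r e γ) :
    (graphMeasure e γ).restrict (Metric.ball x₀ r) ≤ surfaceMeasure Ω := by
  refine Measure.le_iff.2 fun A hA => ?_
  have hcont := continuous_graphMap (e := e) h.contDiff.continuous
  have hP : ∀ y, (Submodule.span ℝ {e})ᗮ.orthogonalProjectionOnto (graphMap e γ y) = y := by
    intro y
    have he : (Submodule.span ℝ {e})ᗮ.orthogonalProjectionOnto e = 0 :=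
      Submodule.orthogonalProjectionOnto_orthogonal_apply_eq_zero
        (Submodule.mem_span_singleton_self e)
    rw [graphMap, map_add, map_smul, he]
    simp
  rw [Measure.restrict_apply hA, graphMeasure, Measure.map_apply hcont.measurable
    (hA.inter measurableSet_ball), volume_orthogonal_span h.norm_eq_one, surfaceMeasure,
    Measure.restrict_apply hA]
  set S := graphMap e γ ⁻¹' (A ∩ Metric.ball x₀ r) with hS
  have hS2 : S = (Submodule.span ℝ {e})ᗮ.orthogonalProjectionOnto '' (graphMap e γ '' S) := by
    rw [Set.image_image]
    simp [hP]
  have hlip := ((Submodule.span ℝ {e})ᗮ.lipschitzWith_orthogonalProjectionOnto).lipschitzOnWith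
    (s := graphMap e γ '' S)
  have h1 := euclideanHausdorffMeasure_image_le hlip (d - 1)
  rw [← hS2] at h1
  refine h1.trans ?_
  simp only [ENNReal.coe_one, one_pow, one_mul]
  refine measure_mono ?_
  rintro x ⟨y, hy, rfl⟩
  refine ⟨hy.1, (h.mem_frontier_iff hy.2).2 ?_⟩
  simp [graphMap, h.add_smul, inner_add_right, inner_smul_right, inner_eq_zero_of_orthogonal,
    h.norm_eq_one]

/-- In a chart, surface measure is bounded by a multiple of the graph measure: the parametrization
of the graph is Lipschitz. -/
lemma IsGraphChart.exists_surfaceMeasure_restrict_le (h : IsGraphChart Ω x₀ r e γ) :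
    ∃ K : NNReal, (surfaceMeasure Ω).restrict (Metric.ball x₀ r) ≤ K • graphMeasure e γ := by
  have hsm : ContDiff ℝ 1 (graphMap e γ) := by
    have h1 : ContDiff ℝ 1 γ := h.contDiff.of_le (by simp)
    have h2 : ContDiff ℝ 1 (fun y : (Submodule.span ℝ {e})ᗮ => (y : EuclideanSpace ℝ (Fin d))) :=
      (Submodule.span ℝ {e})ᗮ.subtypeL.contDiff
    exact h2.add ((h1.comp h2).smul contDiff_const)
  set P := (Submodule.span ℝ {e})ᗮ.orthogonalProjectionOnto with hP
  obtain ⟨K, hK⟩ := LocallyLipschitzOn.exists_lipschitzOnWith_of_compact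
    (isCompact_closedBall (P x₀) r) hsm.locallyLipschitz.locallyLipschitzOn
  refine ⟨K ^ (d - 1), Measure.le_iff.2 fun A hA => ?_⟩
  have hcont := continuous_graphMap (e := e) h.contDiff.continuous
  rw [Measure.smul_apply, graphMeasure, Measure.map_apply hcont.measurable hA,
    volume_orthogonal_span h.norm_eq_one, surfaceMeasure,
    Measure.restrict_apply hA, Measure.restrict_apply (hA.inter measurableSet_ball),
    ENNReal.smul_def, smul_eq_mul, ENNReal.coe_pow]
  have hsub : A ∩ Metric.ball x₀ r ∩ frontier Ω ⊆
      graphMap e γ '' (graphMap e γ ⁻¹' A ∩ Metric.closedBall (P x₀) r) := by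
    rintro x ⟨⟨hxA, hxB⟩, hxf⟩
    have hx := (h.mem_frontier_iff hxB).1 hxf
    have hdec : (P x : EuclideanSpace ℝ (Fin d)) = x - inner ℝ e x • e := by
      have h1 := (Submodule.span ℝ {e}).starProjection_add_starProjection_orthogonal x
      have h2 := Submodule.starProjection_unit_singleton ℝ h.norm_eq_one x
      rw [h2] at h1
      exact eq_sub_of_add_eq' h1
    have hγx : γ (P x) = γ x := by
      rw [hdec, sub_eq_add_neg, ← neg_smul, h.add_smul]
    have hx2 : graphMap e γ (P x) = x := by
      rw [graphMap, hγx, hdec, hx, sub_add_cancel]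
    refine ⟨P x, ⟨?_, ?_⟩, hx2⟩
    · rwa [Set.mem_preimage, hx2]
    · rw [Metric.mem_closedBall]
      have := ((Submodule.span ℝ {e})ᗮ.lipschitzWith_orthogonalProjectionOnto).dist_le_mul x x₀
      simp only [NNReal.coe_one, one_mul] at this
      exact this.trans (Metric.mem_ball.1 hxB).le
  refine (measure_mono hsub).trans
    ((euclideanHausdorffMeasure_image_le (hK.mono Set.inter_subset_right) (d - 1)).trans ?_)
  gcongr
  exact Set.inter_subset_left

end Chart

/-! ### Convergence in `L²` -/

section L2

variable {α : Type*} {m0 : MeasurableSpace α} {μ ν : Measure α} {f f' : ℕ → α → ℂ} {g g' : α → ℂ}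

/-- The sequence `f` of square integrable functions converges to `g` in `L²(μ)`. -/
structure L2Tendsto (μ : Measure α) (f : ℕ → α → ℂ) (g : α → ℂ) : Prop where
  memLp : ∀ k, MemLp (f k) 2 μ
  memLp_limit : MemLp g 2 μ
  tendsto : Tendsto (fun k => eLpNorm (fun x => f k x - g x) 2 μ) atTop (𝓝 0)

lemma L2Tendsto.const (hg : MemLp g 2 μ) : L2Tendsto μ (fun _ => g) g :=
  ⟨fun _ => hg, hg, by simp⟩

lemma L2Tendsto.add (h : L2Tendsto μ f g) (h' : L2Tendsto μ f' g') :
    L2Tendsto μ (fun k x => f k x + f' k x) (fun x => g x + g' x) := by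
  refine ⟨fun k => (h.memLp k).add (h'.memLp k), h.memLp_limit.add h'.memLp_limit, ?_⟩
  have h2 := h.tendsto.add h'.tendsto
  rw [add_zero] at h2
  refine tendsto_of_tendsto_of_tendsto_of_le_of_le tendsto_const_nhds h2 (fun _ => zero_le)
    fun k => ?_
  have := eLpNorm_add_le ((h.memLp k).sub h.memLp_limit).1 ((h'.memLp k).sub h'.memLp_limit).1
    (p := 2) (by norm_num)
  refine le_trans (le_of_eq ?_) this
  congr 1
  ext x
  simp only [Pi.add_apply, Pi.sub_apply]
  ring

lemma L2Tendsto.sum {ι : Type*} (s : Finset ι) {f : ι → ℕ → α → ℂ} {g : ι → α → ℂ}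
    (h : ∀ i ∈ s, L2Tendsto μ (f i) (g i)) :
    L2Tendsto μ (fun k x => ∑ i ∈ s, f i k x) (fun x => ∑ i ∈ s, g i x) := by
  classical
  induction s using Finset.induction_on with
  | empty => simpa using L2Tendsto.const (MemLp.zero' (p := 2) (μ := μ))
  | insert a s ha ih =>
    simp only [Finset.sum_insert ha]
    exact (h a (Finset.mem_insert_self a s)).add
      (ih fun i hi => h i (Finset.mem_insert_of_mem hi))

lemma L2Tendsto.mul_top (h : L2Tendsto μ f g) {b : α → ℂ} (hb : MemLp b ⊤ μ) :
    L2Tendsto μ (fun k x => b x * f k x) (fun x => b x * g x) := by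
  refine ⟨fun k => (h.memLp k).mul' hb, h.memLp_limit.mul' hb, ?_⟩
  have h2 := ENNReal.Tendsto.const_mul h.tendsto (a := eLpNorm b ⊤ μ) (Or.inr hb.2.ne)
  rw [mul_zero] at h2
  refine tendsto_of_tendsto_of_tendsto_of_le_of_le tendsto_const_nhds h2 (fun _ => zero_le)
    fun k => ?_
  have := eLpNorm_smul_le_eLpNorm_top_mul_eLpNorm 2 ((h.memLp k).sub h.memLp_limit).1 b
  refine le_trans (le_of_eq ?_) this
  congr 1
  ext x
  simp only [Pi.smul_apply', Pi.sub_apply, smul_eq_mul]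
  ring

lemma L2Tendsto.const_mul (h : L2Tendsto μ f g) (b : ℂ) :
    L2Tendsto μ (fun k x => b * f k x) (fun x => b * g x) :=
  h.mul_top (memLp_top_const b)

lemma L2Tendsto.sub (h : L2Tendsto μ f g) (h' : L2Tendsto μ f' g') :
    L2Tendsto μ (fun k x => f k x - f' k x) (fun x => g x - g' x) := by
  simpa [sub_eq_add_neg] using h.add (h'.const_mul (-1))

lemma L2Tendsto.conj (h : L2Tendsto μ f g) :
    L2Tendsto μ (fun k x => (starRingEnd ℂ) (f k x)) (fun x => (starRingEnd ℂ) (g x)) := by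
  refine ⟨fun k => (h.memLp k).star, h.memLp_limit.star, ?_⟩
  refine h.tendsto.congr fun k => eLpNorm_congr_norm_ae (Eventually.of_forall fun x => ?_)
  rw [← map_sub, RCLike.norm_conj]

lemma L2Tendsto.mono_measure (h : L2Tendsto μ f g) (hν : ν ≤ μ) : L2Tendsto ν f g :=
  ⟨fun k => (h.memLp k).mono_measure hν, h.memLp_limit.mono_measure hν,
    tendsto_of_tendsto_of_tendsto_of_le_of_le tendsto_const_nhds h.tendsto (fun _ => zero_le)
      fun _ => eLpNorm_mono_measure _ hν⟩

lemma L2Tendsto.congr (h : L2Tendsto μ f g) (hf : ∀ k, f k =ᵐ[μ] f' k) (hg : g =ᵐ[μ] g') :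
    L2Tendsto μ f' g' := by
  refine ⟨fun k => (h.memLp k).ae_eq (hf k), h.memLp_limit.ae_eq hg, ?_⟩
  refine h.tendsto.congr fun k => eLpNorm_congr_ae ?_
  filter_upwards [hf k, hg] with x h1 h2
  rw [h1, h2]

lemma L2Tendsto.ae_unique (h : L2Tendsto μ f g) (h' : L2Tendsto μ f g') : g =ᵐ[μ] g' := by
  have h1 := (h.sub h').tendsto
  have h2 : eLpNorm (fun x => g x - g' x) 2 μ = 0 := by
    refine tendsto_nhds_unique (tendsto_const_nhds (f := (atTop : Filter ℕ))) (h1.congr fun k => ?_)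
    rw [← eLpNorm_neg]
    congr 1
    ext x
    simp
  rw [eLpNorm_eq_zero_iff (f := fun x => g x - g' x) (h.memLp_limit.sub h'.memLp_limit).1 (by norm_num)] at h2
  filter_upwards [h2] with x hx
  exact sub_eq_zero.1 hx

/-- The integral of a product is continuous with respect to convergence in `L²`. -/
lemma L2Tendsto.integral_mul (h : L2Tendsto μ f g) (h' : L2Tendsto μ f' g') :
    Tendsto (fun k => ∫ x, f k x * f' k x ∂μ) atTop (𝓝 (∫ x, g x * g' x ∂μ)) := by
  refine tendsto_integral_of_L1' (fun x => g x * g' x) (h.memLp_limit.1.mul h'.memLp_limit.1)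
    (Eventually.of_forall fun k => (h.memLp k).integrable_mul (h'.memLp k)) ?_
  -- `f f' - g g' = (f - g)(f' - g') + (f - g) g' + g (f' - g')`
  have hHolder : ∀ {a b : α → ℂ}, MemLp a 2 μ → MemLp b 2 μ →
      eLpNorm (fun x => a x * b x) 1 μ ≤ eLpNorm a 2 μ * eLpNorm b 2 μ := fun {a b} ha hb => by
    have h1 := eLpNorm_smul_le_mul_eLpNorm (p := 2) (q := 2) (r := 1) hb.1 ha.1
    have h2 : (fun x => a x * b x) = a • b := by ext x; simp
    rwa [h2]
  have hlim : Tendsto (fun k =>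
      eLpNorm (fun x => f k x - g x) 2 μ * eLpNorm (fun x => f' k x - g' x) 2 μ +
      (eLpNorm (fun x => f k x - g x) 2 μ * eLpNorm g' 2 μ +
      eLpNorm g 2 μ * eLpNorm (fun x => f' k x - g' x) 2 μ)) atTop (𝓝 (0 * 0 + (0 * eLpNorm g' 2 μ +
      eLpNorm g 2 μ * 0))) := by
    refine (ENNReal.Tendsto.mul h.tendsto (Or.inr (by simp)) h'.tendsto (Or.inr (by simp))).add
      ((ENNReal.Tendsto.mul_const h.tendsto (Or.inr h'.memLp_limit.2.ne)).add
      (ENNReal.Tendsto.const_mul h'.tendsto (Or.inr h.memLp_limit.2.ne)))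
  simp only [mul_zero, zero_mul, add_zero] at hlim
  refine tendsto_of_tendsto_of_tendsto_of_le_of_le tendsto_const_nhds hlim (fun _ => zero_le)
    fun k => ?_
  have hs := (h.memLp k).sub h.memLp_limit
  have hs' := (h'.memLp k).sub h'.memLp_limit
  have heq : ((fun x => f k x * f' k x) - fun x => g x * g' x) =
      (fun x => (f k x - g x) * (f' k x - g' x)) +
      ((fun x => (f k x - g x) * g' x) + (fun x => g x * (f' k x - g' x))) := by
    ext x
    simp only [Pi.sub_apply, Pi.add_apply]
    ring
  rw [heq]
  refine (eLpNorm_add_le (hs.1.mul hs'.1) ((hs.1.mul h'.memLp_limit.1).add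
    (h.memLp_limit.1.mul hs'.1)) le_rfl).trans (add_le_add (hHolder hs hs') ?_)
  exact (eLpNorm_add_le (hs.1.mul h'.memLp_limit.1)
    (h.memLp_limit.1.mul hs'.1) le_rfl).trans
    (add_le_add (hHolder hs h'.memLp_limit) (hHolder h.memLp_limit hs'))

lemma integral_mul_conj_self (g : α → ℂ) :
    ∫ x, g x * (starRingEnd ℂ) (g x) ∂μ = ((∫ x, ‖g x‖ ^ 2 ∂μ : ℝ) : ℂ) := by
  rw [← integral_complex_ofReal]
  congr 1 with x
  rw [Complex.mul_conj, Complex.normSq_eq_norm_sq]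

lemma L2Tendsto.integral_norm_sq (h : L2Tendsto μ f g) :
    Tendsto (fun k => ∫ x, ‖f k x‖ ^ 2 ∂μ) atTop (𝓝 (∫ x, ‖g x‖ ^ 2 ∂μ)) := by
  have h1 := h.integral_mul h.conj
  simp only [integral_mul_conj_self] at h1
  simpa [Function.comp_def] using (Complex.continuous_re.tendsto _).comp h1

lemma eLpNorm_two_sq {f : α → ℂ} (hf : MemLp f 2 μ) :
    eLpNorm f 2 μ ^ 2 = ENNReal.ofReal (∫ x, ‖f x‖ ^ 2 ∂μ) := by
  have hi : Integrable (fun x => ‖f x‖ ^ 2) μ := hf.integrable_norm_pow (by norm_num)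
  rw [ofReal_integral_eq_lintegral_ofReal hi (Eventually.of_forall fun x => by positivity)]
  have := eLpNorm_nnreal_pow_eq_lintegral (p := 2) (f := f) (μ := μ) (by norm_num)
  simp only [NNReal.coe_ofNat, ENNReal.coe_ofNat] at this
  have h2 : eLpNorm f 2 μ ^ (2 : ℝ) = eLpNorm f 2 μ ^ 2 := by
    rw [← ENNReal.rpow_natCast]; norm_num
  rw [← h2, this]
  congr 1 with x
  rw [ENNReal.ofReal_pow (norm_nonneg _), ofReal_norm, ← ENNReal.rpow_natCast]
  norm_num

lemma L2Tendsto.of_integral_norm_sq (hf : ∀ k, MemLp (f k) 2 μ) (hg : MemLp g 2 μ)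
    (h : Tendsto (fun k => ∫ x, ‖f k x - g x‖ ^ 2 ∂μ) atTop (𝓝 0)) : L2Tendsto μ f g := by
  refine ⟨hf, hg, ?_⟩
  have h1 : Tendsto (fun k => eLpNorm (fun x => f k x - g x) 2 μ ^ 2) atTop (𝓝 0) := by
    have := ENNReal.tendsto_ofReal h
    rw [ENNReal.ofReal_zero] at this
    exact this.congr fun k => (eLpNorm_two_sq ((hf k).sub hg)).symm
  have h2 := (ENNReal.continuous_rpow_const (y := 1 / 2)).tendsto 0 |>.comp h1
  simp only [one_div, ENNReal.zero_rpow_of_pos (by norm_num : (0 : ℝ) < 2⁻¹)] at h2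
  refine h2.congr fun k => ?_
  simp only [Function.comp_apply, ← ENNReal.rpow_natCast]
  rw [← ENNReal.rpow_mul]
  norm_num

lemma L2Tendsto.tendsto_integral_norm_sub_sq (h : L2Tendsto μ f g) :
    Tendsto (fun k => ∫ x, ‖f k x - g x‖ ^ 2 ∂μ) atTop (𝓝 0) := by
  simpa using (h.sub (L2Tendsto.const h.memLp_limit)).integral_norm_sq

/-- The Cauchy-Schwarz inequality. -/
lemma norm_integral_mul_le {f g : α → ℂ} (hf : MemLp f 2 μ) (hg : MemLp g 2 μ) :
    ‖∫ x, f x * g x ∂μ‖ ≤ √(∫ x, ‖f x‖ ^ 2 ∂μ) * √(∫ x, ‖g x‖ ^ 2 ∂μ) := by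
  refine (norm_integral_le_integral_norm _).trans ?_
  have := integral_mul_norm_le_Lp_mul_Lq (p := 2) (q := 2) (f := f) (g := g) (μ := μ)
    (by constructor <;> norm_num) (by simpa using hf) (by simpa using hg)
  simpa [Real.sqrt_eq_rpow] using this

end L2

/-! ### Mollification -/

/-- A smooth mollification kernel supported near `a`, within distance `ε`. -/
structure IsMollifier {d : ℕ} (ρ : EuclideanSpace ℝ (Fin d) → ℝ) (a : EuclideanSpace ℝ (Fin d))
    (ε : ℝ) : Prop where
  contDiff : ContDiff ℝ ∞ ρ
  nonneg : ∀ x, 0 ≤ ρ x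
  integral_eq_one : ∫ x, ρ x = 1
  tsupport_subset : tsupport ρ ⊆ Metric.closedBall a ε

/-- The convolution of `f` with the kernel `ρ`. -/
noncomputable def mollify {d : ℕ} (ρ : EuclideanSpace ℝ (Fin d) → ℝ)
    (f : EuclideanSpace ℝ (Fin d) → ℂ) : EuclideanSpace ℝ (Fin d) → ℂ :=
  convolution ρ f (ContinuousLinearMap.lsmul ℝ ℝ) volume

section Mollify

variable {d : ℕ} {ρ : EuclideanSpace ℝ (Fin d) → ℝ} {a : EuclideanSpace ℝ (Fin d)} {ε : ℝ}
  {f : EuclideanSpace ℝ (Fin d) → ℂ}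

lemma exists_isMollifier (a : EuclideanSpace ℝ (Fin d)) (hε : 0 < ε) :
    ∃ ρ : EuclideanSpace ℝ (Fin d) → ℝ, IsMollifier ρ a ε := by
  let b : ContDiffBump a := ⟨ε / 2, ε, by positivity, by linarith⟩
  exact ⟨b.normed volume, b.contDiff_normed, b.nonneg_normed, b.integral_normed,
    (b.tsupport_normed_eq (μ := volume)).subset⟩

lemma IsMollifier.hasCompactSupport (h : IsMollifier ρ a ε) : HasCompactSupport ρ :=
  (isCompact_closedBall a ε).of_isClosed_subset (isClosed_tsupport ρ) h.tsupport_subset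

lemma IsMollifier.integrable (h : IsMollifier ρ a ε) : Integrable ρ :=
  h.contDiff.continuous.integrable_of_hasCompactSupport h.hasCompactSupport

lemma mollify_apply (x : EuclideanSpace ℝ (Fin d)) :
    mollify ρ f x = ∫ y, ρ y • f (x - y) := rfl

lemma mollify_apply_swap (x : EuclideanSpace ℝ (Fin d)) :
    mollify ρ f x = ∫ w, ρ (x - w) • f w :=
  convolution_eq_swap _

lemma IsMollifier.contDiff_mollify (h : IsMollifier ρ a ε) (hf : LocallyIntegrable f) :
    ContDiff ℝ ∞ (mollify ρ f) :=
  h.hasCompactSupport.contDiff_convolution_left _ h.contDiff hf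

/-- The kernel `ρ` as a probability measure. -/
noncomputable def kernelMeasure {d : ℕ} (ρ : EuclideanSpace ℝ (Fin d) → ℝ) :
    Measure (EuclideanSpace ℝ (Fin d)) :=
  volume.withDensity fun x => ENNReal.ofReal (ρ x)

lemma IsMollifier.isProbabilityMeasure (h : IsMollifier ρ a ε) :
    IsProbabilityMeasure (kernelMeasure ρ) := by
  refine ⟨?_⟩
  rw [kernelMeasure, withDensity_apply _ MeasurableSet.univ, Measure.restrict_univ,
    ← ofReal_integral_eq_lintegral_ofReal h.integrable (Eventually.of_forall h.nonneg),
    h.integral_eq_one, ENNReal.ofReal_one]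

lemma IsMollifier.mollify_eq_integral (h : IsMollifier ρ a ε) (x : EuclideanSpace ℝ (Fin d)) :
    mollify ρ f x = ∫ y, f (x - y) ∂kernelMeasure ρ := by
  rw [kernelMeasure, integral_withDensity_eq_integral_toReal_smul
    (h.contDiff.continuous.measurable.ennreal_ofReal) (by simp), mollify_apply]
  simp [ENNReal.toReal_ofReal (h.nonneg _)]

/-- Young's inequality for a kernel of integral one. -/
lemma IsMollifier.eLpNorm_mollify_le (h : IsMollifier ρ a ε) (hf : MemLp f 2) :
    eLpNorm (mollify ρ f) 2 ≤ eLpNorm f 2 := by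
  -- a strongly measurable representative makes Tonelli's theorem directly applicable
  obtain ⟨g, hg, hfg⟩ := hf.1
  have hmol : mollify ρ f = mollify ρ g := by
    ext1 x
    rw [mollify_apply_swap, mollify_apply_swap]
    refine integral_congr_ae ?_
    filter_upwards [hfg] with w hw
    rw [hw]
  rw [hmol, eLpNorm_congr_ae hfg]
  have := h.isProbabilityMeasure
  have hpt : ∀ x, ‖mollify ρ g x‖ₑ ^ 2 ≤ ∫⁻ y, ‖g (x - y)‖ₑ ^ 2 ∂kernelMeasure ρ := by
    intro x
    have hm : AEStronglyMeasurable (fun y => g (x - y)) (kernelMeasure ρ) :=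
      (hg.comp_measurable (by fun_prop)).aestronglyMeasurable
    rw [h.mollify_eq_integral]
    have h1 : ‖∫ y, g (x - y) ∂kernelMeasure ρ‖ₑ ≤ eLpNorm (fun y => g (x - y)) 2
        (kernelMeasure ρ) :=
      (enorm_integral_le_lintegral_enorm _).trans (by
        rw [← eLpNorm_one_eq_lintegral_enorm]
        exact eLpNorm_le_eLpNorm_of_exponent_le (by norm_num) hm)
    have h2 := eLpNorm_nnreal_pow_eq_lintegral (p := 2) (f := fun y => g (x - y))
      (μ := kernelMeasure ρ) (by norm_num)
    simp only [NNReal.coe_ofNat, ENNReal.coe_ofNat, ENNReal.rpow_ofNat] at h2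
    rw [← h2]
    gcongr
  have h2 : ∀ u : EuclideanSpace ℝ (Fin d) → ℂ, eLpNorm u 2 ^ 2 = ∫⁻ x, ‖u x‖ₑ ^ 2 := by
    intro u
    have h2 := eLpNorm_nnreal_pow_eq_lintegral (p := 2) (f := u)
      (μ := volume) (by norm_num)
    simpa only [NNReal.coe_ofNat, ENNReal.coe_ofNat, ENNReal.rpow_ofNat] using h2
  have h3 : eLpNorm (mollify ρ g) 2 ^ 2 ≤ eLpNorm g 2 ^ 2 := by
    rw [h2, h2]
    refine (lintegral_mono hpt).trans ?_
    rw [lintegral_lintegral_swap]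
    · have h4 : ∀ y : EuclideanSpace ℝ (Fin d),
          ∫⁻ x, ‖g (x - y)‖ₑ ^ 2 = ∫⁻ x, ‖g x‖ₑ ^ 2 := fun y =>
        lintegral_sub_right_eq_self (fun x => ‖g x‖ₑ ^ 2) y
      simp_rw [h4]
      simp
    · exact ((hg.comp_measurable (measurable_fst.sub measurable_snd)).enorm.pow_const 2).aemeasurable
  exact (ENNReal.pow_le_pow_left_iff (by norm_num)).1 h3

lemma IsMollifier.memLp_mollify (h : IsMollifier ρ a ε) (hf : MemLp f 2) :
    MemLp (mollify ρ f) 2 :=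
  ⟨(h.contDiff_mollify (hf.locallyIntegrable (by norm_num))).continuous.aestronglyMeasurable,
    (h.eLpNorm_mollify_le hf).trans_lt hf.2⟩

lemma IsMollifier.mollify_sub (h : IsMollifier ρ a ε) {f g : EuclideanSpace ℝ (Fin d) → ℂ}
    (hf : MemLp f 2) (hg : MemLp g 2) :
    mollify ρ (f - g) = mollify ρ f - mollify ρ g := by
  ext1 x
  have h1 : ∀ {f : EuclideanSpace ℝ (Fin d) → ℂ}, MemLp f 2 →
      Integrable (fun w => ρ w • f (x - w)) := fun hf =>
    h.hasCompactSupport.convolutionExists_left (ContinuousLinearMap.lsmul ℝ ℝ)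
      h.contDiff.continuous (hf.locallyIntegrable (by norm_num)) x
  rw [Pi.sub_apply, mollify_apply, mollify_apply, mollify_apply, ← integral_sub (h1 hf) (h1 hg)]
  simp [smul_sub]

/-- Mollification with kernels concentrating at the origin converges in `L²`. -/
lemma tendsto_mollify {ρ : ℕ → EuclideanSpace ℝ (Fin d) → ℝ} {a : ℕ → EuclideanSpace ℝ (Fin d)}
    {ε : ℕ → ℝ} (h : ∀ k, IsMollifier (ρ k) (a k) (ε k)) (ha : Tendsto a atTop (𝓝 0))
    (hε : Tendsto ε atTop (𝓝 0)) (hf : MemLp f 2) :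
    L2Tendsto volume (fun k => mollify (ρ k) f) f := by
  refine ⟨fun k => (h k).memLp_mollify hf, hf, ?_⟩
  rw [ENNReal.tendsto_nhds_zero]
  intro η hη
  have hη3 : η / 3 ≠ 0 := (ENNReal.div_pos hη.ne' (by norm_num)).ne'
  obtain ⟨g, hgs, hfg, hgc, hg⟩ := hf.exists_hasCompactSupport_eLpNorm_sub_le (by norm_num) hη3
  set K := Metric.cthickening 1 (tsupport g) with hK
  have hKc : IsCompact K := hgs.isCompact.cthickening
  -- uniform smallness on a fixed compact set gives smallness in `L²`
  obtain ⟨t, ht0, ht⟩ : ∃ t : ℝ, 0 < t ∧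
      ENNReal.ofReal t * volume K ^ (1 / 2 : ℝ) ≤ η / 3 := by
    have hV : volume K ^ (1 / 2 : ℝ) ≠ ⊤ :=
      ENNReal.rpow_ne_top_of_nonneg (by norm_num) hKc.measure_lt_top.ne
    have h1 : Tendsto (fun t : ℝ => ENNReal.ofReal t * volume K ^ (1 / 2 : ℝ)) (𝓝[>] 0) (𝓝 0) := by
      have h0 : Tendsto (fun t : ℝ => ENNReal.ofReal t) (𝓝[>] 0) (𝓝 0) := by
        have := (ENNReal.continuous_ofReal.tendsto 0).mono_left
          (nhdsWithin_le_nhds (s := Set.Ioi 0))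
        rwa [ENNReal.ofReal_zero] at this
      simpa using ENNReal.Tendsto.mul_const h0 (Or.inr hV)
    have h2 := (h1.eventually (gt_mem_nhds (pos_iff_ne_zero.2 hη3))).and self_mem_nhdsWithin
    obtain ⟨t, h3, h4⟩ := h2.exists
    exact ⟨t, h4, h3.le⟩
  obtain ⟨s, hs0, hs⟩ := Metric.uniformContinuous_iff.1
    (hgs.uniformContinuous_of_continuous hgc) t ht0
  have hR : Tendsto (fun k => ‖a k‖ + ε k) atTop (𝓝 0) := by simpa using ha.norm.add hε
  filter_upwards [hR.eventually (gt_mem_nhds (lt_min hs0 one_pos))] with k hk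
  have hsupp : Function.support (ρ k) ⊆ Metric.ball 0 (min s 1) := by
    refine (subset_tsupport _).trans ((h k).tsupport_subset.trans fun x hx => ?_)
    rw [mem_ball_zero_iff]
    rw [mem_closedBall_iff_norm] at hx
    have : ‖x‖ ≤ ‖a k‖ + ‖x - a k‖ := by
      simpa using norm_add_le (a k) (x - a k)
    linarith
  have hpt : ∀ x, ‖mollify (ρ k) g x - g x‖ ≤ t := by
    intro x
    rw [← dist_eq_norm]
    refine dist_convolution_le ht0.le hsupp (h k).nonneg (h k).integral_eq_one
      hgc.aestronglyMeasurable fun y hy => ?_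
    exact (hs (lt_of_lt_of_le (Metric.mem_ball.1 hy) (min_le_left _ _))).le
  have hzero : ∀ x ∉ K, mollify (ρ k) g x - g x = 0 := by
    intro x hx
    have h1 : ∀ y ∈ Metric.ball (0 : EuclideanSpace ℝ (Fin d)) (min s 1), g (x - y) = 0 := by
      intro y hy
      by_contra hne
      refine hx (Metric.mem_cthickening_of_dist_le x (x - y) 1 _
        (subset_tsupport g hne) ?_)
      rw [dist_eq_norm, sub_sub_cancel]
      exact (mem_ball_zero_iff.1 hy).le.trans (min_le_right _ _)
    have h2 : g x = 0 := by simpa using h1 0 (by simpa using hs0)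
    rw [h2, sub_zero, mollify_apply]
    refine integral_eq_zero_of_ae (Eventually.of_forall fun y => ?_)
    by_cases hy : ρ k y = 0
    · simp [hy]
    · simp [h1 y (hsupp hy)]
  have hmid : eLpNorm (mollify (ρ k) g - g) 2 ≤ η / 3 := by
    have h1 : mollify (ρ k) g - g = K.indicator (mollify (ρ k) g - g) := by
      ext x
      by_cases hx : x ∈ K
      · simp [hx]
      · simpa [hx] using hzero x hx
    rw [h1, eLpNorm_indicator_eq_eLpNorm_restrict hKc.isClosed.measurableSet]
    refine (eLpNorm_le_of_ae_bound (C := t) (Eventually.of_forall hpt)).trans ?_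
    rw [mul_comm]
    simpa using ht
  have hsplit : (fun x => mollify (ρ k) f x - f x) =
      mollify (ρ k) (f - g) + ((mollify (ρ k) g - g) + (g - f)) := by
    rw [(h k).mollify_sub hf hg]
    ext x
    simp only [Pi.add_apply, Pi.sub_apply]
    ring
  have hM1 := (h k).memLp_mollify (hf.sub hg)
  have hM2 := ((h k).memLp_mollify hg).sub hg
  have h1 : eLpNorm (mollify (ρ k) (f - g)) 2 ≤ η / 3 :=
    ((h k).eLpNorm_mollify_le (hf.sub hg)).trans hfg
  have h2 : eLpNorm (g - f) 2 ≤ η / 3 := by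
    rw [eLpNorm_sub_comm]
    exact hfg
  have h3 := eLpNorm_add_le hM1.1 (hM2.add (hg.sub hf)).1 (by norm_num : (1 : ENNReal) ≤ 2)
  have h4 := eLpNorm_add_le hM2.1 (hg.sub hf).1 (by norm_num : (1 : ENNReal) ≤ 2)
  rw [hsplit, ← ENNReal.add_thirds η, add_assoc]
  exact h3.trans (add_le_add h1 (h4.trans (add_le_add hmid h2)))

/-- Differentiation of a mollified function, when the integration by parts holds for the kernel
centred at `x`. -/
lemma IsMollifier.partialDeriv_mollify (h : IsMollifier ρ a ε)
    {U : Set (EuclideanSpace ℝ (Fin d))} (hU : MeasurableSet U)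
    {f' : EuclideanSpace ℝ (Fin d) → ℂ} (hf : LocallyIntegrable (U.indicator f)) (i : Fin d)
    (x : EuclideanSpace ℝ (Fin d))
    (hx : ∫ w in U, partialDeriv i (fun w => ρ (x - w)) w • f w =
      -∫ w in U, ρ (x - w) • f' w) :
    partialDeriv i (mollify ρ (U.indicator f)) x = mollify ρ (U.indicator f') x := by
  have h1 := h.hasCompactSupport.hasFDerivAt_convolution_left (ContinuousLinearMap.lsmul ℝ ℝ)
    (h.contDiff.of_le (by simp)) hf x
  have h2 : ∀ w, partialDeriv i (fun w => ρ (x - w)) w = -partialDeriv i ρ (x - w) := by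
    intro w
    have h3 : HasFDerivAt (fun w => x - w) (-ContinuousLinearMap.id ℝ _) w :=
      (hasFDerivAt_id w).const_sub x
    have h4 := (((h.contDiff.differentiable (by simp)) (x - w)).hasFDerivAt.comp w h3).fderiv
    unfold partialDeriv
    rw [show (fun w => ρ (x - w)) = ρ ∘ (fun w => x - w) from rfl, h4]
    simp
  have hind : ∀ (u : EuclideanSpace ℝ (Fin d) → ℂ) (φ : EuclideanSpace ℝ (Fin d) → ℝ),
      ∫ w, φ w • U.indicator u w = ∫ w in U, φ w • u w := by
    intro u φ
    rw [← integral_indicator hU]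
    congr 1 with w
    by_cases hw : w ∈ U <;> simp [hw]
  rw [mollify_apply_swap, hind, ← neg_eq_iff_eq_neg.2 hx]
  simp_rw [h2, neg_smul]
  rw [integral_neg, neg_neg, partialDeriv, mollify, h1.fderiv, ← hind]
  have hce : ConvolutionExistsAt (fderiv ℝ ρ) (U.indicator f) x
      ((ContinuousLinearMap.lsmul ℝ ℝ).precompL (EuclideanSpace ℝ (Fin d))) volume :=
    (h.hasCompactSupport.fderiv ℝ).convolutionExists_left _
      (h.contDiff.continuous_fderiv (by simp)) hf x
  rw [convolution_def, ContinuousLinearMap.integral_apply hce, ← integral_sub_left_eq_self _ _ x]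
  congr 1 with w
  simp [partialDeriv, ContinuousLinearMap.precompL_apply]

lemma IsMollifier.isTestFunction (h : IsMollifier ρ a ε) {U : Set (EuclideanSpace ℝ (Fin d))}
    {x : EuclideanSpace ℝ (Fin d)} (hx : Metric.closedBall (x - a) ε ⊆ U) :
    IsTestFunction U (fun w => ρ (x - w)) := by
  have hts : tsupport (fun w => ρ (x - w)) ⊆ Metric.closedBall (x - a) ε := by
    refine closure_minimal (fun w hw => ?_) Metric.isClosed_closedBall
    have h1 := h.tsupport_subset (subset_tsupport _ hw)
    rw [mem_closedBall_iff_norm] at h1 ⊢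
    rw [← norm_neg, show -(w - (x - a)) = x - w - a by abel]
    exact h1
  refine ⟨h.contDiff.comp (by fun_prop), ?_, hts.trans hx⟩
  exact (isCompact_closedBall _ _).of_isClosed_subset (isClosed_tsupport _) hts

end Mollify

/-! ### Boundary atlases and partitions of unity -/

section ChartShift

variable {d : ℕ} {Ω : Set (EuclideanSpace ℝ (Fin d))} {x₀ e : EuclideanSpace ℝ (Fin d)} {r : ℝ}
  {γ : EuclideanSpace ℝ (Fin d) → ℝ}

lemma IsGraphChart.recenter (h : IsGraphChart Ω x₀ r e γ) {y : EuclideanSpace ℝ (Fin d)} {s : ℝ}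
    (hs : 0 < s) (hy : dist y x₀ + s ≤ r) : IsGraphChart Ω y s e γ :=
  ⟨hs, h.norm_eq_one, h.contDiff, h.add_smul, fun x hx => h.mem_iff x (by
    have := dist_triangle x y x₀
    rw [Metric.mem_ball] at hx ⊢
    linarith)⟩

lemma IsGraphChart.le_of_mem_closure (h : IsGraphChart Ω x₀ r e γ) {x : EuclideanSpace ℝ (Fin d)}
    (hx : x ∈ Metric.ball x₀ r) (hxΩ : x ∈ closure Ω) : γ x ≤ inner ℝ e x := by
  by_cases hx1 : x ∈ Ω
  · exact ((h.mem_iff x hx).1 hx1).le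
  · refine ((h.mem_frontier_iff hx).1 ⟨hxΩ, fun hi => hx1 (interior_subset hi)⟩).le

/-- Near `K`, moving a point of `Ω` by a small multiple of `e` leads well into `Ω`, and only points
of `Ω` are reached from the closure of `Ω` in this way. -/
def ShiftsInto (Ω K : Set (EuclideanSpace ℝ (Fin d))) (e : EuclideanSpace ℝ (Fin d)) : Prop :=
  ∃ κ > 0, ∃ s₀ > 0, ∀ s : ℝ, 0 < s → s ≤ s₀ → ∀ x ∈ K,
    (x ∈ Ω → Metric.closedBall (x + s • e) (κ * s) ⊆ Ω) ∧
    ((Metric.closedBall (x - s • e) (κ * s) ∩ closure Ω).Nonempty → x ∈ Ω)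

lemma shiftsInto_zero (hΩ : IsOpen Ω) {K : Set (EuclideanSpace ℝ (Fin d))} (hK : IsCompact K)
    (hKΩ : K ⊆ Ω) : ShiftsInto Ω K 0 := by
  obtain ⟨s, hs, hsub⟩ := hK.exists_cthickening_subset_open hΩ hKΩ
  refine ⟨1, one_pos, s, hs, fun t ht hts x hx => ⟨fun _ => ?_, fun _ => hKΩ hx⟩⟩
  rw [smul_zero, add_zero, one_mul]
  exact (Metric.closedBall_subset_closedBall hts).trans
    ((Metric.closedBall_subset_cthickening hx s).trans hsub)

lemma IsGraphChart.shiftsInto (h : IsGraphChart Ω x₀ r e γ) {K : Set (EuclideanSpace ℝ (Fin d))}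
    (hK : IsCompact K) (hKb : K ⊆ Metric.ball x₀ r) : ShiftsInto Ω K e := by
  obtain ⟨η, hη, hsub⟩ := hK.exists_cthickening_subset_open Metric.isOpen_ball hKb
  obtain ⟨L, hL⟩ := LocallyLipschitzOn.exists_lipschitzOnWith_of_compact
    (isCompact_closedBall x₀ r)
    ((h.contDiff.of_le (by simp : (1 : WithTop ℕ∞) ≤ ∞)).locallyLipschitz.locallyLipschitzOn)
  have hLip : ∀ x ∈ Metric.ball x₀ r, ∀ y ∈ Metric.ball x₀ r, γ x ≤ γ y + L * dist x y := by
    intro x hx y hy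
    have := hL.dist_le_mul x (Metric.ball_subset_closedBall hx) y (Metric.ball_subset_closedBall hy)
    rw [Real.dist_eq] at this
    linarith [le_abs_self (γ x - γ y)]
  have hinner : ∀ w, |inner ℝ e w| ≤ ‖w‖ := fun w => by
    simpa [h.norm_eq_one] using abs_real_inner_le_norm e w
  set κ : ℝ := 1 / (L + 2) with hκ
  have hL0 : (0 : ℝ) ≤ L := L.2
  have hκ0 : 0 < κ := by positivity
  have hκL : L * κ + κ < 1 := by
    rw [hκ, ← add_one_mul, mul_one_div, div_lt_one (by positivity)]; linarith
  have hκ1 : κ < 1 := by nlinarith [mul_nonneg hL0 hκ0.le]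
  have hee : inner ℝ e e = (1 : ℝ) := by rw [real_inner_self_eq_norm_sq, h.norm_eq_one]; norm_num
  refine ⟨κ, hκ0, η / 2, by positivity, fun s hs hs0 x hx => ⟨fun hxΩ y hy => ?_, ?_⟩⟩
  · have hd : ‖y - (x + s • e)‖ ≤ κ * s := by rwa [mem_closedBall_iff_norm] at hy
    set w := y - (x + s • e) with hw
    have hyw : y = x + w + s • e := by rw [hw]; abel
    have hκs : κ * s ≤ s := by nlinarith
    have hse : ‖s • e‖ = s := by rw [norm_smul, h.norm_eq_one, Real.norm_of_nonneg hs.le, mul_one]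
    have hyB : y ∈ Metric.ball x₀ r := by
      refine hsub (Metric.mem_cthickening_of_dist_le y x η K hx ?_)
      rw [dist_eq_norm, hyw, show x + w + s • e - x = w + s • e by abel]
      refine (norm_add_le _ _).trans ?_
      rw [hse]; linarith
    have hxwB : x + w ∈ Metric.ball x₀ r := by
      refine hsub (Metric.mem_cthickening_of_dist_le _ x η K hx ?_)
      rw [dist_eq_norm, add_sub_cancel_left]
      linarith
    rw [h.mem_iff y hyB, hyw, h.add_smul]
    have h1 := hLip _ hxwB _ (hKb hx)
    rw [dist_eq_norm, add_sub_cancel_left] at h1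
    have h2 := (h.mem_iff x (hKb hx)).1 hxΩ
    rw [inner_add_right, inner_add_right, inner_smul_right, hee]
    have h3 := (abs_le.1 (hinner w)).1
    have h4 : (L : ℝ) * ‖w‖ ≤ L * (κ * s) := by gcongr
    nlinarith
  · rintro ⟨y, hy, hyΩ⟩
    have hd : ‖y - (x - s • e)‖ ≤ κ * s := by rwa [mem_closedBall_iff_norm] at hy
    set w := y - (x - s • e) with hw
    have hyw : y = x + w - s • e := by rw [hw]; abel
    have hκs : κ * s ≤ s := by nlinarith
    have hse : ‖s • e‖ = s := by rw [norm_smul, h.norm_eq_one, Real.norm_of_nonneg hs.le, mul_one]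
    have hyB : y ∈ Metric.ball x₀ r := by
      refine hsub (Metric.mem_cthickening_of_dist_le y x η K hx ?_)
      rw [dist_eq_norm, hyw, show x + w - s • e - x = w - s • e by abel]
      refine (norm_sub_le _ _).trans ?_
      rw [hse]; linarith
    have hxwB : x + w ∈ Metric.ball x₀ r := by
      refine hsub (Metric.mem_cthickening_of_dist_le _ x η K hx ?_)
      rw [dist_eq_norm, add_sub_cancel_left]
      linarith
    have h0 := h.le_of_mem_closure hyB hyΩ
    rw [hyw, sub_eq_add_neg, ← neg_smul, h.add_smul, inner_add_right, inner_add_right,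
      inner_smul_right, hee] at h0
    have h1 := hLip _ (hKb hx) _ hxwB
    rw [dist_eq_norm, sub_add_cancel_left, norm_neg] at h1
    rw [h.mem_iff x (hKb hx)]
    have h3 := (abs_le.1 (hinner w)).2
    have h4 : (L : ℝ) * ‖w‖ ≤ L * (κ * s) := by gcongr
    nlinarith

end ChartShift

/-- A finite family of graph charts of radius at most `δ` covering the boundary of `Ω`, with a
smooth partition of unity on the closure of `Ω`: the function `χ₀` is supported in the
interior, and `χ j` is supported in the ball of the `j`-th chart. -/
structure BoundaryAtlas {d : ℕ} (Ω : Set (EuclideanSpace ℝ (Fin d))) (δ : ℝ) (ι : Type)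
    [Fintype ι] where
  /-- the centres of the charts -/
  x : ι → EuclideanSpace ℝ (Fin d)
  /-- the radii of the charts -/
  r : ι → ℝ
  /-- the directions of the charts -/
  e : ι → EuclideanSpace ℝ (Fin d)
  /-- the functions whose graphs describe the boundary -/
  γ : ι → EuclideanSpace ℝ (Fin d) → ℝ
  /-- the interior cutoff -/
  χ₀ : EuclideanSpace ℝ (Fin d) → ℝ
  /-- the boundary cutoffs -/
  χ : ι → EuclideanSpace ℝ (Fin d) → ℝ
  chart : ∀ j, IsGraphChart Ω (x j) (r j) (e j) (γ j)
  center_mem : ∀ j, x j ∈ frontier Ω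
  radius_le : ∀ j, r j ≤ δ
  test₀ : IsTestFunction Ω χ₀
  test : ∀ j, IsTestFunction (Metric.ball (x j) (r j)) (χ j)
  nonneg₀ : ∀ y, 0 ≤ χ₀ y
  nonneg : ∀ j y, 0 ≤ χ j y
  sum_eq_one : ∀ y ∈ closure Ω, χ₀ y + ∑ j, χ j y = 1

lemma IsSmoothBoundedDomain.exists_boundaryAtlas {d : ℕ} {Ω : Set (EuclideanSpace ℝ (Fin d))}
    (hΩ : IsSmoothBoundedDomain Ω) {δ : ℝ} (hδ : 0 < δ) :
    ∃ (ι : Type) (_ : Fintype ι), Nonempty (BoundaryAtlas Ω δ ι) := by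
  have hch : ∀ p : frontier Ω, ∃ r e γ, r ≤ δ ∧ IsGraphChart Ω p r e γ := by
    intro p
    obtain ⟨r, e, γ, h⟩ := hΩ.exists_chart p p.2
    exact ⟨min r δ, e, γ, min_le_right _ _,
      h.recenter (lt_min h.radius_pos hδ) (by rw [dist_self, zero_add]; exact min_le_left _ _)⟩
  choose r e γ hr hchart using hch
  have hcomp : IsCompact (frontier Ω) := by
    rw [frontier]
    exact hΩ.isBounded.isCompact_closure.diff isOpen_interior
  obtain ⟨t, ht⟩ := hcomp.elim_nhds_subcover' (fun p hp => Metric.ball p (r ⟨p, hp⟩))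
    fun p hp => Metric.ball_mem_nhds p (hchart ⟨p, hp⟩).radius_pos
  let U : Option t → Set (EuclideanSpace ℝ (Fin d)) := fun o =>
    o.elim Ω fun p => Metric.ball p.1 (r p.1)
  have hUo : ∀ o, IsOpen (U o) := by
    rintro (_ | p)
    · exact hΩ.isOpen
    · exact Metric.isOpen_ball
  have hcov : closure Ω ⊆ ⋃ o, U o := by
    intro y hy
    by_cases hyΩ : y ∈ Ω
    · exact Set.mem_iUnion.2 ⟨none, hyΩ⟩
    · have hyf : y ∈ frontier Ω := ⟨hy, fun hi => hyΩ (interior_subset hi)⟩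
      obtain ⟨p, hp, hyp⟩ := Set.mem_iUnion₂.1 (ht hyf)
      exact Set.mem_iUnion.2 ⟨some ⟨p, hp⟩, hyp⟩
  obtain ⟨f, hf⟩ := SmoothPartitionOfUnity.exists_isSubordinate
    (modelWithCornersSelf ℝ (EuclideanSpace ℝ (Fin d))) isClosed_closure U hUo hcov
  have hcs : ∀ o, HasCompactSupport (f o) := by
    intro o
    refine HasCompactSupport.of_support_subset_isCompact
      (K := closure (U o)) ?_ ((subset_tsupport _).trans ((hf o).trans subset_closure))
    refine Bornology.IsBounded.isCompact_closure ?_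
    cases o with
    | none => exact hΩ.isBounded
    | some p => exact Metric.isBounded_ball
  refine ⟨t, inferInstance, ⟨{
    x := fun p => p.1
    r := fun p => r p.1
    e := fun p => e p.1
    γ := fun p => γ p.1
    χ₀ := f none
    χ := fun p => f (some p)
    chart := fun p => hchart p.1
    center_mem := fun p => p.1.2
    radius_le := fun p => hr p.1
    test₀ := ⟨(f none).contMDiff.contDiff, hcs none, hf none⟩
    test := fun p => ⟨(f (some p)).contMDiff.contDiff, hcs (some p), hf (some p)⟩
    nonneg₀ := fun y => f.nonneg none y
    nonneg := fun p y => f.nonneg (some p) y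
    sum_eq_one := fun y hy => ?_ }⟩⟩
  have := f.sum_eq_one hy
  rw [finsum_eq_sum_of_fintype, Fintype.sum_option] at this
  exact this

namespace BoundaryAtlas

variable {d : ℕ} {Ω : Set (EuclideanSpace ℝ (Fin d))} {δ : ℝ} {ι : Type} [Fintype ι]

/-- All the functions of the partition of unity. -/
def cutoff (A : BoundaryAtlas Ω δ ι) : Option ι → EuclideanSpace ℝ (Fin d) → ℝ :=
  fun o => o.elim A.χ₀ A.χ

/-- The direction along which functions are shifted on the support of `A.cutoff`. -/
def shift (A : BoundaryAtlas Ω δ ι) : Option ι → EuclideanSpace ℝ (Fin d) :=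
  fun o => o.elim 0 A.e

lemma contDiff_cutoff (A : BoundaryAtlas Ω δ ι) (o : Option ι) : ContDiff ℝ ∞ (A.cutoff o) := by
  cases o with
  | none => exact A.test₀.contDiff
  | some j => exact (A.test j).contDiff

lemma hasCompactSupport_cutoff (A : BoundaryAtlas Ω δ ι) (o : Option ι) :
    HasCompactSupport (A.cutoff o) := by
  cases o with
  | none => exact A.test₀.hasCompactSupport
  | some j => exact (A.test j).hasCompactSupport

lemma sum_cutoff (A : BoundaryAtlas Ω δ ι) {y : EuclideanSpace ℝ (Fin d)} (hy : y ∈ closure Ω) :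
    ∑ o, A.cutoff o y = 1 := by
  rw [Fintype.sum_option]
  exact A.sum_eq_one y hy

lemma shiftsInto (A : BoundaryAtlas Ω δ ι) (hΩ : IsOpen Ω) (o : Option ι) :
    ShiftsInto Ω (tsupport (A.cutoff o)) (A.shift o) := by
  cases o with
  | none => exact shiftsInto_zero hΩ A.test₀.hasCompactSupport A.test₀.tsupport_subset
  | some j => exact (A.chart j).shiftsInto (A.test j).hasCompactSupport (A.test j).tsupport_subset

lemma sum_χ_frontier (A : BoundaryAtlas Ω δ ι) (hΩ : IsOpen Ω) {y : EuclideanSpace ℝ (Fin d)}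
    (hy : y ∈ frontier Ω) : ∑ j, A.χ j y = 1 := by
  have h1 := A.sum_eq_one y (frontier_subset_closure hy)
  rw [hΩ.frontier_eq] at hy
  have h2 : A.χ₀ y = 0 := by
    by_contra h
    exact hy.2 (A.test₀.tsupport_subset (subset_tsupport _ h))
  rwa [h2, zero_add] at h1

end BoundaryAtlas

/-! ### The divergence theorem and traces of smooth functions -/

lemma integrable_graphMeasure {d : ℕ} {e : EuclideanSpace ℝ (Fin d)}
    {γ : EuclideanSpace ℝ (Fin d) → ℝ} (hγ : Continuous γ)
    {F : Type*} [NormedAddCommGroup F] {G : EuclideanSpace ℝ (Fin d) → F}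
    (hG : Continuous G) (hGs : HasCompactSupport G) : Integrable G (graphMeasure e γ) := by
  rw [graphMeasure, (isClosedEmbedding_graphMap hγ).measurableEmbedding.integrable_map_iff]
  exact (hG.comp (continuous_graphMap hγ)).integrable_of_hasCompactSupport
    (hGs.comp_isClosedEmbedding (isClosedEmbedding_graphMap hγ))

section ChartDivergence

variable {d : ℕ} {Ω : Set (EuclideanSpace ℝ (Fin d))} {x₀ e : EuclideanSpace ℝ (Fin d)} {r : ℝ}
  {γ : EuclideanSpace ℝ (Fin d) → ℝ} {F : Type*} [NormedAddCommGroup F] [NormedSpace ℝ F]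

lemma contDiff_conormal (hγ : ContDiff ℝ ∞ γ) (i : Fin d) : ContDiff ℝ ∞ (conormal e γ i) :=
  contDiff_const.sub ((hγ.fderiv_right (m := ∞) (by simp)).clm_apply contDiff_const)

lemma fderiv_conormal_apply_self (hγ : ContDiff ℝ ∞ γ) (hγe : ∀ x (t : ℝ), γ (x + t • e) = γ x)
    (i : Fin d) (x : EuclideanSpace ℝ (Fin d)) : fderiv ℝ (conormal e γ i) x e = 0 :=
  fderiv_apply_self (contDiff_conormal hγ i)
    (fun x t => by simp only [conormal, partialDeriv, fderiv_add_smul hγe]) x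

lemma IsGraphChart.setIntegral_eq (h : IsGraphChart Ω x₀ r e γ) (hΩ : MeasurableSet Ω)
    {G : EuclideanSpace ℝ (Fin d) → F} (hG : ∀ x ∉ Metric.ball x₀ r, G x = 0) :
    ∫ x in Ω, G x = ∫ x in aboveGraph e γ, G x := by
  rw [← integral_indicator hΩ,
    ← integral_indicator (isOpen_aboveGraph h.contDiff.continuous).measurableSet]
  congr 1 with x
  by_cases hx : x ∈ Metric.ball x₀ r
  · by_cases hxΩ : x ∈ Ω
    · have : x ∈ aboveGraph e γ := (h.mem_iff x hx).1 hxΩ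
      simp [hxΩ, this]
    · have : x ∉ aboveGraph e γ := fun h' => hxΩ ((h.mem_iff x hx).2 h')
      simp [hxΩ, this]
  · simp [Set.indicator, hG x hx]

lemma fderiv_eq_zero_of_tsupport_subset {G : EuclideanSpace ℝ (Fin d) → F}
    {U : Set (EuclideanSpace ℝ (Fin d))} (hG : tsupport G ⊆ U) {x : EuclideanSpace ℝ (Fin d)}
    (hx : x ∉ U) : fderiv ℝ G x = 0 := by
  by_contra hne
  exact hx (hG (support_fderiv_subset ℝ hne))

/-- The fundamental theorem of calculus in the direction of a chart. -/
lemma IsGraphChart.setIntegral_fderiv (h : IsGraphChart Ω x₀ r e γ) (hΩ : MeasurableSet Ω)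
    [CompleteSpace F] {G : EuclideanSpace ℝ (Fin d) → F} (hG : ContDiff ℝ 1 G)
    (hGs : HasCompactSupport G) (hGb : tsupport G ⊆ Metric.ball x₀ r) :
    ∫ x in Ω, fderiv ℝ G x e = -∫ x, G x ∂graphMeasure e γ := by
  rw [h.setIntegral_eq hΩ fun x hx => by rw [fderiv_eq_zero_of_tsupport_subset hGb hx]; simp,
    setIntegral_aboveGraph_fderiv h.norm_eq_one h.contDiff.continuous h.add_smul hG hGs]

/-- The divergence theorem in a chart. -/
lemma IsGraphChart.setIntegral_partialDeriv (h : IsGraphChart Ω x₀ r e γ) (hΩ : MeasurableSet Ω)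
    [CompleteSpace F] {G : EuclideanSpace ℝ (Fin d) → F} (hG : ContDiff ℝ 1 G)
    (hGs : HasCompactSupport G) (hGb : tsupport G ⊆ Metric.ball x₀ r) (i : Fin d) :
    ∫ x in Ω, partialDeriv i G x = -∫ x, conormal e γ i x • G x ∂graphMeasure e γ := by
  have hn : ContDiff ℝ 1 (conormal e γ i) := (contDiff_conormal h.contDiff i).of_le (by simp)
  have hprod : ContDiff ℝ 1 (fun x => conormal e γ i x • G x) := hn.smul hG
  rw [h.setIntegral_eq hΩ fun x hx => by
      rw [partialDeriv, fderiv_eq_zero_of_tsupport_subset hGb hx]; simp,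
    setIntegral_aboveGraph_partialDeriv h.norm_eq_one h.contDiff h.add_smul hG hGs,
    ← setIntegral_aboveGraph_fderiv h.norm_eq_one h.contDiff.continuous h.add_smul hprod
      hGs.smul_left]
  congr 1 with x
  have h1 := ((hn.differentiable one_ne_zero) x).hasFDerivAt.smul
    ((hG.differentiable one_ne_zero) x).hasFDerivAt
  change _ = fderiv ℝ (conormal e γ i • G) x e
  rw [h1.fderiv]
  simp [fderiv_conormal_apply_self h.contDiff h.add_smul]

lemma IsTestFunction.setIntegral_partialDeriv_smul {χ : EuclideanSpace ℝ (Fin d) → ℝ}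
    [CompleteSpace F] (h : IsTestFunction Ω χ) (hΩ : MeasurableSet Ω)
    {G : EuclideanSpace ℝ (Fin d) → F} (hG : ContDiff ℝ 1 G) (i : Fin d) :
    ∫ x in Ω, partialDeriv i (fun x => χ x • G x) x = 0 := by
  have hts : tsupport (fun x => χ x • G x) ⊆ Ω :=
    (tsupport_smul_subset_left χ G).trans h.tsupport_subset
  have hcs : HasCompactSupport (fun x => χ x • G x) := h.hasCompactSupport.smul_right
  have hC : ContDiff ℝ 1 (fun x => χ x • G x) := (h.contDiff.of_le (by simp)).smul hG
  rw [← integral_indicator hΩ]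
  have h1 : Ω.indicator (fun x => partialDeriv i (fun x => χ x • G x) x) =
      fun x => fderiv ℝ (fun x => χ x • G x) x (EuclideanSpace.single i (1 : ℝ)) := by
    ext x
    by_cases hx : x ∈ Ω
    · simp [hx, partialDeriv]
    · simp [hx, fderiv_eq_zero_of_tsupport_subset hts hx]
  rw [h1]
  have := integral_smul_fderiv_eq_neg_fderiv_smul_of_integrable
    (μ := (volume : Measure (EuclideanSpace ℝ (Fin d)))) (f := fun _ => (1 : ℝ))
    (g := fun x => χ x • G x) (v := EuclideanSpace.single i (1 : ℝ)) (by simp) ?_ ?_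
    (fun _ _ => differentiableAt_const _) (fun x _ => (hC.differentiable one_ne_zero) x)
  · simpa using this
  · simpa using ((hC.continuous_fderiv one_ne_zero).clm_apply
      continuous_const).integrable_of_hasCompactSupport (hcs.fderiv_apply (𝕜 := ℝ) _)
  · simpa using hC.continuous.integrable_of_hasCompactSupport hcs

end ChartDivergence

namespace BoundaryAtlas

variable {d : ℕ} {Ω : Set (EuclideanSpace ℝ (Fin d))} {δ : ℝ} {ι : Type} [Fintype ι]
  {F : Type*} [NormedAddCommGroup F] [NormedSpace ℝ F]

lemma lintegral_χ_mul (A : BoundaryAtlas Ω δ ι) (j : ι)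
    (μ : Measure (EuclideanSpace ℝ (Fin d))) (G : EuclideanSpace ℝ (Fin d) → ENNReal) :
    ∫⁻ x in Metric.ball (A.x j) (A.r j), ENNReal.ofReal (A.χ j x) * G x ∂μ =
      ∫⁻ x, ENNReal.ofReal (A.χ j x) * G x ∂μ := by
  rw [← lintegral_indicator measurableSet_ball]
  congr 1 with x
  by_cases hx : x ∈ Metric.ball (A.x j) (A.r j)
  · simp [hx]
  · have : A.χ j x = 0 := by
      by_contra h
      exact hx ((A.test j).tsupport_subset (subset_tsupport _ h))
    simp [hx, this]

/-- Surface measure is dominated by the measures on the graphs of the charts. -/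
lemma exists_lintegral_surfaceMeasure_le (A : BoundaryAtlas Ω δ ι) (hΩ : IsOpen Ω) :
    ∃ K : NNReal, ∀ G : EuclideanSpace ℝ (Fin d) → ENNReal, Measurable G →
      ∫⁻ x, G x ∂surfaceMeasure Ω ≤
        K * ∑ j, ∫⁻ x, ENNReal.ofReal (A.χ j x) * G x ∂graphMeasure (A.e j) (A.γ j) := by
  choose K hK using fun j => (A.chart j).exists_surfaceMeasure_restrict_le
  refine ⟨∑ j, K j, fun G hG => ?_⟩
  have h1 : ∫⁻ x, G x ∂surfaceMeasure Ω =
      ∑ j, ∫⁻ x, ENNReal.ofReal (A.χ j x) * G x ∂surfaceMeasure Ω := by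
    rw [← lintegral_finsetSum]
    · refine setLIntegral_congr_fun isClosed_frontier.measurableSet fun x hx => ?_
      rw [← Finset.sum_mul, ← ENNReal.ofReal_sum_of_nonneg fun j _ => A.nonneg j x,
        A.sum_χ_frontier hΩ hx, ENNReal.ofReal_one, one_mul]
    · exact fun j _ => ((A.test j).contDiff.continuous.measurable.ennreal_ofReal).mul hG
  rw [h1, Finset.mul_sum]
  refine Finset.sum_le_sum fun j _ => ?_
  rw [← A.lintegral_χ_mul j (surfaceMeasure Ω)]
  refine (lintegral_mono' (hK j) le_rfl).trans ?_
  rw [lintegral_smul_measure, ENNReal.smul_def, smul_eq_mul]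
  gcongr
  exact Finset.single_le_sum (f := K) (fun _ _ => zero_le) (Finset.mem_univ j)

lemma lintegral_graphMeasure_le (A : BoundaryAtlas Ω δ ι) (hΩ : IsOpen Ω) (j : ι)
    (G : EuclideanSpace ℝ (Fin d) → ENNReal) :
    ∫⁻ x, ENNReal.ofReal (A.χ j x) * G x ∂graphMeasure (A.e j) (A.γ j) ≤
      ∫⁻ x, G x ∂surfaceMeasure Ω := by
  rw [← A.lintegral_χ_mul j]
  refine (lintegral_mono' (A.chart j).graphMeasure_restrict_le le_rfl).trans ?_
  refine setLIntegral_mono_ae' isClosed_frontier.measurableSet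
    (Eventually.of_forall fun x hx => ?_)
  have h1 : A.χ j x ≤ 1 := by
    rw [← A.sum_χ_frontier hΩ hx]
    exact Finset.single_le_sum (f := fun j => A.χ j x) (fun j _ => A.nonneg j x) (Finset.mem_univ j)
  calc ENNReal.ofReal (A.χ j x) * G x ≤ 1 * G x := by
        gcongr
        exact ENNReal.ofReal_le_one.2 h1
    _ = G x := one_mul _

lemma hasCompactSupport_χ_smul (A : BoundaryAtlas Ω δ ι) (j : ι)
    (G : EuclideanSpace ℝ (Fin d) → F) : HasCompactSupport (fun x => A.χ j x • G x) :=
  (A.test j).hasCompactSupport.smul_right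

lemma tsupport_χ_smul (A : BoundaryAtlas Ω δ ι) (j : ι) (G : EuclideanSpace ℝ (Fin d) → F) :
    tsupport (fun x => A.χ j x • G x) ⊆ Metric.ball (A.x j) (A.r j) :=
  (tsupport_smul_subset_left (A.χ j) G).trans (A.test j).tsupport_subset

lemma isFiniteMeasure_surfaceMeasure (A : BoundaryAtlas Ω δ ι) (hΩ : IsOpen Ω) :
    IsFiniteMeasure (surfaceMeasure Ω) := by
  obtain ⟨K, hK⟩ := A.exists_lintegral_surfaceMeasure_le hΩ
  refine ⟨?_⟩
  have h1 := hK (fun _ => 1) measurable_const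
  rw [lintegral_one] at h1
  refine h1.trans_lt (ENNReal.mul_lt_top ENNReal.coe_lt_top (ENNReal.sum_lt_top.2 fun j _ => ?_))
  have h2 := integrable_graphMeasure (e := A.e j) (A.chart j).contDiff.continuous
    (A.test j).contDiff.continuous (A.test j).hasCompactSupport
  simp only [mul_one]
  exact h2.lintegral_lt_top

end BoundaryAtlas

section Surface

variable {d : ℕ} {Ω : Set (EuclideanSpace ℝ (Fin d))} {F : Type*} [NormedAddCommGroup F]

lemma memLp_surfaceMeasure [IsFiniteMeasure (surfaceMeasure Ω)] (hb : Bornology.IsBounded Ω)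
    {G : EuclideanSpace ℝ (Fin d) → F} (hG : Continuous G) (p : ENNReal) :
    MemLp G p (surfaceMeasure Ω) := by
  have hc : IsCompact (frontier Ω) := by
    rw [frontier]
    exact hb.isCompact_closure.diff isOpen_interior
  obtain ⟨C, hC⟩ := hc.exists_bound_of_continuousOn hG.continuousOn
  refine MemLp.of_bound hG.aestronglyMeasurable C ?_
  exact (ae_restrict_iff' isClosed_frontier.measurableSet).2 (Eventually.of_forall hC)

lemma isFiniteMeasure_restrict (hb : Bornology.IsBounded Ω) :
    IsFiniteMeasure ((volume : Measure (EuclideanSpace ℝ (Fin d))).restrict Ω) :=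
  ⟨by rw [Measure.restrict_apply_univ]; exact hb.measure_lt_top⟩

lemma memLp_restrict (hΩ : MeasurableSet Ω) (hb : Bornology.IsBounded Ω)
    {G : EuclideanSpace ℝ (Fin d) → F} (hG : Continuous G) (p : ENNReal) :
    MemLp G p (volume.restrict Ω) := by
  have := isFiniteMeasure_restrict hb
  obtain ⟨C, hC⟩ := hb.isCompact_closure.exists_bound_of_continuousOn hG.continuousOn
  refine MemLp.of_bound hG.aestronglyMeasurable C ?_
  exact (ae_restrict_iff' hΩ).2 (Eventually.of_forall fun x hx => hC x (subset_closure hx))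

end Surface

namespace BoundaryAtlas

variable {d : ℕ} {Ω : Set (EuclideanSpace ℝ (Fin d))} {δ : ℝ} {ι : Type} [Fintype ι]
  {F : Type*} [NormedAddCommGroup F] [NormedSpace ℝ F]

/-- Boundary integrals of nonnegative functions are dominated by integrals over the graphs of the
charts. -/
lemma exists_integral_surfaceMeasure_le (A : BoundaryAtlas Ω δ ι) (hΩ : IsOpen Ω)
    (hb : Bornology.IsBounded Ω) :
    ∃ K : ℝ, 0 ≤ K ∧ ∀ G : EuclideanSpace ℝ (Fin d) → ℝ, Continuous G → (∀ x, 0 ≤ G x) →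
      ∫ x, G x ∂surfaceMeasure Ω ≤
        K * ∑ j, ∫ x, A.χ j x * G x ∂graphMeasure (A.e j) (A.γ j) := by
  have := A.isFiniteMeasure_surfaceMeasure hΩ
  obtain ⟨K, hK⟩ := A.exists_lintegral_surfaceMeasure_le hΩ
  refine ⟨K, K.2, fun G hG hG0 => ?_⟩
  have hint : ∀ j, Integrable (fun x => A.χ j x * G x) (graphMeasure (A.e j) (A.γ j)) := fun j =>
    integrable_graphMeasure (A.chart j).contDiff.continuous
      ((A.test j).contDiff.continuous.mul hG) (A.hasCompactSupport_χ_smul j G)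
  have h0 : ∀ j x, 0 ≤ A.χ j x * G x := fun j x => mul_nonneg (A.nonneg j x) (hG0 x)
  have h1 := hK (fun x => ENNReal.ofReal (G x)) hG.measurable.ennreal_ofReal
  rw [← ofReal_integral_eq_lintegral_ofReal
    (memLp_one_iff_integrable.1 (memLp_surfaceMeasure hb hG 1)) (Eventually.of_forall hG0)] at h1
  have h2 : ∀ j, ∫⁻ x, ENNReal.ofReal (A.χ j x) * ENNReal.ofReal (G x)
      ∂graphMeasure (A.e j) (A.γ j) =
      ENNReal.ofReal (∫ x, A.χ j x * G x ∂graphMeasure (A.e j) (A.γ j)) := by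
    intro j
    rw [ofReal_integral_eq_lintegral_ofReal (hint j) (Eventually.of_forall (h0 j))]
    simp_rw [ENNReal.ofReal_mul (A.nonneg j _)]
  simp_rw [h2] at h1
  have h3 : ∀ j, 0 ≤ ∫ x, A.χ j x * G x ∂graphMeasure (A.e j) (A.γ j) := fun j =>
    integral_nonneg (h0 j)
  rw [← ENNReal.ofReal_sum_of_nonneg fun j _ => h3 j, ← ENNReal.ofReal_coe_nnreal,
    ← ENNReal.ofReal_mul K.coe_nonneg] at h1
  exact (ENNReal.ofReal_le_ofReal_iff
    (mul_nonneg K.2 (Finset.sum_nonneg fun j _ => h3 j))).1 h1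

lemma integral_graphMeasure_le (A : BoundaryAtlas Ω δ ι) (hΩ : IsOpen Ω)
    (hb : Bornology.IsBounded Ω) (j : ι) {G : EuclideanSpace ℝ (Fin d) → ℝ} (hG : Continuous G)
    (hG0 : ∀ x, 0 ≤ G x) :
    ∫ x, A.χ j x * G x ∂graphMeasure (A.e j) (A.γ j) ≤ ∫ x, G x ∂surfaceMeasure Ω := by
  have := A.isFiniteMeasure_surfaceMeasure hΩ
  have hint : Integrable (fun x => A.χ j x * G x) (graphMeasure (A.e j) (A.γ j)) :=
    integrable_graphMeasure (A.chart j).contDiff.continuous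
      ((A.test j).contDiff.continuous.mul hG) (A.hasCompactSupport_χ_smul j G)
  have h0 : ∀ x, 0 ≤ A.χ j x * G x := fun x => mul_nonneg (A.nonneg j x) (hG0 x)
  have h1 := A.lintegral_graphMeasure_le hΩ j (fun x => ENNReal.ofReal (G x))
  rw [← ofReal_integral_eq_lintegral_ofReal
    (memLp_one_iff_integrable.1 (memLp_surfaceMeasure hb hG 1)) (Eventually.of_forall hG0)] at h1
  simp_rw [← ENNReal.ofReal_mul (A.nonneg j _)] at h1
  rw [← ofReal_integral_eq_lintegral_ofReal hint (Eventually.of_forall h0)] at h1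
  exact (ENNReal.ofReal_le_ofReal_iff (integral_nonneg hG0)).1 h1

/-- The integral of a first derivative over `Ω` is controlled by the boundary values. -/
lemma exists_norm_setIntegral_partialDeriv_le [CompleteSpace F] (A : BoundaryAtlas Ω δ ι)
    (hΩ : IsOpen Ω) (hb : Bornology.IsBounded Ω) :
    ∃ C : ℝ, ∀ (i : Fin d) (G : EuclideanSpace ℝ (Fin d) → F), ContDiff ℝ 1 G →
      ‖∫ x in Ω, partialDeriv i G x‖ ≤ C * ∫ x, ‖G x‖ ∂surfaceMeasure Ω := by
  have hbd : ∀ j i, ∃ B : ℝ, 0 ≤ B ∧ ∀ x, |conormal (A.e j) (A.γ j) i x| * A.χ j x ≤ B * A.χ j x := by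
    intro j i
    obtain ⟨B, hB⟩ := (A.test j).hasCompactSupport.isCompact.exists_bound_of_continuousOn
      (contDiff_conormal (e := A.e j) (A.chart j).contDiff i).continuous.continuousOn
    refine ⟨max B 0, le_max_right _ _, fun x => ?_⟩
    by_cases hx : x ∈ tsupport (A.χ j)
    · exact mul_le_mul_of_nonneg_right ((hB x hx).trans (le_max_left _ _)) (A.nonneg j x)
    · simp [image_eq_zero_of_notMem_tsupport hx]
  choose B hB0 hB using hbd
  refine ⟨∑ j, ∑ i, B j i, fun i G hG => ?_⟩
  have hC : ∀ j, ContDiff ℝ 1 (fun x => A.χ j x • G x) := fun j =>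
    ((A.test j).contDiff.of_le (by simp)).smul hG
  have hC₀ : ContDiff ℝ 1 (fun x => A.χ₀ x • G x) := (A.test₀.contDiff.of_le (by simp)).smul hG
  have hintg : ∀ H : EuclideanSpace ℝ (Fin d) → F, ContDiff ℝ 1 H →
      Integrable (partialDeriv i H) (volume.restrict Ω) := fun H hH =>
    memLp_one_iff_integrable.1 (memLp_restrict hΩ.measurableSet hb
      ((hH.continuous_fderiv one_ne_zero).clm_apply continuous_const) 1)
  have hsplit : ∫ x in Ω, partialDeriv i G x = ∫ x in Ω, (partialDeriv i (fun x => A.χ₀ x • G x) x +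
      ∑ j, partialDeriv i (fun x => A.χ j x • G x) x) := by
    refine setIntegral_congr_fun hΩ.measurableSet fun x hx => ?_
    have h1 : G =ᶠ[𝓝 x] fun x => A.χ₀ x • G x + ∑ j, A.χ j x • G x := by
      filter_upwards [hΩ.mem_nhds hx] with y hy
      rw [← Finset.sum_smul, ← add_smul, A.sum_eq_one y (subset_closure hy), one_smul]
    simp only [partialDeriv]
    rw [h1.fderiv_eq, fderiv_fun_add ((hC₀.differentiable one_ne_zero) x)
      (DifferentiableAt.fun_sum fun j _ => ((hC j).differentiable one_ne_zero) x),
      fderiv_fun_sum fun j _ => ((hC j).differentiable one_ne_zero) x]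
    simp
  rw [hsplit, integral_add (hintg _ hC₀) (integrable_finsetSum _ fun j _ => hintg _ (hC j)),
    A.test₀.setIntegral_partialDeriv_smul hΩ.measurableSet hG, zero_add,
    integral_finsetSum _ fun j _ => hintg _ (hC j), Finset.sum_mul]
  refine (norm_sum_le _ _).trans (Finset.sum_le_sum fun j _ => ?_)
  rw [(A.chart j).setIntegral_partialDeriv hΩ.measurableSet (hC j)
    (A.hasCompactSupport_χ_smul j G) (A.tsupport_χ_smul j G), norm_neg]
  refine (norm_integral_le_integral_norm _).trans ?_
  have hI : Integrable (fun x => A.χ j x * ‖G x‖) (graphMeasure (A.e j) (A.γ j)) :=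
    integrable_graphMeasure (A.chart j).contDiff.continuous
      ((A.test j).contDiff.continuous.mul hG.continuous.norm)
      (A.hasCompactSupport_χ_smul j fun x => ‖G x‖)
  calc ∫ x, ‖conormal (A.e j) (A.γ j) i x • A.χ j x • G x‖ ∂graphMeasure (A.e j) (A.γ j)
      ≤ ∫ x, B j i * (A.χ j x * ‖G x‖) ∂graphMeasure (A.e j) (A.γ j) := by
        refine integral_mono_of_nonneg (Eventually.of_forall fun x => norm_nonneg _)
          (hI.const_mul _) (Eventually.of_forall fun x => ?_)
        simp only
        rw [norm_smul, norm_smul, Real.norm_eq_abs, Real.norm_of_nonneg (A.nonneg j x), ← mul_assoc,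
          ← mul_assoc]
        exact mul_le_mul_of_nonneg_right (hB j i x) (norm_nonneg _)
    _ = B j i * ∫ x, A.χ j x * ‖G x‖ ∂graphMeasure (A.e j) (A.γ j) := integral_const_mul _ _
    _ ≤ (∑ i, B j i) * ∫ x, ‖G x‖ ∂surfaceMeasure Ω := by
        refine mul_le_mul (Finset.single_le_sum (f := B j) (fun i _ => hB0 j i) (Finset.mem_univ i))
          (A.integral_graphMeasure_le hΩ hb j hG.continuous.norm fun x => norm_nonneg _)
          (integral_nonneg fun x => mul_nonneg (A.nonneg j x) (norm_nonneg _))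
          (Finset.sum_nonneg fun i _ => hB0 j i)

end BoundaryAtlas

section PartialDeriv

variable {d : ℕ} {F : Type*} [NormedAddCommGroup F] [NormedSpace ℝ F]

lemma contDiff_partialDeriv {φ : EuclideanSpace ℝ (Fin d) → F} (hφ : ContDiff ℝ ∞ φ) (i : Fin d) :
    ContDiff ℝ ∞ (partialDeriv i φ) :=
  (hφ.fderiv_right (m := ∞) (by simp)).clm_apply contDiff_const

lemma continuous_partialDeriv {φ : EuclideanSpace ℝ (Fin d) → F} (hφ : ContDiff ℝ 1 φ)
    (i : Fin d) : Continuous (partialDeriv i φ) :=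
  (hφ.continuous_fderiv one_ne_zero).clm_apply continuous_const

lemma tsupport_partialDeriv_subset (φ : EuclideanSpace ℝ (Fin d) → F) (i : Fin d) :
    tsupport (partialDeriv i φ) ⊆ tsupport φ :=
  tsupport_fderiv_apply_subset ℝ _

lemma partialDeriv_smul {χ : EuclideanSpace ℝ (Fin d) → ℝ} {φ : EuclideanSpace ℝ (Fin d) → F}
    {x : EuclideanSpace ℝ (Fin d)} (hχ : DifferentiableAt ℝ χ x) (hφ : DifferentiableAt ℝ φ x)
    (i : Fin d) : partialDeriv i (fun y => χ y • φ y) x =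
      partialDeriv i χ x • φ x + χ x • partialDeriv i φ x := by
  simp only [partialDeriv]
  rw [fderiv_fun_smul hχ hφ]
  simp [add_comm]

lemma partialDeriv_add {φ ψ : EuclideanSpace ℝ (Fin d) → F} {x : EuclideanSpace ℝ (Fin d)}
    (hφ : DifferentiableAt ℝ φ x) (hψ : DifferentiableAt ℝ ψ x) (i : Fin d) :
    partialDeriv i (fun y => φ y + ψ y) x = partialDeriv i φ x + partialDeriv i ψ x := by
  simp only [partialDeriv]
  rw [fderiv_fun_add hφ hψ]
  rfl

lemma partialDeriv_sum {ι : Type*} (s : Finset ι) {φ : ι → EuclideanSpace ℝ (Fin d) → F}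
    {x : EuclideanSpace ℝ (Fin d)} (h : ∀ j ∈ s, DifferentiableAt ℝ (φ j) x) (i : Fin d) :
    partialDeriv i (fun y => ∑ j ∈ s, φ j y) x = ∑ j ∈ s, partialDeriv i (φ j) x := by
  simp only [partialDeriv]
  rw [fderiv_fun_sum h]
  simp

lemma fderiv_apply_eq_sum (φ : EuclideanSpace ℝ (Fin d) → F) (x v : EuclideanSpace ℝ (Fin d)) :
    fderiv ℝ φ x v = ∑ i, v i • partialDeriv i φ x := by
  have hv : v = ∑ i, v i • EuclideanSpace.single i (1 : ℝ) := by
    simpa using ((EuclideanSpace.basisFun (Fin d) ℝ).sum_repr v).symm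
  conv_lhs => rw [hv, map_sum]
  simp [partialDeriv]

lemma norm_sum_smul_sq_le {e : EuclideanSpace ℝ (Fin d)} (he : ‖e‖ = 1) (a : Fin d → F) :
    ‖∑ i, e i • a i‖ ^ 2 ≤ ∑ i, ‖a i‖ ^ 2 := by
  have h1 : ‖∑ i, e i • a i‖ ≤ ∑ i, |e i| * ‖a i‖ := by
    refine (norm_sum_le _ _).trans (le_of_eq ?_)
    simp [norm_smul]
  have h2 := Finset.sum_mul_sq_le_sq_mul_sq Finset.univ (fun i => |e i|) (fun i => ‖a i‖)
  have h3 : ∑ i, |e i| ^ 2 = 1 := by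
    have := EuclideanSpace.norm_sq_eq e
    rw [he] at this
    simpa using this.symm
  rw [h3, one_mul] at h2
  refine le_trans ?_ h2
  gcongr

lemma norm_fderiv_apply_sq_le {e : EuclideanSpace ℝ (Fin d)} (he : ‖e‖ = 1)
    (φ : EuclideanSpace ℝ (Fin d) → F) (x : EuclideanSpace ℝ (Fin d)) :
    ‖fderiv ℝ φ x e‖ ^ 2 ≤ ∑ i, ‖partialDeriv i φ x‖ ^ 2 := by
  rw [fderiv_apply_eq_sum]
  exact norm_sum_smul_sq_le he _

end PartialDeriv

namespace BoundaryAtlas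

variable {d : ℕ} {Ω : Set (EuclideanSpace ℝ (Fin d))} {δ : ℝ} {ι : Type} [Fintype ι]

/-- The trace inequality for smooth functions. In a chart it is the fundamental theorem of calculus
in the direction `e` for the product of `‖φ‖ ^ 2` with the cutoff. -/
lemma exists_trace_le (A : BoundaryAtlas Ω δ ι) (hΩ : IsOpen Ω) (hb : Bornology.IsBounded Ω) :
    ∃ C : ℝ, 0 ≤ C ∧ ∀ φ : EuclideanSpace ℝ (Fin d) → ℂ, ContDiff ℝ 1 φ →
      ∫ x, ‖φ x‖ ^ 2 ∂surfaceMeasure Ω ≤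
        C * ((∫ x in Ω, ‖φ x‖ ^ 2) + ∑ i, ∫ x in Ω, ‖partialDeriv i φ x‖ ^ 2) := by
  obtain ⟨K, hK0, hK⟩ := A.exists_integral_surfaceMeasure_le hΩ hb
  have hM : ∀ j, ∃ M : ℝ, ∀ x, ‖fderiv ℝ (A.χ j) x (A.e j)‖ ≤ M := fun j =>
    (((A.test j).contDiff.continuous_fderiv (by simp)).clm_apply
      continuous_const).bounded_above_of_compact_support
      ((A.test j).hasCompactSupport.fderiv_apply (𝕜 := ℝ) _)
  choose M hM using hM
  have hM0 : ∀ j, 0 ≤ M j := fun j => (norm_nonneg _).trans (hM j 0)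
  refine ⟨K * ∑ j, (M j + 1), mul_nonneg hK0 (Finset.sum_nonneg fun j _ => by linarith [hM0 j]),
    fun φ hφ => ?_⟩
  have hG : ContDiff ℝ 1 (fun x => ‖φ x‖ ^ 2) := hφ.norm_sq ℝ
  refine (hK _ hG.continuous fun x => by positivity).trans ?_
  rw [mul_assoc, Finset.sum_mul]
  refine mul_le_mul_of_nonneg_left (Finset.sum_le_sum fun j _ => ?_) hK0
  have hF : ContDiff ℝ 1 (fun x => A.χ j x * ‖φ x‖ ^ 2) :=
    ((A.test j).contDiff.of_le (by simp)).mul hG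
  have h1 := (A.chart j).setIntegral_fderiv hΩ.measurableSet hF
    (A.hasCompactSupport_χ_smul j fun x => ‖φ x‖ ^ 2) (A.tsupport_χ_smul j fun x => ‖φ x‖ ^ 2)
  rw [← neg_eq_iff_eq_neg.2 h1]
  have hi1 : Integrable (fun x => ‖φ x‖ ^ 2) (volume.restrict Ω) :=
    memLp_one_iff_integrable.1 (memLp_restrict hΩ.measurableSet hb hG.continuous 1)
  have hi2 : ∀ i, Integrable (fun x => ‖partialDeriv i φ x‖ ^ 2) (volume.restrict Ω) := fun i =>
    memLp_one_iff_integrable.1 (memLp_restrict hΩ.measurableSet hb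
      ((continuous_partialDeriv hφ i).norm.pow 2) 1)
  rw [← integral_finsetSum _ fun i _ => hi2 i, ← integral_add hi1
    (integrable_finsetSum _ fun i _ => hi2 i), ← integral_const_mul, ← integral_neg]
  refine setIntegral_mono_on (memLp_one_iff_integrable.1 (memLp_restrict hΩ.measurableSet hb
      ((hF.continuous_fderiv one_ne_zero).clm_apply continuous_const).neg 1))
    ((hi1.add (integrable_finsetSum _ fun i _ => hi2 i)).const_mul _) hΩ.measurableSet
    fun x hx => ?_
  have hχ1 : A.χ j x ≤ 1 := by
    have h2 := A.sum_eq_one x (subset_closure hx)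
    have h4 := Finset.single_le_sum (f := fun j => A.χ j x) (fun j _ => A.nonneg j x)
      (Finset.mem_univ j)
    have h5 := A.nonneg₀ x
    linarith
  have hd := (((A.test j).contDiff.differentiable (by simp)) x).hasFDerivAt.mul
    ((hφ.differentiable one_ne_zero) x).hasFDerivAt.norm_sq
  have hd2 : fderiv ℝ (fun x => A.χ j x * ‖φ x‖ ^ 2) x (A.e j) =
      A.χ j x * (2 * inner ℝ (φ x) (fderiv ℝ φ x (A.e j))) +
        ‖φ x‖ ^ 2 * fderiv ℝ (A.χ j) x (A.e j) := by
    rw [show (fun x => A.χ j x * ‖φ x‖ ^ 2) = A.χ j * fun x => ‖φ x‖ ^ 2 from rfl, hd.fderiv]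
    simp only [add_apply, smul_apply, ContinuousLinearMap.comp_apply,
      innerSL_apply_apply, smul_eq_mul, nsmul_eq_mul, Nat.cast_ofNat]
  have hb1 := norm_fderiv_apply_sq_le (A.chart j).norm_eq_one φ x
  have hb2 := abs_le.1 (hM j x)
  have hb3 := abs_le.1 (abs_real_inner_le_norm (φ x) (fderiv ℝ φ x (A.e j)))
  have hb4 : -(2 * inner ℝ (φ x) (fderiv ℝ φ x (A.e j))) ≤
      ‖φ x‖ ^ 2 + ∑ i, ‖partialDeriv i φ x‖ ^ 2 := by
    nlinarith [sq_nonneg (‖φ x‖ - ‖fderiv ℝ φ x (A.e j)‖)]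
  have hS : 0 ≤ ∑ i, ‖partialDeriv i φ x‖ ^ 2 := Finset.sum_nonneg fun i _ => by positivity
  have hb5 : A.χ j x * -(2 * inner ℝ (φ x) (fderiv ℝ φ x (A.e j))) ≤
      ‖φ x‖ ^ 2 + ∑ i, ‖partialDeriv i φ x‖ ^ 2 := by
    calc _ ≤ A.χ j x * (‖φ x‖ ^ 2 + ∑ i, ‖partialDeriv i φ x‖ ^ 2) :=
          mul_le_mul_of_nonneg_left hb4 (A.nonneg j x)
      _ ≤ 1 * (‖φ x‖ ^ 2 + ∑ i, ‖partialDeriv i φ x‖ ^ 2) :=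
          mul_le_mul_of_nonneg_right hχ1 (by positivity)
      _ = _ := one_mul _
  have hb6 : ‖φ x‖ ^ 2 * -fderiv ℝ (A.χ j) x (A.e j) ≤ ‖φ x‖ ^ 2 * M j :=
    mul_le_mul_of_nonneg_left (by linarith [hb2.1]) (by positivity)
  rw [hd2]
  nlinarith [mul_nonneg (hM0 j) hS]

end BoundaryAtlas

/-! ### Weak derivatives -/

section Weak

variable {d : ℕ} {U V : Set (EuclideanSpace ℝ (Fin d))} {F : Type*} [NormedAddCommGroup F]
  [NormedSpace ℝ F] {f f' f'' : EuclideanSpace ℝ (Fin d) → F} {i : Fin d}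

lemma IsTestFunction.setIntegral_eq {φ : EuclideanSpace ℝ (Fin d) → ℝ} (hφ : IsTestFunction U φ)
    (f : EuclideanSpace ℝ (Fin d) → F) : ∫ x in U, φ x • f x = ∫ x, φ x • f x :=
  setIntegral_eq_integral_of_forall_compl_eq_zero fun x hx => by
    rw [image_eq_zero_of_notMem_tsupport fun h => hx (hφ.tsupport_subset h), zero_smul]

lemma isTestFunction_partialDeriv {φ : EuclideanSpace ℝ (Fin d) → ℝ} (hφ : IsTestFunction U φ)
    (i : Fin d) : IsTestFunction U (partialDeriv i φ) :=
  ⟨contDiff_partialDeriv hφ.contDiff i,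
    hφ.hasCompactSupport.isCompact.of_isClosed_subset (isClosed_tsupport _)
      (tsupport_partialDeriv_subset φ i),
    (tsupport_partialDeriv_subset φ i).trans hφ.tsupport_subset⟩

lemma IsTestFunction.mono {φ : EuclideanSpace ℝ (Fin d) → ℝ} (hφ : IsTestFunction V φ)
    (h : V ⊆ U) : IsTestFunction U φ :=
  ⟨hφ.contDiff, hφ.hasCompactSupport, hφ.tsupport_subset.trans h⟩

lemma IsTestFunction.integrable_smul {φ : EuclideanSpace ℝ (Fin d) → ℝ} (hφ : IsTestFunction U φ)
    (hU : IsOpen U) (hf : LocallyIntegrableOn f U) :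
    Integrable (fun x => φ x • f x) := by
  have h1 : IntegrableOn f (tsupport φ) :=
    (locallyIntegrableOn_iff hU.isLocallyClosed).1 hf _ hφ.tsupport_subset hφ.hasCompactSupport
  have h2 : IntegrableOn (fun x => φ x • f x) (tsupport φ) :=
    h1.continuousOn_smul hφ.contDiff.continuous.continuousOn hφ.hasCompactSupport
  refine (integrableOn_iff_integrable_of_support_subset fun x hx => subset_tsupport φ fun h => ?_).1 h2
  exact hx (by simp [h])

lemma HasWeakPartial.ae_unique [CompleteSpace F] (hU : IsOpen U) (h1 : HasWeakPartial U i f f')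
    (h2 : HasWeakPartial U i f f'') : f' =ᵐ[volume.restrict U] f'' := by
  have hloc : LocallyIntegrableOn (fun x => f' x - f'' x) U := h1.2.1.sub h2.2.1
  have := hU.ae_eq_zero_of_integral_contDiff_smul_eq_zero hloc fun g hg hgs hgU => by
    have hφ : IsTestFunction U g := ⟨hg, hgs, hgU⟩
    have h3 := (h1.2.2 g hφ).symm.trans (h2.2.2 g hφ)
    rw [hφ.setIntegral_eq, hφ.setIntegral_eq] at h3
    simp_rw [smul_sub]
    rw [integral_sub (hφ.integrable_smul hU h1.2.1) (hφ.integrable_smul hU h2.2.1),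
      neg_injective h3, sub_self]
  filter_upwards [(ae_restrict_iff' hU.measurableSet).2 this] with x hx
  exact sub_eq_zero.1 hx

lemma integrable_mul_of_memLp {α : Type*} {m0 : MeasurableSpace α} {μ : Measure α} {f g : α → ℂ}
    (hf : MemLp f 2 μ) (hg : MemLp g 2 μ) : Integrable (fun x => f x * g x) μ :=
  hf.integrable_mul hg

lemma memLp_indicator {g : EuclideanSpace ℝ (Fin d) → ℂ} (hU : MeasurableSet U)
    (hg : MemLp g 2 (volume.restrict U)) : MemLp (U.indicator g) 2 :=
  (memLp_indicator_iff_restrict hU).2 hg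

lemma locallyIntegrable_indicator {g : EuclideanSpace ℝ (Fin d) → ℂ} (hU : MeasurableSet U)
    (hg : MemLp g 2 (volume.restrict U)) : LocallyIntegrable (U.indicator g) :=
  (memLp_indicator hU hg).locallyIntegrable (by norm_num)

end Weak

/-! ### Density of smooth functions -/

section Density

variable {d : ℕ} {Ω : Set (EuclideanSpace ℝ (Fin d))} {δ : ℝ} {ι : Type} [Fintype ι]

/-- Kernels on the supports of the partition of unity. With `σ = 1` they average over points well
inside `Ω`, and with `σ = -1` over points that are outside `Ω` when `x` is near the boundary. -/
lemma BoundaryAtlas.exists_kernels (A : BoundaryAtlas Ω δ ι) (hΩ : IsOpen Ω) (σ : ℝ)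
    (hσ : σ = 1 ∨ σ = -1) :
    ∃ (ρ : Option ι → ℕ → EuclideanSpace ℝ (Fin d) → ℝ)
      (a : Option ι → ℕ → EuclideanSpace ℝ (Fin d)) (ε : Option ι → ℕ → ℝ),
      (∀ o k, IsMollifier (ρ o k) (a o k) (ε o k)) ∧ (∀ o, Tendsto (a o) atTop (𝓝 0)) ∧
      (∀ o, Tendsto (ε o) atTop (𝓝 0)) ∧
      ∀ o k, ∀ x ∈ tsupport (A.cutoff o),
        (σ = 1 → x ∈ Ω → Metric.closedBall (x - a o k) (ε o k) ⊆ Ω) ∧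
        (σ = -1 → (Metric.closedBall (x - a o k) (ε o k) ∩ closure Ω).Nonempty → x ∈ Ω) := by
  choose κ hκ s₀ hs₀ hsh using fun o => A.shiftsInto hΩ o
  let s : Option ι → ℕ → ℝ := fun o k => s₀ o * (1 / ((k : ℝ) + 1))
  have hs : ∀ o k, 0 < s o k := fun o k => mul_pos (hs₀ o) (by positivity)
  have hss : ∀ o k, s o k ≤ s₀ o := fun o k => by
    refine mul_le_of_le_one_right (hs₀ o).le ?_
    rw [div_le_one (by positivity)]
    linarith [(Nat.cast_nonneg k : (0 : ℝ) ≤ k)]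
  have hst : ∀ o, Tendsto (s o) atTop (𝓝 0) := fun o => by
    simpa [s] using (tendsto_one_div_add_atTop_nhds_zero_nat (𝕜 := ℝ)).const_mul (s₀ o)
  choose ρ hρ using fun o k =>
    exists_isMollifier (-σ • s o k • A.shift o) (mul_pos (hκ o) (hs o k))
  refine ⟨ρ, fun o k => -σ • s o k • A.shift o, fun o k => κ o * s o k, hρ, fun o => ?_,
    fun o => ?_, fun o k x hx => ⟨?_, ?_⟩⟩
  · simpa using ((hst o).smul_const (A.shift o)).const_smul (-σ)
  · simpa using (hst o).const_mul (κ o)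
  · rintro rfl hxΩ
    have := (hsh o (s o k) (hs o k) (hss o k) x hx).1 hxΩ
    simpa using this
  · rintro rfl hne
    refine (hsh o (s o k) (hs o k) (hss o k) x hx).2 ?_
    simpa using hne

lemma partialDeriv_eq_of_eqOn {F : Type*} [NormedAddCommGroup F] [NormedSpace ℝ F]
    {f g : EuclideanSpace ℝ (Fin d) → F} (hΩ : IsOpen Ω) (h : ∀ x ∈ Ω, f x = g x)
    {x : EuclideanSpace ℝ (Fin d)} (hx : x ∈ Ω) (i : Fin d) :
    partialDeriv i f x = partialDeriv i g x := by
  have : f =ᶠ[𝓝 x] g := by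
    filter_upwards [hΩ.mem_nhds hx] with y hy using h y hy
  rw [partialDeriv, partialDeriv, this.fderiv_eq]

lemma memLp_top_ofReal {ψ : EuclideanSpace ℝ (Fin d) → ℝ} (hψ : Continuous ψ)
    (hs : HasCompactSupport ψ) (μ : Measure (EuclideanSpace ℝ (Fin d))) :
    MemLp (fun x => (ψ x : ℂ)) ⊤ μ := by
  obtain ⟨C, hC⟩ := hψ.bounded_above_of_compact_support hs
  exact memLp_top_of_bound (Complex.continuous_ofReal.comp hψ).aestronglyMeasurable C
    (Eventually.of_forall fun x => by simpa using hC x)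

namespace BoundaryAtlas

lemma sum_partialDeriv_cutoff (A : BoundaryAtlas Ω δ ι) (hΩ : IsOpen Ω)
    {x : EuclideanSpace ℝ (Fin d)} (hx : x ∈ Ω) (i : Fin d) :
    ∑ o, partialDeriv i (A.cutoff o) x = 0 := by
  rw [← partialDeriv_sum _ fun o _ => ((A.contDiff_cutoff o).differentiable (by simp)) x,
    partialDeriv_eq_of_eqOn (g := fun _ => (1 : ℝ)) hΩ
      (fun y hy => A.sum_cutoff (subset_closure hy)) hx]
  simp [partialDeriv]

lemma sum_partialDeriv_partialDeriv_cutoff (A : BoundaryAtlas Ω δ ι) (hΩ : IsOpen Ω)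
    {x : EuclideanSpace ℝ (Fin d)} (hx : x ∈ Ω) (i l : Fin d) :
    ∑ o, partialDeriv l (partialDeriv i (A.cutoff o)) x = 0 := by
  rw [← partialDeriv_sum _ fun o _ =>
      ((contDiff_partialDeriv (A.contDiff_cutoff o) i).differentiable (by simp)) x,
    partialDeriv_eq_of_eqOn (g := fun _ => (0 : ℝ)) hΩ
      (fun y hy => A.sum_partialDeriv_cutoff hΩ hy i) hx]
  simp [partialDeriv]

/-- Convergence of locally mollified functions. -/
lemma tendsto_cutoff_smul_mollify {ρ : ℕ → EuclideanSpace ℝ (Fin d) → ℝ}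
    {a : ℕ → EuclideanSpace ℝ (Fin d)} {ε : ℕ → ℝ} (h : ∀ k, IsMollifier (ρ k) (a k) (ε k))
    (ha : Tendsto a atTop (𝓝 0)) (hε : Tendsto ε atTop (𝓝 0)) (hΩ : MeasurableSet Ω)
    {f : EuclideanSpace ℝ (Fin d) → ℂ} (hf : MemLp f 2 (volume.restrict Ω))
    {ψ : EuclideanSpace ℝ (Fin d) → ℝ} (hψ : Continuous ψ) (hs : HasCompactSupport ψ) :
    L2Tendsto (volume.restrict Ω) (fun k x => ψ x • mollify (ρ k) (Ω.indicator f) x)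
      (fun x => ψ x • f x) := by
  have h1 := ((tendsto_mollify h ha hε (memLp_indicator hΩ hf)).mono_measure
    (Measure.restrict_le_self (s := Ω))).mul_top (memLp_top_ofReal hψ hs _)
  refine h1.congr (fun k => ?_) ?_
  · exact Eventually.of_forall fun x => by simp
  · filter_upwards [ae_restrict_mem hΩ] with x hx
    simp [hx]

/-- Smooth functions are dense in `H²(Ω)`: on the support of each member of the partition of unity
the function is mollified with kernels shifted along the chart direction, which only see values
inside `Ω`. -/
theorem exists_smooth_approx (A : BoundaryAtlas Ω δ ι) (hΩ : IsOpen Ω)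
    {u : EuclideanSpace ℝ (Fin d) → ℂ} {G : Fin d → EuclideanSpace ℝ (Fin d) → ℂ}
    {H : Fin d → Fin d → EuclideanSpace ℝ (Fin d) → ℂ} (hu : MemLp u 2 (volume.restrict Ω))
    (hG : HasWeakGradient Ω u G) (hG2 : ∀ i, MemLp (G i) 2 (volume.restrict Ω))
    (hH : ∀ i, HasWeakGradient Ω (G i) (H i))
    (hH2 : ∀ i l, MemLp (H i l) 2 (volume.restrict Ω)) :
    ∃ φ : ℕ → EuclideanSpace ℝ (Fin d) → ℂ, (∀ k, ContDiff ℝ ∞ (φ k)) ∧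
      L2Tendsto (volume.restrict Ω) φ u ∧
      (∀ i, L2Tendsto (volume.restrict Ω) (fun k => partialDeriv i (φ k)) (G i)) ∧
      ∀ i l, L2Tendsto (volume.restrict Ω)
        (fun k => partialDeriv l (partialDeriv i (φ k))) (H i l) := by
  obtain ⟨ρ, a, ε, hρ, ha, hε, hin⟩ := A.exists_kernels hΩ 1 (Or.inl rfl)
  have hm := hΩ.measurableSet
  -- the Leibniz rule inside `Ω`, for a function supported where the kernels stay in `Ω`
  have hleib : ∀ (o : Option ι) (k : ℕ) (ψ : EuclideanSpace ℝ (Fin d) → ℝ), ContDiff ℝ ∞ ψ →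
      tsupport ψ ⊆ tsupport (A.cutoff o) → ∀ (l : Fin d) (f f' : EuclideanSpace ℝ (Fin d) → ℂ),
      MemLp f 2 (volume.restrict Ω) → HasWeakPartial Ω l f f' → ∀ x ∈ Ω,
      partialDeriv l (fun x => ψ x • mollify (ρ o k) (Ω.indicator f) x) x =
        partialDeriv l ψ x • mollify (ρ o k) (Ω.indicator f) x +
          ψ x • mollify (ρ o k) (Ω.indicator f') x := by
    intro o k ψ hψ hψs l f f' hf hff' x hx
    have hloc := locallyIntegrable_indicator hm hf
    rw [partialDeriv_smul ((hψ.differentiable (by simp)) x)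
      ((((hρ o k).contDiff_mollify hloc).differentiable (by simp)) x)]
    by_cases hxs : x ∈ tsupport ψ
    · rw [(hρ o k).partialDeriv_mollify hm hloc l x
        (hff'.2.2 _ ((hρ o k).isTestFunction ((hin o k x (hψs hxs)).1 rfl hx)))]
    · simp [image_eq_zero_of_notMem_tsupport hxs]
  have hsm : ∀ (o : Option ι) (k : ℕ) (ψ : EuclideanSpace ℝ (Fin d) → ℝ), ContDiff ℝ ∞ ψ →
      ∀ f : EuclideanSpace ℝ (Fin d) → ℂ, MemLp f 2 (volume.restrict Ω) →
      ContDiff ℝ ∞ (fun x => ψ x • mollify (ρ o k) (Ω.indicator f) x) := fun o k ψ hψ f hf =>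
    hψ.smul ((hρ o k).contDiff_mollify (locallyIntegrable_indicator hm hf))
  have hcs : ∀ o i, HasCompactSupport (partialDeriv i (A.cutoff o)) := fun o i =>
    (A.hasCompactSupport_cutoff o).fderiv_apply (𝕜 := ℝ) _
  have hcd : ∀ o i, ContDiff ℝ ∞ (partialDeriv i (A.cutoff o)) := fun o i =>
    contDiff_partialDeriv (A.contDiff_cutoff o) i
  have hd1 : ∀ k i, ∀ x ∈ Ω,
      partialDeriv i (fun x => ∑ o, A.cutoff o x • mollify (ρ o k) (Ω.indicator u) x) x =
        ∑ o, (partialDeriv i (A.cutoff o) x • mollify (ρ o k) (Ω.indicator u) x +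
          A.cutoff o x • mollify (ρ o k) (Ω.indicator (G i)) x) := by
    intro k i x hx
    rw [partialDeriv_sum _ fun o _ =>
      ((hsm o k _ (A.contDiff_cutoff o) u hu).differentiable (by simp)) x]
    exact Finset.sum_congr rfl fun o _ =>
      hleib o k _ (A.contDiff_cutoff o) le_rfl i u (G i) hu (hG i) x hx
  have hd2 : ∀ k i l, ∀ x ∈ Ω, partialDeriv l (partialDeriv i
      (fun x => ∑ o, A.cutoff o x • mollify (ρ o k) (Ω.indicator u) x)) x =
        ∑ o, (partialDeriv l (partialDeriv i (A.cutoff o)) x • mollify (ρ o k) (Ω.indicator u) x +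
          partialDeriv i (A.cutoff o) x • mollify (ρ o k) (Ω.indicator (G l)) x +
          (partialDeriv l (A.cutoff o) x • mollify (ρ o k) (Ω.indicator (G i)) x +
          A.cutoff o x • mollify (ρ o k) (Ω.indicator (H i l)) x)) := by
    intro k i l x hx
    have hD1 : ∀ o, DifferentiableAt ℝ
        (fun x => partialDeriv i (A.cutoff o) x • mollify (ρ o k) (Ω.indicator u) x) x := fun o =>
      ((hsm o k _ (hcd o i) u hu).differentiable (by simp)) x
    have hD2 : ∀ o, DifferentiableAt ℝ
        (fun x => A.cutoff o x • mollify (ρ o k) (Ω.indicator (G i)) x) x := fun o =>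
      ((hsm o k _ (A.contDiff_cutoff o) _ (hG2 i)).differentiable (by simp)) x
    rw [partialDeriv_eq_of_eqOn hΩ (hd1 k i) hx, partialDeriv_sum _ fun o _ => (hD1 o).fun_add (hD2 o)]
    refine Finset.sum_congr rfl fun o _ => ?_
    rw [← hleib o k _ (hcd o i) (tsupport_partialDeriv_subset _ i) l u (G l) hu (hG l) x hx,
      ← hleib o k _ (A.contDiff_cutoff o) le_rfl l (G i) (H i l) (hG2 i) (hH i l) x hx]
    exact partialDeriv_add (hD1 o) (hD2 o) l
  have hlim := fun (o : Option ι) {f : EuclideanSpace ℝ (Fin d) → ℂ}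
    (hf : MemLp f 2 (volume.restrict Ω)) {ψ : EuclideanSpace ℝ (Fin d) → ℝ} (hψ : Continuous ψ)
    (hs : HasCompactSupport ψ) => tendsto_cutoff_smul_mollify (hρ o) (ha o) (hε o) hm hf hψ hs
  refine ⟨fun k x => ∑ o, A.cutoff o x • mollify (ρ o k) (Ω.indicator u) x,
    fun k => ContDiff.sum fun o _ => hsm o k _ (A.contDiff_cutoff o) u hu, ?_, fun i => ?_,
    fun i l => ?_⟩
  · refine (L2Tendsto.sum Finset.univ fun o _ => hlim o hu (A.contDiff_cutoff o).continuous
      (A.hasCompactSupport_cutoff o)).congr (fun k => ae_eq_rfl) ?_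
    filter_upwards [ae_restrict_mem hm] with x hx
    rw [← Finset.sum_smul, A.sum_cutoff (subset_closure hx), one_smul]
  · refine (L2Tendsto.sum Finset.univ fun o _ =>
      (hlim o hu (hcd o i).continuous (hcs o i)).add
      (hlim o (hG2 i) (A.contDiff_cutoff o).continuous
      (A.hasCompactSupport_cutoff o))).congr (fun k => ?_) ?_
    · filter_upwards [ae_restrict_mem hm] with x hx
      exact (hd1 k i x hx).symm
    · filter_upwards [ae_restrict_mem hm] with x hx
      rw [Finset.sum_add_distrib, ← Finset.sum_smul, ← Finset.sum_smul,
        A.sum_cutoff (subset_closure hx), A.sum_partialDeriv_cutoff hΩ hx, one_smul, zero_smul,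
        zero_add]
  · refine (L2Tendsto.sum Finset.univ fun o _ =>
      ((hlim o hu (contDiff_partialDeriv (hcd o i) l).continuous
      ((hcs o i).fderiv_apply (𝕜 := ℝ) _)).add
      (hlim o (hG2 l) (hcd o i).continuous (hcs o i))).add
      ((hlim o (hG2 i) (hcd o l).continuous (hcs o l)).add
      (hlim o (hH2 i l) (A.contDiff_cutoff o).continuous
      (A.hasCompactSupport_cutoff o)))).congr (fun k => ?_) ?_
    · filter_upwards [ae_restrict_mem hm] with x hx
      exact (hd2 k i l x hx).symm
    · filter_upwards [ae_restrict_mem hm] with x hx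
      simp only [Finset.sum_add_distrib, ← Finset.sum_smul]
      rw [A.sum_cutoff (subset_closure hx), A.sum_partialDeriv_cutoff hΩ hx,
        A.sum_partialDeriv_cutoff hΩ hx, A.sum_partialDeriv_partialDeriv_cutoff hΩ hx, one_smul]
      simp

/-- If `u` has vanishing trace, its extension by zero has a weak derivative on the whole space. -/
lemma setIntegral_partialDeriv_smul_of_hasTrace_zero (A : BoundaryAtlas Ω δ ι) (hΩ : IsOpen Ω)
    (hb : Bornology.IsBounded Ω) {u : EuclideanSpace ℝ (Fin d) → ℂ}
    {G : Fin d → EuclideanSpace ℝ (Fin d) → ℂ} {φ : ℕ → EuclideanSpace ℝ (Fin d) → ℂ}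
    (hφ : ∀ k, ContDiff ℝ ∞ (φ k)) (hφu : L2Tendsto (volume.restrict Ω) φ u)
    (hφG : ∀ i, L2Tendsto (volume.restrict Ω) (fun k => partialDeriv i (φ k)) (G i))
    (hφ0 : L2Tendsto (surfaceMeasure Ω) φ (fun _ => 0)) (i : Fin d)
    {ψ : EuclideanSpace ℝ (Fin d) → ℝ} (hψ : ContDiff ℝ ∞ ψ) (hψs : HasCompactSupport ψ) :
    ∫ x in Ω, partialDeriv i ψ x • u x = -∫ x in Ω, ψ x • G i x := by
  have := isFiniteMeasure_restrict hb
  have := A.isFiniteMeasure_surfaceMeasure hΩ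
  obtain ⟨C, hC⟩ := A.exists_norm_setIntegral_partialDeriv_le (F := ℂ) hΩ hb
  have hψ2 : MemLp (fun x => (ψ x : ℂ)) 2 (volume.restrict Ω) :=
    memLp_restrict hΩ.measurableSet hb (Complex.continuous_ofReal.comp hψ.continuous) 2
  have hψ2' : MemLp (fun x => ((partialDeriv i ψ x : ℝ) : ℂ)) 2 (volume.restrict Ω) :=
    memLp_restrict hΩ.measurableSet hb
      (Complex.continuous_ofReal.comp (contDiff_partialDeriv hψ i).continuous) 2
  have h1 := ((L2Tendsto.const hψ2').integral_mul hφu).add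
    ((L2Tendsto.const hψ2).integral_mul (hφG i))
  have h2 : ∀ k, (∫ x in Ω, ((partialDeriv i ψ x : ℝ) : ℂ) * φ k x) +
      ∫ x in Ω, (ψ x : ℂ) * partialDeriv i (φ k) x =
      ∫ x in Ω, partialDeriv i (fun x => ψ x • φ k x) x := by
    intro k
    rw [← integral_add (integrable_mul_of_memLp hψ2' (hφu.memLp k))
      (integrable_mul_of_memLp hψ2 ((hφG i).memLp k))]
    congr 1 with x
    rw [partialDeriv_smul ((hψ.differentiable (by simp)) x) (((hφ k).differentiable (by simp)) x)]
    simp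
  have h3 : Tendsto (fun k => ∫ x in Ω, partialDeriv i (fun x => ψ x • φ k x) x) atTop (𝓝 0) := by
    have h4 := ((hφ0.mul_top (memLp_top_ofReal hψ.continuous hψs _))).tendsto
    simp only [mul_zero, sub_zero] at h4
    -- convergence in `L²` implies convergence in `L¹` on the boundary
    have h5 : Tendsto (fun k => ∫ x, ‖ψ x • φ k x‖ ∂surfaceMeasure Ω) atTop (𝓝 0) := by
      have h6 : Tendsto (fun k => ∫ x, ‖(ψ x • φ k x)‖ ∂surfaceMeasure Ω) atTop
          (𝓝 (∫ x, (0 : ℝ) ∂surfaceMeasure Ω)) := by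
        refine tendsto_integral_of_L1' (fun _ => 0) aestronglyMeasurable_const
          (Eventually.of_forall fun k => ?_) ?_
        · exact memLp_one_iff_integrable.1 (memLp_surfaceMeasure hb
            (hψ.continuous.smul (hφ k).continuous).norm 1)
        · have h7 := ENNReal.Tendsto.mul_const h4
            (b := surfaceMeasure Ω Set.univ ^ (1 / (1 : ENNReal).toReal - 1 / (2 : ENNReal).toReal))
            (Or.inr (ENNReal.rpow_ne_top_of_nonneg (by norm_num) (measure_ne_top _ _)))
          rw [zero_mul] at h7
          refine tendsto_of_tendsto_of_tendsto_of_le_of_le tendsto_const_nhds h7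
            (fun _ => zero_le) fun k => ?_
          have h8 := eLpNorm_le_eLpNorm_mul_rpow_measure_univ (p := 1) (q := 2) (by norm_num)
            (hψ.continuous.smul (hφ k).continuous).aestronglyMeasurable (μ := surfaceMeasure Ω)
          have h9 : eLpNorm ((fun x => ‖ψ x • φ k x‖) - fun _ => 0) 1 (surfaceMeasure Ω) =
              eLpNorm (fun x => ψ x • φ k x) 1 (surfaceMeasure Ω) := by
            rw [← eLpNorm_norm (fun x => ψ x • φ k x)]
            congr 1
            ext x
            simp
          rw [h9]
          refine h8.trans (le_of_eq ?_)
          congr 2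
      simpa using h6
    refine squeeze_zero_norm (fun k => hC i _ ((hψ.smul (hφ k)).of_le (by simp))) ?_
    simpa using h5.const_mul C
  simp_rw [h2] at h1
  have h4 := tendsto_nhds_unique h1 h3
  simp only [← Complex.real_smul] at h4
  exact eq_neg_of_add_eq_zero_left h4

open scoped Pointwise in
/-- A function of `H¹(Ω)` with vanishing trace is a limit of test functions: it is extended by zero,
and mollified with kernels shifted so that the result vanishes near the boundary. -/
theorem exists_test_approx (A : BoundaryAtlas Ω δ ι) (hΩ : IsOpen Ω)
    (hb : Bornology.IsBounded Ω) {u : EuclideanSpace ℝ (Fin d) → ℂ}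
    {G : Fin d → EuclideanSpace ℝ (Fin d) → ℂ} (hu : MemLp u 2 (volume.restrict Ω))
    (hG2 : ∀ i, MemLp (G i) 2 (volume.restrict Ω))
    (hext : ∀ i (ψ : EuclideanSpace ℝ (Fin d) → ℝ), ContDiff ℝ ∞ ψ → HasCompactSupport ψ →
      ∫ x in Ω, partialDeriv i ψ x • u x = -∫ x in Ω, ψ x • G i x) :
    ∃ w : ℕ → EuclideanSpace ℝ (Fin d) → ℂ, (∀ k, ContDiff ℝ ∞ (w k)) ∧
      (∀ k, HasCompactSupport (w k)) ∧ (∀ k, tsupport (w k) ⊆ Ω) ∧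
      L2Tendsto (volume.restrict Ω) w u ∧
      ∀ i, L2Tendsto (volume.restrict Ω) (fun k => partialDeriv i (w k)) (G i) := by
  obtain ⟨ρ, a, ε, hρ, ha, hε, hin⟩ := A.exists_kernels hΩ (-1) (Or.inr rfl)
  have hm := hΩ.measurableSet
  have hloc := locallyIntegrable_indicator hm hu
  have hsm : ∀ (o : Option ι) (k : ℕ),
      ContDiff ℝ ∞ (fun x => A.cutoff o x • mollify (ρ o k) (Ω.indicator u) x) := fun o k =>
    (A.contDiff_cutoff o).smul ((hρ o k).contDiff_mollify hloc)
  have hts : ∀ o k, tsupport (fun x => A.cutoff o x • mollify (ρ o k) (Ω.indicator u) x) ⊆ Ω := by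
    intro o k
    set T := tsupport (A.cutoff o) ∩ (closure Ω + Metric.closedBall (a o k) (ε o k)) with hT
    have hTc : IsClosed T := (isClosed_tsupport _).inter
      ((hb.isCompact_closure).add (isCompact_closedBall _ _)).isClosed
    have hTΩ : T ⊆ Ω := by
      rintro x ⟨hx, y, hy, z, hz, rfl⟩
      refine (hin o k _ hx).2 rfl ⟨y, ?_, hy⟩
      rw [mem_closedBall_iff_norm] at hz ⊢
      rw [show y - (y + z - a o k) = -(z - a o k) by abel, norm_neg]
      exact hz
    refine (closure_minimal (fun x hx => Set.mem_inter ?_ ?_) hTc).trans hTΩ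
    · exact subset_tsupport _ fun h => hx (by simp [h])
    · by_contra hne
      refine hx ?_
      have h0 : mollify (ρ o k) (Ω.indicator u) x = 0 := by
        rw [mollify_apply]
        refine integral_eq_zero_of_ae (Eventually.of_forall fun y => ?_)
        by_cases hy : ρ o k y = 0
        · simp [hy]
        · have hxy : x - y ∉ Ω := fun h => hne ⟨x - y, subset_closure h, y,
            (hρ o k).tsupport_subset (subset_tsupport _ hy), sub_add_cancel _ _⟩
          simp [hxy]
      simp [h0]
  have hd1 : ∀ k i x,
      partialDeriv i (fun x => ∑ o, A.cutoff o x • mollify (ρ o k) (Ω.indicator u) x) x =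
        ∑ o, (partialDeriv i (A.cutoff o) x • mollify (ρ o k) (Ω.indicator u) x +
          A.cutoff o x • mollify (ρ o k) (Ω.indicator (G i)) x) := by
    intro k i x
    rw [partialDeriv_sum _ fun o _ => ((hsm o k).differentiable (by simp)) x]
    refine Finset.sum_congr rfl fun o _ => ?_
    rw [partialDeriv_smul (((A.contDiff_cutoff o).differentiable (by simp)) x)
      ((((hρ o k).contDiff_mollify hloc).differentiable (by simp)) x)]
    have htest : IsTestFunction Set.univ (fun w => ρ o k (x - w)) :=
      (hρ o k).isTestFunction (Set.subset_univ _)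
    rw [(hρ o k).partialDeriv_mollify hm hloc i x
      (hext i _ htest.contDiff htest.hasCompactSupport)]
  have hcs : ∀ o i, HasCompactSupport (partialDeriv i (A.cutoff o)) := fun o i =>
    (A.hasCompactSupport_cutoff o).fderiv_apply (𝕜 := ℝ) _
  have hlim := fun (o : Option ι) {f : EuclideanSpace ℝ (Fin d) → ℂ}
    (hf : MemLp f 2 (volume.restrict Ω)) {ψ : EuclideanSpace ℝ (Fin d) → ℝ} (hψ : Continuous ψ)
    (hs : HasCompactSupport ψ) => tendsto_cutoff_smul_mollify (hρ o) (ha o) (hε o) hm hf hψ hs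
  have hsub : ∀ k, tsupport (fun x => ∑ o, A.cutoff o x • mollify (ρ o k) (Ω.indicator u) x) ⊆
      ⋃ o, tsupport (fun x => A.cutoff o x • mollify (ρ o k) (Ω.indicator u) x) := by
    intro k
    refine closure_minimal (fun x hx => ?_) (isClosed_iUnion_of_finite fun o => isClosed_tsupport _)
    obtain ⟨o, -, ho⟩ := Finset.exists_ne_zero_of_sum_ne_zero hx
    exact Set.mem_iUnion.2 ⟨o, subset_tsupport _ ho⟩
  have hΩk : ∀ k, tsupport (fun x => ∑ o, A.cutoff o x • mollify (ρ o k) (Ω.indicator u) x) ⊆ Ω :=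
    fun k => (hsub k).trans (Set.iUnion_subset fun o => hts o k)
  refine ⟨fun k x => ∑ o, A.cutoff o x • mollify (ρ o k) (Ω.indicator u) x,
    fun k => ContDiff.sum fun o _ => hsm o k, fun k => ?_, hΩk, ?_, fun i => ?_⟩
  · exact hb.isCompact_closure.of_isClosed_subset (isClosed_tsupport _)
      ((hΩk k).trans subset_closure)
  · refine (L2Tendsto.sum Finset.univ fun o _ => hlim o hu (A.contDiff_cutoff o).continuous
      (A.hasCompactSupport_cutoff o)).congr (fun k => ae_eq_rfl) ?_
    filter_upwards [ae_restrict_mem hm] with x hx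
    rw [← Finset.sum_smul, A.sum_cutoff (subset_closure hx), one_smul]
  · refine (L2Tendsto.sum Finset.univ fun o _ =>
      (hlim o hu (contDiff_partialDeriv (A.contDiff_cutoff o) i).continuous (hcs o i)).add
      (hlim o (hG2 i) (A.contDiff_cutoff o).continuous
      (A.hasCompactSupport_cutoff o))).congr (fun k => ?_) ?_
    · exact Eventually.of_forall fun x => (hd1 k i x).symm
    · filter_upwards [ae_restrict_mem hm] with x hx
      rw [Finset.sum_add_distrib, ← Finset.sum_smul, ← Finset.sum_smul,
        A.sum_cutoff (subset_closure hx), A.sum_partialDeriv_cutoff hΩ hx, one_smul, zero_smul,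
        zero_add]

end BoundaryAtlas

end Density

/-! ### Complex test functions and the energy estimate -/

/-- `w` is a complex test function in `U`. -/
structure IsComplexTest {d : ℕ} (U : Set (EuclideanSpace ℝ (Fin d)))
    (w : EuclideanSpace ℝ (Fin d) → ℂ) : Prop where
  contDiff : ContDiff ℝ ∞ w
  hasCompactSupport : HasCompactSupport w
  tsupport_subset : tsupport w ⊆ U

section ComplexTest

variable {d : ℕ} {U : Set (EuclideanSpace ℝ (Fin d))} {w f f' : EuclideanSpace ℝ (Fin d) → ℂ}
  {i : Fin d}

lemma tsupport_clm_comp_subset {F F' : Type*} [NormedAddCommGroup F] [NormedSpace ℝ F]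
    [NormedAddCommGroup F'] [NormedSpace ℝ F'] (L : F →L[ℝ] F')
    (w : EuclideanSpace ℝ (Fin d) → F) : tsupport (fun x => L (w x)) ⊆ tsupport w :=
  closure_mono fun x hx h => hx (by simp [h])

lemma partialDeriv_clm_comp {F F' : Type*} [NormedAddCommGroup F] [NormedSpace ℝ F]
    [NormedAddCommGroup F'] [NormedSpace ℝ F'] (L : F →L[ℝ] F')
    {w : EuclideanSpace ℝ (Fin d) → F} {x : EuclideanSpace ℝ (Fin d)}
    (hw : DifferentiableAt ℝ w x) (i : Fin d) :
    partialDeriv i (fun x => L (w x)) x = L (partialDeriv i w x) := by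
  change fderiv ℝ (⇑L ∘ w) x _ = _
  rw [(L.hasFDerivAt.comp x hw.hasFDerivAt).fderiv]
  rfl

lemma IsComplexTest.clm_comp (h : IsComplexTest U w) (L : ℂ →L[ℝ] ℝ) :
    IsTestFunction U (fun x => L (w x)) :=
  ⟨L.contDiff.comp h.contDiff,
    h.hasCompactSupport.isCompact.of_isClosed_subset (isClosed_tsupport _)
      (tsupport_clm_comp_subset L w), (tsupport_clm_comp_subset L w).trans h.tsupport_subset⟩

lemma partialDeriv_conj (hw : ContDiff ℝ ∞ w) (i : Fin d) (x : EuclideanSpace ℝ (Fin d)) :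
    partialDeriv i (fun x => (starRingEnd ℂ) (w x)) x = (starRingEnd ℂ) (partialDeriv i w x) :=
  partialDeriv_clm_comp (Complex.conjCLE : ℂ →L[ℝ] ℂ) ((hw.differentiable (by simp)) x) i

lemma IsComplexTest.conj (h : IsComplexTest U w) :
    IsComplexTest U (fun x => (starRingEnd ℂ) (w x)) :=
  ⟨(Complex.conjCLE : ℂ →L[ℝ] ℂ).contDiff.comp h.contDiff,
    h.hasCompactSupport.isCompact.of_isClosed_subset (isClosed_tsupport _)
      (tsupport_clm_comp_subset (Complex.conjCLE : ℂ →L[ℝ] ℂ) w),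
    (tsupport_clm_comp_subset (Complex.conjCLE : ℂ →L[ℝ] ℂ) w).trans h.tsupport_subset⟩

lemma IsComplexTest.partialDeriv_eq_re_add_im (h : IsComplexTest U w) (i : Fin d)
    (x : EuclideanSpace ℝ (Fin d)) : partialDeriv i w x =
      ((partialDeriv i (fun x => Complex.reCLM (w x)) x : ℝ) : ℂ) +
      Complex.I * ((partialDeriv i (fun x => Complex.imCLM (w x)) x : ℝ) : ℂ) := by
  have hd := (h.contDiff.differentiable (by simp)) x
  rw [partialDeriv_clm_comp _ hd, partialDeriv_clm_comp _ hd, mul_comm]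
  exact (Complex.re_add_im _).symm

/-- Integration by parts against complex test functions. -/
lemma HasWeakPartial.setIntegral_mul (hU : IsOpen U) (hf : HasWeakPartial U i f f')
    (hw : IsComplexTest U w) :
    ∫ x in U, partialDeriv i w x * f x = -∫ x in U, w x * f' x := by
  have hI : ∀ {φ : EuclideanSpace ℝ (Fin d) → ℝ} {g : EuclideanSpace ℝ (Fin d) → ℂ},
      IsTestFunction U φ → LocallyIntegrableOn g U →
      Integrable (fun x => φ x • g x) (volume.restrict U) := fun hφ hg =>
    (hφ.integrable_smul hU hg).integrableOn
  have hre := hw.clm_comp Complex.reCLM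
  have him := hw.clm_comp Complex.imCLM
  have h1 : ∀ x, partialDeriv i w x * f x =
      partialDeriv i (fun x => Complex.reCLM (w x)) x • f x +
      Complex.I * (partialDeriv i (fun x => Complex.imCLM (w x)) x • f x) := by
    intro x
    rw [hw.partialDeriv_eq_re_add_im i x, Complex.real_smul, Complex.real_smul]
    ring
  have h2 : ∀ x, w x * f' x = Complex.reCLM (w x) • f' x +
      Complex.I * (Complex.imCLM (w x) • f' x) := by
    intro x
    conv_lhs => rw [← Complex.re_add_im (w x)]
    rw [Complex.real_smul, Complex.real_smul]
    simp only [Complex.reCLM_apply, Complex.imCLM_apply]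
    ring
  simp_rw [h1, h2]
  rw [integral_add (hI (isTestFunction_partialDeriv hre i) hf.1)
      ((hI (isTestFunction_partialDeriv him i) hf.1).const_mul _),
    integral_add (hI hre hf.2.1) ((hI him hf.2.1).const_mul _), integral_const_mul,
    integral_const_mul, hf.2.2 _ hre, hf.2.2 _ him]
  ring

lemma IsComplexTest.memLp (h : IsComplexTest U w) (μ : Measure (EuclideanSpace ℝ (Fin d)))
    [IsFiniteMeasure μ] (p : ENNReal) : MemLp w p μ := by
  obtain ⟨C, hC⟩ := h.contDiff.continuous.bounded_above_of_compact_support h.hasCompactSupport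
  exact MemLp.of_bound h.contDiff.continuous.aestronglyMeasurable C (Eventually.of_forall hC)

lemma IsComplexTest.partialDeriv' (h : IsComplexTest U w) (i : Fin d) :
    IsComplexTest U (SemiclassicalDirichlet.partialDeriv i w) :=
  ⟨contDiff_partialDeriv h.contDiff i,
    h.hasCompactSupport.isCompact.of_isClosed_subset (isClosed_tsupport _)
      (tsupport_partialDeriv_subset w i),
    (tsupport_partialDeriv_subset w i).trans h.tsupport_subset⟩

lemma IsTestFunction.ofReal {φ : EuclideanSpace ℝ (Fin d) → ℝ} (hφ : IsTestFunction U φ) :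
    IsComplexTest U (fun x => (φ x : ℂ)) :=
  ⟨Complex.ofRealCLM.contDiff.comp hφ.contDiff,
    hφ.hasCompactSupport.isCompact.of_isClosed_subset (isClosed_tsupport _)
      (tsupport_clm_comp_subset Complex.ofRealCLM φ),
    (tsupport_clm_comp_subset Complex.ofRealCLM φ).trans hφ.tsupport_subset⟩

lemma partialDeriv_ofReal {φ : EuclideanSpace ℝ (Fin d) → ℝ} {x : EuclideanSpace ℝ (Fin d)}
    (hφ : DifferentiableAt ℝ φ x) (i : Fin d) :
    partialDeriv i (fun x => (φ x : ℂ)) x = ((partialDeriv i φ x : ℝ) : ℂ) :=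
  partialDeriv_clm_comp Complex.ofRealCLM hφ i

lemma memLp_ofReal {α : Type*} {m0 : MeasurableSpace α} {μ : Measure α} {p : ENNReal} {b : α → ℝ}
    (hb : MemLp b p μ) : MemLp (fun x => (b x : ℂ)) p μ :=
  hb.ofReal

end ComplexTest

section WeakForm

variable {d : ℕ} {Ω : Set (EuclideanSpace ℝ (Fin d))} {c n : EuclideanSpace ℝ (Fin d) → ℝ}
  {h : ℝ} {z : ℂ} {u v : EuclideanSpace ℝ (Fin d) → ℂ}
  {G : Fin d → EuclideanSpace ℝ (Fin d) → ℂ}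

/-- The weak form of the equation, with complex test functions and a prescribed weak gradient. -/
lemma SolvesEquation.weak_form (hs : SolvesEquation Ω c n h z u v) (hΩ : IsOpen Ω)
    (hb : Bornology.IsBounded Ω) (hc : MemLp c ⊤ (volume.restrict Ω))
    (hn : MemLp n ⊤ (volume.restrict Ω)) (hu : MemLp u 2 (volume.restrict Ω))
    (hv : MemLp v 2 (volume.restrict Ω)) (hG : HasWeakGradient Ω u G)
    (hG2 : ∀ i, MemLp (G i) 2 (volume.restrict Ω)) {w : EuclideanSpace ℝ (Fin d) → ℂ}
    (hw : IsComplexTest Ω w) :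
    -((h : ℂ) ^ 2 * ∑ i, ∫ x in Ω, (c x : ℂ) * G i x * partialDeriv i w x) +
      z * ∫ x in Ω, (n x : ℂ) * u x * w x = h * ∫ x in Ω, v x * w x := by
  have := isFiniteMeasure_restrict hb
  obtain ⟨G', hG', heq⟩ := hs
  have hGG : ∀ i, G' i =ᵐ[volume.restrict Ω] G i := fun i => (hG' i).ae_unique hΩ (hG i)
  have hcG : ∀ i, MemLp (fun x => (c x : ℂ) * G i x) 2 (volume.restrict Ω) := fun i =>
    (hG2 i).mul' (memLp_ofReal hc)
  have hnu : MemLp (fun x => (n x : ℂ) * u x) 2 (volume.restrict Ω) := hu.mul' (memLp_ofReal hn)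
  have hreal : ∀ φ : EuclideanSpace ℝ (Fin d) → ℝ, IsTestFunction Ω φ →
      -((h : ℂ) ^ 2 * ∑ i, ∫ x in Ω, (c x : ℂ) * G i x * ((partialDeriv i φ x : ℝ) : ℂ)) +
      z * ∫ x in Ω, (n x : ℂ) * u x * (φ x : ℂ) = h * ∫ x in Ω, v x * (φ x : ℂ) := by
    intro φ hφ
    have hφ2 := hφ.ofReal.memLp (volume.restrict Ω) 2
    have hdφ2 := fun i => (isTestFunction_partialDeriv hφ i).ofReal.memLp (volume.restrict Ω) 2
    have hi1 : ∀ i, Integrable (fun x => (c x : ℂ) * G i x * ((partialDeriv i φ x : ℝ) : ℂ))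
      (volume.restrict Ω) := fun i => integrable_mul_of_memLp (hcG i) (hdφ2 i)
    have hi2 := integrable_mul_of_memLp hnu hφ2
    have h1 := heq φ hφ
    have h2 : ∫ x in Ω, (-((h : ℂ) ^ 2 * (c x : ℂ) *
        ∑ i, ((partialDeriv i φ x : ℝ) : ℂ) * G' i x) + z * (n x : ℂ) * u x * (φ x : ℂ)) =
        ∫ x in Ω, (-((h : ℂ) ^ 2 * ∑ i, (c x : ℂ) * G i x * ((partialDeriv i φ x : ℝ) : ℂ)) +
          z * ((n x : ℂ) * u x * (φ x : ℂ))) := by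
      refine integral_congr_ae ?_
      filter_upwards [eventually_countable_forall.2 hGG] with x hx
      simp_rw [hx, mul_assoc, Finset.mul_sum]
      congr 2
      refine Finset.sum_congr rfl fun i _ => ?_
      ring
    have hi0 : Integrable (fun x => -((h : ℂ) ^ 2 *
        ∑ i, (c x : ℂ) * G i x * ((partialDeriv i φ x : ℝ) : ℂ))) (volume.restrict Ω) :=
      ((integrable_finsetSum _ fun i _ => hi1 i).const_mul _).neg
    rw [h2, integral_add hi0 (hi2.const_mul _), integral_neg, integral_const_mul, integral_const_mul,
      integral_finsetSum _ fun i _ => hi1 i] at h1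
    rw [h1, ← integral_const_mul]
    simp_rw [mul_assoc]
  have hre := hw.clm_comp Complex.reCLM
  have him := hw.clm_comp Complex.imCLM
  have hsplit : ∀ {g : EuclideanSpace ℝ (Fin d) → ℂ}, MemLp g 2 (volume.restrict Ω) →
      ∀ {r : EuclideanSpace ℝ (Fin d) → ℂ} {φ ψ : EuclideanSpace ℝ (Fin d) → ℝ},
      IsTestFunction Ω φ → IsTestFunction Ω ψ → (∀ x, r x = (φ x : ℂ) + Complex.I * (ψ x : ℂ)) →
      ∫ x in Ω, g x * r x = (∫ x in Ω, g x * (φ x : ℂ)) +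
        Complex.I * ∫ x in Ω, g x * (ψ x : ℂ) := by
    intro g hg r φ ψ hφ hψ hr
    rw [← integral_const_mul, ← integral_add
      (integrable_mul_of_memLp hg (hφ.ofReal.memLp _ 2))
      ((integrable_mul_of_memLp hg (hψ.ofReal.memLp _ 2)).const_mul _)]
    congr 1 with x
    rw [hr x]
    ring
  have hwx : ∀ x, w x = ((Complex.reCLM (w x) : ℝ) : ℂ) +
      Complex.I * ((Complex.imCLM (w x) : ℝ) : ℂ) := fun x => by
    rw [mul_comm]
    exact (Complex.re_add_im _).symm
  have h1 : ∀ i, ∫ x in Ω, (c x : ℂ) * G i x * partialDeriv i w x = _ := fun i =>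
    hsplit (hcG i) (isTestFunction_partialDeriv hre i) (isTestFunction_partialDeriv him i)
      (hw.partialDeriv_eq_re_add_im i)
  rw [hsplit hnu hre him hwx, hsplit hv hre him hwx]
  simp_rw [h1]
  rw [Finset.sum_add_distrib, ← Finset.mul_sum]
  linear_combination hreal _ hre + Complex.I * hreal _ him

lemma exists_bound_of_memLp_top {α : Type*} {m0 : MeasurableSpace α} {μ : Measure α} {b : α → ℝ}
    (hb : MemLp b ⊤ μ) : ∃ M : ℝ, 0 ≤ M ∧ ∀ᵐ x ∂μ, |b x| ≤ M := by
  have h1 : eLpNormEssSup b μ ≠ ⊤ := by simpa using hb.2.ne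
  refine ⟨(eLpNormEssSup b μ).toReal, ENNReal.toReal_nonneg, ?_⟩
  filter_upwards [enorm_ae_le_eLpNormEssSup b μ] with x hx
  have := ENNReal.toReal_mono h1 hx
  simpa using this

lemma theta_le_one (hz : ‖z‖ = 1) : theta z ≤ 1 := by
  unfold theta
  split_ifs
  · rw [← hz]; exact Complex.abs_im_le_norm z
  · exact le_rfl

lemma abs_im_le_theta (hz : ‖z‖ = 1) : |z.im| ≤ theta z := by
  unfold theta
  split_ifs
  · exact le_rfl
  · rw [← hz]; exact Complex.abs_im_le_norm z

/-- The algebra behind the energy estimate: `a` and `b` stand for the weighted squares of `‖∇u‖`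
and `‖u‖`, and `p` for the pairing of `v` with `u`. -/
lemma energy_algebra {a b X Y V b₀ M θ : ℝ} {p : ℂ} (hb₀ : 0 < b₀) (hM : 0 ≤ M) (hh : 0 < h)
    (hz : ‖z‖ = 1) (hθ : θ = theta z) (hθ0 : 0 < θ) (hX : 0 ≤ X) (hV : 0 ≤ V)
    (ha : b₀ * Y ^ 2 ≤ a) (hb1 : b₀ * X ^ 2 ≤ b) (hb2 : b ≤ M * X ^ 2) (hp : ‖p‖ ≤ V * X)
    (heq : -((h : ℂ) ^ 2 * (a : ℂ)) + z * (b : ℂ) = h * p) :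
    X ≤ 2 / b₀ * (h / θ) * V ∧ Y ^ 2 ≤ (4 * M / b₀ ^ 3 + 2 / b₀ ^ 2) * (V / θ) ^ 2 := by
  have hb0 : 0 ≤ b := le_trans (by positivity) hb1
  have ha0 : 0 ≤ a := le_trans (by positivity) ha
  have hre : -(h ^ 2 * a) + z.re * b = h * p.re := by
    have := congrArg Complex.re heq
    simpa [← Complex.ofReal_pow] using this
  have him : z.im * b = h * p.im := by
    have := congrArg Complex.im heq
    simpa [← Complex.ofReal_pow] using this
  have hpre : |p.re| ≤ V * X := (Complex.abs_re_le_norm p).trans hp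
  have hpim : |p.im| ≤ V * X := (Complex.abs_im_le_norm p).trans hp
  have himb : |z.im| * b ≤ h * (V * X) := by
    rw [← abs_of_nonneg hb0, ← abs_mul, him, abs_mul, abs_of_pos hh]
    gcongr
  have hθ1 : θ ≤ 1 := hθ ▸ theta_le_one hz
  have hkey : θ * b ≤ 2 * (h * (V * X)) := by
    have h0 : 0 ≤ h * (V * X) := by positivity
    rcases le_or_gt 0 z.re with hz0 | hz0
    · have : θ = |z.im| := by rw [hθ, theta, if_pos hz0]
      rw [this]; linarith
    · have h1 : θ = 1 := by rw [hθ, theta, if_neg (not_le.2 hz0)]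
      have h2 : |z.re| * b ≤ h * (V * X) := by
        rw [abs_of_neg hz0]
        have := (abs_le.1 hpre).1
        nlinarith [mul_nonneg (sq_nonneg h) ha0]
      have h3 : 1 ≤ |z.re| + |z.im| := by
        rw [← hz]; exact Complex.norm_le_abs_re_add_abs_im z
      rw [h1]
      nlinarith
  have hX1 : X ≤ 2 / b₀ * (h / θ) * V := by
    rcases hX.eq_or_lt with hX0 | hX0
    · rw [← hX0]; positivity
    · have h1 : θ * (b₀ * X ^ 2) ≤ 2 * (h * (V * X)) :=
        (mul_le_mul_of_nonneg_left hb1 hθ0.le).trans hkey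
      have h2 : θ * b₀ * X ≤ 2 * h * V := by
        refine le_of_mul_le_mul_right ?_ hX0
        nlinarith
      rw [show 2 / b₀ * (h / θ) * V = (2 * h * V) / (θ * b₀) by field_simp, le_div_iff₀ (by positivity)]
      linarith
  refine ⟨hX1, ?_⟩
  have hzre : z.re * b ≤ b := by
    have := (Complex.abs_re_le_norm z).trans hz.le
    nlinarith [(abs_le.1 this).2]
  have h1 : h ^ 2 * (b₀ * Y ^ 2) ≤ M * X ^ 2 + h * (V * X) := by
    have h2 : h ^ 2 * (b₀ * Y ^ 2) ≤ h ^ 2 * a := by gcongr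
    have h3 := (abs_le.1 hpre).1
    nlinarith
  have h2 : X ^ 2 ≤ (2 / b₀ * (h / θ) * V) ^ 2 := by gcongr
  have h3 : V * X ≤ V * (2 / b₀ * (h / θ) * V) := by gcongr
  have h4 : M * X ^ 2 + h * (V * X) ≤
      h ^ 2 * (b₀ * ((4 * M / b₀ ^ 3 + 2 / b₀ ^ 2) * (V / θ) ^ 2)) := by
    have h5 : h * (V * (2 / b₀ * (h / θ) * V)) ≤ h ^ 2 * (2 / b₀ * (V / θ) ^ 2) := by
      rw [show h * (V * (2 / b₀ * (h / θ) * V)) = h ^ 2 * (2 / b₀ * (V ^ 2 / θ ^ 2)) * θ by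
        field_simp]
      rw [div_pow]
      exact mul_le_of_le_one_right (by positivity) hθ1
    calc M * X ^ 2 + h * (V * X)
        ≤ M * (2 / b₀ * (h / θ) * V) ^ 2 + h * (V * (2 / b₀ * (h / θ) * V)) := by gcongr
      _ ≤ M * (2 / b₀ * (h / θ) * V) ^ 2 + h ^ 2 * (2 / b₀ * (V / θ) ^ 2) := by gcongr
      _ = _ := by field_simp; ring
  have h5 := h1.trans h4
  have h6 : 0 < h ^ 2 * b₀ := by positivity
  rw [← mul_assoc, ← mul_assoc] at h5
  exact le_of_mul_le_mul_left h5 h6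

/-- The energy estimate. Testing the equation with the conjugate of `u`, the imaginary part (or the
real part, where `Re z < 0`) bounds `u` by `h / θ`, and then the real part bounds the gradient by
`1 / θ`, relative to `v`. -/
lemma energy_estimate (hΩ : IsOpen Ω)
    (hb : Bornology.IsBounded Ω) (hc : MemLp c ⊤ (volume.restrict Ω))
    (hn : MemLp n ⊤ (volume.restrict Ω)) {b₀ M : ℝ} (hb₀ : 0 < b₀)
    (hcb : ∀ᵐ x ∂(volume.restrict Ω), b₀ ≤ c x) (hnb : ∀ᵐ x ∂(volume.restrict Ω), b₀ ≤ n x)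
    (hM : 0 ≤ M) (hnM : ∀ᵐ x ∂(volume.restrict Ω), |n x| ≤ M)
    (hs : SolvesEquation Ω c n h z u v) (hh : 0 < h) (hz : ‖z‖ = 1) (hθ : h ≤ theta z)
    (hu : MemLp u 2 (volume.restrict Ω))
    (hv : MemLp v 2 (volume.restrict Ω)) (hG : HasWeakGradient Ω u G)
    (hG2 : ∀ i, MemLp (G i) 2 (volume.restrict Ω)) {w : ℕ → EuclideanSpace ℝ (Fin d) → ℂ}
    (hw : ∀ k, IsComplexTest Ω (w k)) (hwu : L2Tendsto (volume.restrict Ω) w u)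
    (hwG : ∀ i, L2Tendsto (volume.restrict Ω) (fun k => partialDeriv i (w k)) (G i)) :
    √(∫ x in Ω, ‖u x‖ ^ 2) ≤ 2 / b₀ * (h / theta z) * √(∫ x in Ω, ‖v x‖ ^ 2) ∧
    ∑ i, ∫ x in Ω, ‖G i x‖ ^ 2 ≤ (4 * M / b₀ ^ 3 + 2 / b₀ ^ 2) *
      (√(∫ x in Ω, ‖v x‖ ^ 2) / theta z) ^ 2 := by
  have hcG : ∀ i, MemLp (fun x => (c x : ℂ) * G i x) 2 (volume.restrict Ω) := fun i =>
    (hG2 i).mul' (memLp_ofReal hc)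
  have hnu : MemLp (fun x => (n x : ℂ) * u x) 2 (volume.restrict Ω) := hu.mul' (memLp_ofReal hn)
  -- testing the equation with `conj (w k)` and passing to the limit
  have hlim : -((h : ℂ) ^ 2 * ∑ i, ∫ x in Ω, (c x : ℂ) * G i x * (starRingEnd ℂ) (G i x)) +
      z * ∫ x in Ω, (n x : ℂ) * u x * (starRingEnd ℂ) (u x) =
      h * ∫ x in Ω, v x * (starRingEnd ℂ) (u x) := by
    have h1 := ((tendsto_finsetSum Finset.univ fun i _ =>
      (L2Tendsto.const (hcG i)).integral_mul (hwG i).conj).const_mul ((h : ℂ) ^ 2)).neg.add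
      (((L2Tendsto.const hnu).integral_mul hwu.conj).const_mul z)
    have h2 := ((L2Tendsto.const hv).integral_mul hwu.conj).const_mul (h : ℂ)
    refine tendsto_nhds_unique h1 (h2.congr fun k => ?_)
    have h3 := hs.weak_form hΩ hb hc hn hu hv hG hG2 (hw k).conj
    simp_rw [partialDeriv_conj (hw k).contDiff] at h3
    exact h3.symm
  have hsq : ∀ (b : EuclideanSpace ℝ (Fin d) → ℝ) (f : EuclideanSpace ℝ (Fin d) → ℂ),
      ∫ x in Ω, (b x : ℂ) * f x * (starRingEnd ℂ) (f x) =
      ((∫ x in Ω, b x * ‖f x‖ ^ 2 : ℝ) : ℂ) := by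
    intro b f
    rw [← integral_complex_ofReal]
    congr 1 with x
    rw [mul_assoc, Complex.mul_conj, Complex.normSq_eq_norm_sq]
    push_cast
    ring
  simp_rw [hsq] at hlim
  rw [← Complex.ofReal_sum] at hlim
  have hnsq : ∀ {f : EuclideanSpace ℝ (Fin d) → ℂ}, MemLp f 2 (volume.restrict Ω) →
      Integrable (fun x => ‖f x‖ ^ 2) (volume.restrict Ω) := fun hf =>
    hf.integrable_norm_pow (by norm_num)
  have hbsq : ∀ {b : EuclideanSpace ℝ (Fin d) → ℝ} {f : EuclideanSpace ℝ (Fin d) → ℂ},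
      MemLp b ⊤ (volume.restrict Ω) → MemLp f 2 (volume.restrict Ω) →
      Integrable (fun x => b x * ‖f x‖ ^ 2) (volume.restrict Ω) := fun hb hf =>
    memLp_one_iff_integrable.1 ((memLp_one_iff_integrable.2 (hnsq hf)).mul' hb)
  have hlow : ∀ {b : EuclideanSpace ℝ (Fin d) → ℝ} {f : EuclideanSpace ℝ (Fin d) → ℂ},
      MemLp b ⊤ (volume.restrict Ω) → (∀ᵐ x ∂(volume.restrict Ω), b₀ ≤ b x) →
      MemLp f 2 (volume.restrict Ω) →
      b₀ * ∫ x in Ω, ‖f x‖ ^ 2 ≤ ∫ x in Ω, b x * ‖f x‖ ^ 2 := by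
    intro b f hbt hbb hf
    rw [← integral_const_mul]
    refine integral_mono_ae ((hnsq hf).const_mul _) (hbsq hbt hf) ?_
    filter_upwards [hbb] with x hx
    gcongr
  have hθ0 : 0 < theta z := hh.trans_le hθ
  have hS0 : 0 ≤ ∑ i, ∫ x in Ω, ‖G i x‖ ^ 2 :=
    Finset.sum_nonneg fun i _ => integral_nonneg fun x => by positivity
  have key := energy_algebra (X := √(∫ x in Ω, ‖u x‖ ^ 2)) (Y := √(∑ i, ∫ x in Ω, ‖G i x‖ ^ 2))
    (V := √(∫ x in Ω, ‖v x‖ ^ 2)) hb₀ hM hh hz rfl hθ0 (Real.sqrt_nonneg _) (Real.sqrt_nonneg _)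
    ?_ ?_ ?_ ?_ hlim
  · rwa [Real.sq_sqrt hS0] at key
  · rw [Real.sq_sqrt hS0, Finset.mul_sum]
    exact Finset.sum_le_sum fun i _ => hlow hc hcb (hG2 i)
  · rw [Real.sq_sqrt (integral_nonneg fun x => by positivity)]
    exact hlow hn hnb hu
  · rw [Real.sq_sqrt (integral_nonneg fun x => by positivity), ← integral_const_mul]
    refine integral_mono_ae (hbsq hn hu) ((hnsq hu).const_mul _) ?_
    filter_upwards [hnM] with x hx
    gcongr
    exact (abs_le.1 hx).2
  · have h1 := norm_integral_mul_le hv hu.star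
    simpa using h1

end WeakForm

/-! ### The equation and the coefficients near the boundary -/

section Collar

variable {d : ℕ} {Ω : Set (EuclideanSpace ℝ (Fin d))} {δ : ℝ}

lemma isOpen_collar (hΩ : IsOpen Ω) (δ : ℝ) : IsOpen (collar Ω δ) :=
  hΩ.inter (isOpen_lt (Metric.continuous_infDist_pt _) continuous_const)

lemma collar_subset : collar Ω δ ⊆ Ω := fun _ hx => hx.1

lemma BoundaryAtlas.ball_inter_subset_collar {ι : Type} [Fintype ι] (A : BoundaryAtlas Ω δ ι)
    (j : ι) : Metric.ball (A.x j) (A.r j) ∩ Ω ⊆ collar Ω δ := fun _ hx =>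
  ⟨hx.2, (Metric.infDist_le_dist_of_mem (A.center_mem j)).trans_lt
    ((Metric.mem_ball.1 hx.1).trans_le (A.radius_le j))⟩

end Collar

section StrongForm

variable {d : ℕ} {S Ω : Set (EuclideanSpace ℝ (Fin d))} {i : Fin d}

lemma HasWeakPartial.ofReal {c c' : EuclideanSpace ℝ (Fin d) → ℝ} (h : HasWeakPartial S i c c') :
    HasWeakPartial S i (fun x => (c x : ℂ)) (fun x => (c' x : ℂ)) := by
  have hloc : ∀ {g : EuclideanSpace ℝ (Fin d) → ℝ}, LocallyIntegrableOn g S →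
      LocallyIntegrableOn (fun x => (g x : ℂ)) S := fun hg x hx => by
    obtain ⟨t, ht, hi⟩ := hg x hx
    exact ⟨t, ht, hi.ofReal⟩
  refine ⟨hloc h.1, hloc h.2.1, fun φ hφ => ?_⟩
  have h1 : ∀ g k : EuclideanSpace ℝ (Fin d) → ℝ, ∫ x in S, g x • (k x : ℂ) =
      ((∫ x in S, g x • k x : ℝ) : ℂ) := fun g k => by
    rw [← integral_complex_ofReal]
    simp
  rw [h1, h1, h.2.2 φ hφ, Complex.ofReal_neg]

lemma IsTestFunction.setIntegral_mul_eq {φ : EuclideanSpace ℝ (Fin d) → ℝ}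
    (hφ : IsTestFunction S φ) (hS : S ⊆ Ω) (f : EuclideanSpace ℝ (Fin d) → ℂ) :
    ∫ x in Ω, f x * (φ x : ℂ) = ∫ x in S, f x * (φ x : ℂ) := by
  have h : ∀ x, f x * (φ x : ℂ) = φ x • f x := fun x => by rw [Complex.real_smul, mul_comm]
  simp_rw [h]
  rw [hφ.setIntegral_eq, (hφ.mono hS).setIntegral_eq]

lemma IsTestFunction.smul_isComplexTest {φ : EuclideanSpace ℝ (Fin d) → ℝ}
    (hφ : IsTestFunction S φ) {g : EuclideanSpace ℝ (Fin d) → ℂ} (hg : ContDiff ℝ ∞ g) :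
    IsComplexTest S (fun x => φ x • g x) :=
  ⟨hφ.contDiff.smul hg, hφ.hasCompactSupport.smul_right,
    (closure_mono (Function.support_smul_subset_left φ g)).trans hφ.tsupport_subset⟩

/-- The product rule, tested against `φ`, for a bounded function with a bounded weak derivative and
the limit of smooth functions. -/
lemma HasWeakPartial.setIntegral_mul_limit (hS : IsOpen S)
    {c c' : EuclideanSpace ℝ (Fin d) → ℝ} (h : HasWeakPartial S i c c')
    (hc : MemLp c ⊤ (volume.restrict S)) (hc' : MemLp c' ⊤ (volume.restrict S))
    {g : ℕ → EuclideanSpace ℝ (Fin d) → ℂ} {G H : EuclideanSpace ℝ (Fin d) → ℂ}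
    (hg : ∀ k, ContDiff ℝ ∞ (g k)) (hG : L2Tendsto (volume.restrict S) g G)
    (hH : L2Tendsto (volume.restrict S) (fun k => partialDeriv i (g k)) H)
    {φ : EuclideanSpace ℝ (Fin d) → ℝ} (hφ : IsTestFunction S φ) :
    ∫ x in S, (c x : ℂ) * G x * ((partialDeriv i φ x : ℝ) : ℂ) =
      -∫ x in S, ((c x : ℂ) * H x + (c' x : ℂ) * G x) * (φ x : ℂ) := by
  have hφ' := isTestFunction_partialDeriv hφ i
  have hint : ∀ {b : EuclideanSpace ℝ (Fin d) → ℝ} {ψ : EuclideanSpace ℝ (Fin d) → ℝ},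
      MemLp b ⊤ (volume.restrict S) → IsTestFunction S ψ →
      MemLp (fun x => (b x : ℂ) * (ψ x : ℂ)) 2 (volume.restrict S) := fun {b ψ} hb hψ => by
    obtain ⟨C, hC⟩ := hψ.contDiff.continuous.bounded_above_of_compact_support hψ.hasCompactSupport
    have : MemLp (fun x => (ψ x : ℂ)) 2 (volume.restrict S) :=
      ((Complex.continuous_ofReal.comp hψ.contDiff.continuous).memLp_of_hasCompactSupport
        hψ.ofReal.hasCompactSupport).restrict S
    exact this.mul' (memLp_ofReal hb)
  have e1 : ∀ k, (∫ x in S, ((c x : ℂ) * ((partialDeriv i φ x : ℝ) : ℂ)) * g k x) =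
      -((∫ x in S, ((c x : ℂ) * (φ x : ℂ)) * partialDeriv i (g k) x) +
        ∫ x in S, ((c' x : ℂ) * (φ x : ℂ)) * g k x) := by
    intro k
    have h1 := h.ofReal.setIntegral_mul hS (hφ.smul_isComplexTest (hg k))
    have h2 : ∀ x, partialDeriv i (fun x => φ x • g k x) x * (c x : ℂ) =
        ((c x : ℂ) * ((partialDeriv i φ x : ℝ) : ℂ)) * g k x +
        ((c x : ℂ) * (φ x : ℂ)) * partialDeriv i (g k) x := fun x => by
      rw [partialDeriv_smul ((hφ.contDiff.differentiable (by simp)) x)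
        (((hg k).differentiable (by simp)) x), Complex.real_smul, Complex.real_smul]
      ring
    have h3 : ∀ x, φ x • g k x * (c' x : ℂ) = ((c' x : ℂ) * (φ x : ℂ)) * g k x := fun x => by
      rw [Complex.real_smul]; ring
    simp_rw [h2, h3] at h1
    rw [integral_add (integrable_mul_of_memLp (hint hc hφ') (hG.memLp k))
      (integrable_mul_of_memLp (hint hc hφ) (hH.memLp k))] at h1
    linear_combination h1
  have h1 := (L2Tendsto.const (hint hc hφ')).integral_mul hG
  have h2 := (((L2Tendsto.const (hint hc hφ)).integral_mul hH).add
    ((L2Tendsto.const (hint hc' hφ)).integral_mul hG)).neg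
  have h3 := tendsto_nhds_unique (h1.congr e1) h2
  rw [← integral_add (integrable_mul_of_memLp (hint hc hφ) hH.memLp_limit)
      (integrable_mul_of_memLp (hint hc' hφ) hG.memLp_limit)] at h3
  convert h3 using 3 with x
  · ring
  · ext x; ring

/-- The equation holds almost everywhere where the coefficient `c` has bounded derivatives. -/
lemma SolvesEquation.ae_eq (hΩ : IsOpen Ω) (hb : Bornology.IsBounded Ω) (hS : IsOpen S)
    (hSΩ : S ⊆ Ω) {c n : EuclideanSpace ℝ (Fin d) → ℝ} {h : ℝ} {z : ℂ}
    {u v : EuclideanSpace ℝ (Fin d) → ℂ} (hs : SolvesEquation Ω c n h z u v)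
    (hc : MemLp c ⊤ (volume.restrict Ω)) (hn : MemLp n ⊤ (volume.restrict Ω))
    (hu : MemLp u 2 (volume.restrict Ω)) (hv : MemLp v 2 (volume.restrict Ω))
    {G : Fin d → EuclideanSpace ℝ (Fin d) → ℂ}
    {H : Fin d → Fin d → EuclideanSpace ℝ (Fin d) → ℂ} (hG : HasWeakGradient Ω u G)
    {φ : ℕ → EuclideanSpace ℝ (Fin d) → ℂ} (hφ : ∀ k, ContDiff ℝ ∞ (φ k))
    (hφG : ∀ i, L2Tendsto (volume.restrict Ω) (fun k => partialDeriv i (φ k)) (G i))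
    (hφH : ∀ i l, L2Tendsto (volume.restrict Ω)
      (fun k => partialDeriv l (partialDeriv i (φ k))) (H i l))
    {c' : Fin d → EuclideanSpace ℝ (Fin d) → ℝ} (hc' : ∀ i, HasWeakPartial S i c (c' i))
    (hc't : ∀ i, MemLp (c' i) ⊤ (volume.restrict S)) :
    ∀ᵐ x ∂(volume.restrict S), (h : ℂ) ^ 2 * (∑ i, ((c x : ℂ) * H i i x + (c' i x : ℂ) * G i x)) +
      z * ((n x : ℂ) * u x) = h * v x := by
  have := isFiniteMeasure_restrict (hb.subset hSΩ)
  have hle : (volume : Measure (EuclideanSpace ℝ (Fin d))).restrict S ≤ volume.restrict Ω :=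
    Measure.restrict_mono hSΩ le_rfl
  have hcS := hc.mono_measure hle
  have hfi : ∀ i, MemLp (fun x => (c x : ℂ) * H i i x + (c' i x : ℂ) * G i x) 2
      (volume.restrict S) := fun i =>
    (((hφH i i).memLp_limit.mono_measure hle).mul' (memLp_ofReal hcS)).add
      (((hφG i).memLp_limit.mono_measure hle).mul' (memLp_ofReal (hc't i)))
  have hnu : MemLp (fun x => (n x : ℂ) * u x) 2 (volume.restrict S) :=
    (hu.mul' (memLp_ofReal hn)).mono_measure hle
  have hvS := hv.mono_measure hle
  have hf : MemLp (fun x => (h : ℂ) ^ 2 *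
      (∑ i, ((c x : ℂ) * H i i x + (c' i x : ℂ) * G i x)) + z * ((n x : ℂ) * u x) - h * v x) 2
      (volume.restrict S) :=
    (((memLp_finsetSum _ fun i _ => hfi i).const_mul _).add (hnu.const_mul z)).sub
      (hvS.const_mul _)
  have hloc : LocallyIntegrableOn (fun x => (h : ℂ) ^ 2 *
      (∑ i, ((c x : ℂ) * H i i x + (c' i x : ℂ) * G i x)) + z * ((n x : ℂ) * u x) - h * v x) S :=
    IntegrableOn.locallyIntegrableOn (hf.integrable (by norm_num))
  have h0 := hS.ae_eq_zero_of_integral_contDiff_smul_eq_zero hloc fun ψ hψ hψs hψS => by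
    have ht : IsTestFunction S ψ := ⟨hψ, hψs, hψS⟩
    have h1 := hs.weak_form hΩ hb hc hn hu hv hG (fun i => (hφG i).memLp_limit)
      (ht.mono hSΩ).ofReal
    simp_rw [fun i x => partialDeriv_ofReal ((hψ.differentiable (by simp)) x) i] at h1
    rw [ht.setIntegral_mul_eq hSΩ, ht.setIntegral_mul_eq hSΩ] at h1
    have h2 : ∀ i, ∫ x in Ω, (c x : ℂ) * G i x * ((partialDeriv i ψ x : ℝ) : ℂ) =
        -∫ x in S, ((c x : ℂ) * H i i x + (c' i x : ℂ) * G i x) * (ψ x : ℂ) := fun i => by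
      rw [(isTestFunction_partialDeriv ht i).setIntegral_mul_eq hSΩ]
      exact (hc' i).setIntegral_mul_limit hS hcS (hc't i)
        (fun k => contDiff_partialDeriv (hφ k) i) ((hφG i).mono_measure hle)
        ((hφH i i).mono_measure hle) ht
    simp_rw [h2] at h1
    rw [← ht.setIntegral_eq]
    have hψ2 := ht.ofReal.memLp (volume.restrict S) 2
    have hi1 : ∀ i, Integrable (fun x => ((c x : ℂ) * H i i x + (c' i x : ℂ) * G i x) * (ψ x : ℂ))
        (volume.restrict S) := fun i => integrable_mul_of_memLp (hfi i) hψ2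
    have hi1s : Integrable (fun x => (h : ℂ) ^ 2 *
        ∑ i, ((c x : ℂ) * H i i x + (c' i x : ℂ) * G i x) * (ψ x : ℂ)) (volume.restrict S) :=
      (integrable_finsetSum _ fun i _ => hi1 i).const_mul _
    have hi2 := (integrable_mul_of_memLp hnu hψ2).const_mul z
    have hi3 := (integrable_mul_of_memLp hvS hψ2).const_mul (h : ℂ)
    have h3 : ∀ x, ψ x • ((h : ℂ) ^ 2 *
        (∑ i, ((c x : ℂ) * H i i x + (c' i x : ℂ) * G i x)) + z * ((n x : ℂ) * u x) - h * v x) =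
        (h : ℂ) ^ 2 * (∑ i, ((c x : ℂ) * H i i x + (c' i x : ℂ) * G i x) * (ψ x : ℂ)) +
        z * ((n x : ℂ) * u x * (ψ x : ℂ)) - h * (v x * (ψ x : ℂ)) := fun x => by
      rw [Complex.real_smul, ← Finset.sum_mul]
      ring
    have hi12 : Integrable (fun x => (h : ℂ) ^ 2 *
        ∑ i, ((c x : ℂ) * H i i x + (c' i x : ℂ) * G i x) * (ψ x : ℂ) +
        z * ((n x : ℂ) * u x * (ψ x : ℂ))) (volume.restrict S) := hi1s.add hi2
    simp_rw [h3]
    rw [integral_sub hi12 hi3, integral_add hi1s hi2, integral_const_mul,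
      integral_const_mul, integral_const_mul, integral_finsetSum _ fun i _ => hi1 i, ← h1,
      Finset.sum_neg_distrib]
    ring
  filter_upwards [(ae_restrict_iff' hS.measurableSet).2 h0] with x hx
  exact sub_eq_zero.1 hx

end StrongForm

section Quotient

variable {d : ℕ} {S : Set (EuclideanSpace ℝ (Fin d))} {i : Fin d}
  {ρ : EuclideanSpace ℝ (Fin d) → ℝ} {a : EuclideanSpace ℝ (Fin d)} {ε : ℝ}

lemma HasWeakPartial.sub_const (hS : IsOpen S) {c c' : EuclideanSpace ℝ (Fin d) → ℝ}
    (h : HasWeakPartial S i c c') (b : ℝ) : HasWeakPartial S i (fun x => c x - b) c' := by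
  have hloc : LocallyIntegrableOn (fun _ => b) S := (continuous_const).locallyIntegrable.locallyIntegrableOn S
  refine ⟨h.1.sub hloc, h.2.1, fun φ hφ => ?_⟩
  have h0 : ∫ x in S, partialDeriv i φ x • b = 0 := by
    have h1 := hφ.setIntegral_partialDeriv_smul hS.measurableSet (contDiff_const (c := b)) i
    rw [← h1]
    congr 1 with x
    rw [partialDeriv_smul ((hφ.contDiff.differentiable (by simp)) x)
      (differentiableAt_const b)]
    simp [partialDeriv]
  rw [← h.2.2 φ hφ]
  simp_rw [smul_sub]
  have hφ' := isTestFunction_partialDeriv hφ i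
  rw [integral_sub (hφ'.integrable_smul hS h.1).integrableOn
    (hφ'.integrable_smul hS hloc).integrableOn, h0, sub_zero]

/-- Averages of functions with values in `[0, ∞)` have nonnegative real part. -/
lemma IsMollifier.mollify_re_nonneg (h : IsMollifier ρ a ε)
    {f : EuclideanSpace ℝ (Fin d) → ℂ} (hf : LocallyIntegrable f) (h0 : ∀ᵐ x, 0 ≤ (f x).re)
    (x : EuclideanSpace ℝ (Fin d)) : 0 ≤ (mollify ρ f x).re := by
  have hi : Integrable (fun w => ρ (x - w) • f w) :=
    (h.isTestFunction (Set.subset_univ _)).integrable_smul isOpen_univ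
      (hf.locallyIntegrableOn _)
  rw [mollify_apply_swap, show (∫ w, ρ (x - w) • f w).re = ∫ w, (ρ (x - w) • f w).re from
    (integral_re hi).symm]
  refine integral_nonneg_of_ae ?_
  filter_upwards [h0] with w hw
  simpa using mul_nonneg (h.nonneg _) hw

lemma IsMollifier.norm_mollify_le (h : IsMollifier ρ a ε)
    {f : EuclideanSpace ℝ (Fin d) → ℂ} {L : ℝ} (hf : ∀ᵐ x, ‖f x‖ ≤ L)
    (x : EuclideanSpace ℝ (Fin d)) : ‖mollify ρ f x‖ ≤ L := by
  rw [mollify_apply_swap]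
  have h1 : ∫ w, ρ (x - w) = 1 := by
    rw [integral_sub_left_eq_self ρ volume x, h.integral_eq_one]
  have h2 : Integrable fun w => ρ (x - w) := h.integrable.comp_sub_left x
  calc _ ≤ ∫ w, ρ (x - w) * L := by
        refine norm_integral_le_of_norm_le (h2.mul_const L) ?_
        filter_upwards [hf] with w hw
        rw [norm_smul, Real.norm_of_nonneg (h.nonneg _)]
        exact mul_le_mul_of_nonneg_left hw (h.nonneg _)
    _ = L := by rw [integral_mul_const, h1, one_mul]

/-- Smooth approximations of a function that is bounded below by a positive constant and has a
bounded weak derivative. -/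
lemma exists_smooth_lowerBound (hS : IsOpen S) (hb : Bornology.IsBounded S) {b₀ L : ℝ}
    {c : EuclideanSpace ℝ (Fin d) → ℝ}
    {c' : Fin d → EuclideanSpace ℝ (Fin d) → ℝ} (hct : MemLp c ⊤ (volume.restrict S))
    (hc : ∀ i, HasWeakPartial S i c (c' i)) (hcb : ∀ᵐ x ∂(volume.restrict S), b₀ ≤ c x)
    (hL : 0 ≤ L) (hcL : ∀ i, ∀ᵐ x ∂(volume.restrict S), |c' i x| ≤ L) :
    ∃ κ : ℕ → EuclideanSpace ℝ (Fin d) → ℝ, (∀ k, ContDiff ℝ ∞ (κ k)) ∧ (∀ k x, b₀ ≤ κ k x) ∧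
      (∀ K : Set (EuclideanSpace ℝ (Fin d)), IsCompact K → K ⊆ S →
        ∀ᶠ k in atTop, ∀ i, ∀ x ∈ K, |partialDeriv i (κ k) x| ≤ L) ∧
      L2Tendsto (volume.restrict S) (fun k x => (κ k x : ℂ)) (fun x => (c x : ℂ)) := by
  have := isFiniteMeasure_restrict hb
  have hm := hS.measurableSet
  choose ρ hρ using fun k : ℕ => exists_isMollifier (d := d) 0
    (ε := 1 / ((k : ℝ) + 1)) (by positivity)
  have hε : Tendsto (fun k : ℕ => 1 / ((k : ℝ) + 1)) atTop (𝓝 0) :=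
    tendsto_one_div_add_atTop_nhds_zero_nat
  let f : EuclideanSpace ℝ (Fin d) → ℂ := fun x => ((c x - b₀ : ℝ) : ℂ)
  have hf2 : MemLp f 2 (volume.restrict S) :=
    memLp_ofReal (((hct.sub (memLp_const b₀))).mono_exponent le_top)
  have hfl := locallyIntegrable_indicator hm hf2
  have hsm : ∀ k, ContDiff ℝ ∞ (mollify (ρ k) (S.indicator f)) := fun k =>
    (hρ k).contDiff_mollify hfl
  have hpos : ∀ k x, 0 ≤ (mollify (ρ k) (S.indicator f) x).re := fun k x => by
    refine (hρ k).mollify_re_nonneg hfl ?_ x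
    filter_upwards [(ae_restrict_iff' hm).1 hcb] with w hw
    by_cases hwS : w ∈ S
    · simpa [hwS, f] using hw hwS
    · simp [hwS]
  have hlim : L2Tendsto (volume.restrict S) (fun k => mollify (ρ k) (S.indicator f)) f :=
    ((tendsto_mollify hρ tendsto_const_nhds hε (memLp_indicator hm hf2)).mono_measure
      Measure.restrict_le_self).congr (fun k => .rfl) (indicator_ae_eq_restrict hm)
  have hre : ∀ w : ℂ, ((w.re : ℝ) : ℂ) = (1 / 2 : ℂ) * (w + (starRingEnd ℂ) w) := fun w => by
    rw [Complex.add_conj]; push_cast; ring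
  refine ⟨fun k x => b₀ + (mollify (ρ k) (S.indicator f) x).re,
    fun k => contDiff_const.add (Complex.reCLM.contDiff.comp (hsm k)),
    fun k x => le_add_of_nonneg_right (hpos k x), fun K hK hKS => ?_, ?_⟩
  · obtain ⟨r, hr, hrS⟩ := hK.exists_cthickening_subset_open hS hKS
    filter_upwards [hε.eventually_le_const hr] with k hk i x hx
    have hball : Metric.closedBall (x - 0) (1 / ((k : ℝ) + 1)) ⊆ S := by
      rw [sub_zero]
      exact ((Metric.closedBall_subset_closedBall hk).trans
        (Metric.closedBall_subset_cthickening hx r)).trans hrS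
    have h1 := (hρ k).partialDeriv_mollify hm hfl i x
      (((hc i).sub_const hS b₀).ofReal.2.2 _ ((hρ k).isTestFunction hball))
    have h2 : partialDeriv i (fun x => b₀ + (mollify (ρ k) (S.indicator f) x).re) x =
        (partialDeriv i (mollify (ρ k) (S.indicator f)) x).re := by
      have h5 : DifferentiableAt ℝ (fun x => (mollify (ρ k) (S.indicator f) x).re) x :=
        ((Complex.reCLM.contDiff.comp (hsm k)).differentiable (by simp)) x
      rw [partialDeriv_add (differentiableAt_const b₀) h5]
      have h3 := partialDeriv_clm_comp Complex.reCLM (((hsm k).differentiable (by simp)) x) i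
      have h4 : partialDeriv i (fun _ => b₀) x = 0 := by simp [partialDeriv]
      rw [h4, zero_add]
      exact h3
    rw [h2, h1]
    refine (Complex.abs_re_le_norm _).trans ((hρ k).norm_mollify_le ?_ x)
    filter_upwards [(ae_restrict_iff' hm).1 (hcL i)] with w hw
    by_cases hwS : w ∈ S
    · simpa [hwS] using hw hwS
    · simpa [hwS] using hL
  · have h1 := ((hlim.add hlim.conj).const_mul (1 / 2 : ℂ)).add
      (L2Tendsto.const (memLp_const (b₀ : ℂ)))
    refine h1.congr (fun k => Eventually.of_forall fun x => ?_) (Eventually.of_forall fun x => ?_)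
    · simp only [Complex.ofReal_add, hre]
      ring
    · simp only [f, Complex.conj_ofReal]
      push_cast
      ring

lemma abs_inv_sub_inv_le {b₀ s t : ℝ} (hb₀ : 0 < b₀) (hs : b₀ ≤ s) (ht : b₀ ≤ t) :
    |s⁻¹ - t⁻¹| ≤ (b₀⁻¹) ^ 2 * |s - t| := by
  have hs0 := hb₀.trans_le hs
  have ht0 := hb₀.trans_le ht
  rw [inv_sub_inv hs0.ne' ht0.ne', abs_div, abs_mul, abs_of_pos hs0, abs_of_pos ht0, abs_sub_comm,
    div_eq_inv_mul, sq, mul_inv]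
  gcongr

lemma norm_ofReal_inv_le {b₀ t : ℝ} (hb₀ : 0 < b₀) (ht : b₀ ≤ t) : ‖((t : ℂ))⁻¹‖ ≤ b₀⁻¹ := by
  rw [norm_inv, Complex.norm_real, Real.norm_of_nonneg (hb₀.le.trans ht)]
  exact inv_anti₀ hb₀ ht

lemma memLp_top_inv {α : Type*} {m0 : MeasurableSpace α} {μ : Measure α} {b₀ : ℝ} (hb₀ : 0 < b₀)
    {f : α → ℝ} (hf : AEStronglyMeasurable f μ) (hfb : ∀ᵐ x ∂μ, b₀ ≤ f x) :
    MemLp (fun x => ((f x)⁻¹ : ℂ)) ⊤ μ := by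
  refine memLp_top_of_bound (C := b₀⁻¹)
    (Complex.measurable_ofReal.comp_aemeasurable hf.aemeasurable).inv.aestronglyMeasurable ?_
  filter_upwards [hfb] with x hx using norm_ofReal_inv_le hb₀ hx

/-- Integration by parts against the quotient `n / c`. The weak derivative of `n` is tested with
`φ / κ`, where `κ` is a smooth approximation of `c`. -/
lemma norm_setIntegral_div_mul_partialDeriv_le (hS : IsOpen S) (hb : Bornology.IsBounded S)
    {b₀ M L : ℝ} (hb₀ : 0 < b₀) {c n : EuclideanSpace ℝ (Fin d) → ℝ}
    {c' n' : Fin d → EuclideanSpace ℝ (Fin d) → ℝ} (hct : MemLp c ⊤ (volume.restrict S))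
    (hc : ∀ i, HasWeakPartial S i c (c' i)) (hcb : ∀ᵐ x ∂(volume.restrict S), b₀ ≤ c x)
    (hL : 0 ≤ L) (hcL : ∀ i, ∀ᵐ x ∂(volume.restrict S), |c' i x| ≤ L)
    (hnt : MemLp n ⊤ (volume.restrict S)) (hn : ∀ i, HasWeakPartial S i n (n' i))
    (hM : 0 ≤ M) (hnM : ∀ᵐ x ∂(volume.restrict S), |n x| ≤ M)
    (hnL : ∀ i, ∀ᵐ x ∂(volume.restrict S), |n' i x| ≤ L)
    {φ : EuclideanSpace ℝ (Fin d) → ℝ} (hφ : IsTestFunction S φ) (i : Fin d) :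
    ‖∫ x in S, (n x : ℂ) * ((partialDeriv i φ x : ℝ) : ℂ) * ((c x)⁻¹ : ℂ)‖ ≤
      (L * b₀⁻¹ + M * L * b₀⁻¹ ^ 2) * ∫ x in S, |φ x| := by
  have := isFiniteMeasure_restrict hb
  obtain ⟨κ, hκs, hκb, hκd, hκ⟩ := exists_smooth_lowerBound hS hb hct hc hcb hL hcL
  have hφ' := isTestFunction_partialDeriv hφ i
  have hnφ : MemLp (fun x => (n x : ℂ) * ((partialDeriv i φ x : ℝ) : ℂ)) 2 (volume.restrict S) :=
    (hφ'.ofReal.memLp (volume.restrict S) 2).mul' (memLp_ofReal hnt)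
  have hinv : L2Tendsto (volume.restrict S) (fun k x => ((κ k x)⁻¹ : ℂ))
      (fun x => ((c x)⁻¹ : ℂ)) := by
    have hκm : ∀ k, MemLp (fun x => ((κ k x)⁻¹ : ℂ)) 2 (volume.restrict S) := fun k =>
      (memLp_top_inv hb₀ (hκs k).continuous.aestronglyMeasurable
        (Eventually.of_forall (hκb k))).mono_exponent le_top
    have hcm := (memLp_top_inv hb₀ hct.1 hcb).mono_exponent (p := 2) le_top
    refine L2Tendsto.of_integral_norm_sq hκm hcm ?_
    have h1 := hκ.tendsto_integral_norm_sub_sq.const_mul ((b₀⁻¹ ^ 2) ^ 2)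
    rw [mul_zero] at h1
    refine squeeze_zero (fun k => integral_nonneg fun x => by positivity) (fun k => ?_) h1
    rw [← integral_const_mul]
    refine integral_mono_ae (((hκm k).sub hcm).integrable_norm_pow (by norm_num))
      ((((hκ.memLp k).sub hκ.memLp_limit).integrable_norm_pow (by norm_num)).const_mul _) ?_
    filter_upwards [hcb] with x hx
    rw [← mul_pow]
    gcongr
    have := abs_inv_sub_inv_le hb₀ (hκb k x) hx
    rw [← Complex.ofReal_inv, ← Complex.ofReal_inv, ← Complex.ofReal_sub, ← Complex.ofReal_sub,
      Complex.norm_real, Complex.norm_real]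
    exact this
  have hlim := ((L2Tendsto.const hnφ).integral_mul hinv).norm
  refine le_of_tendsto hlim ?_
  filter_upwards [hκd _ hφ.hasCompactSupport.isCompact hφ.tsupport_subset] with k hk
  have hκ0 : ∀ x, κ k x ≠ 0 := fun x => (hb₀.trans_le (hκb k x)).ne'
  have hκis : ContDiff ℝ ∞ (fun x => (κ k x)⁻¹) := (hκs k).inv hκ0
  have hinvle : ∀ x, (κ k x)⁻¹ ≤ b₀⁻¹ := fun x => inv_anti₀ hb₀ (hκb k x)
  have hinv0 : ∀ x, 0 ≤ (κ k x)⁻¹ := fun x => inv_nonneg.2 (hb₀.le.trans (hκb k x))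
  -- the test function `φ / κ`
  have hψ : IsTestFunction S (fun x => φ x • (κ k x)⁻¹) :=
    ⟨hφ.contDiff.smul hκis, hφ.hasCompactSupport.smul_right,
      (closure_mono (Function.support_smul_subset_left φ _)).trans hφ.tsupport_subset⟩
  have hdinv : ∀ x, partialDeriv i (fun x => (κ k x)⁻¹) x =
      -((κ k x)⁻¹ ^ 2 * partialDeriv i (κ k) x) := fun x => by
    have h1 : HasFDerivAt (fun x => (κ k x)⁻¹) (-(κ k x ^ 2)⁻¹ • fderiv ℝ (κ k) x) x :=
      (hasDerivAt_inv (hκ0 x)).comp_hasFDerivAt x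
        (((hκs k).differentiable (by simp)) x).hasFDerivAt
    rw [partialDeriv, h1.fderiv, partialDeriv]
    simp [inv_pow]
  have hdψ : ∀ x, partialDeriv i (fun x => φ x • (κ k x)⁻¹) x =
      partialDeriv i φ x * (κ k x)⁻¹ - φ x * ((κ k x)⁻¹ ^ 2 * partialDeriv i (κ k) x) :=
    fun x => by
    rw [partialDeriv_smul ((hφ.contDiff.differentiable (by simp)) x)
      ((hκis.differentiable (by simp)) x), hdinv, smul_eq_mul, smul_eq_mul]
    ring
  have hφi : Integrable (fun x => |φ x|) (volume.restrict S) :=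
    (hφ.contDiff.continuous.abs.integrable_of_hasCompactSupport
      hφ.hasCompactSupport.norm).restrict
  have hreal : ∫ x in S, (n x : ℂ) * ((partialDeriv i φ x : ℝ) : ℂ) * ((κ k x)⁻¹ : ℂ) =
      ((∫ x in S, n x * partialDeriv i φ x * (κ k x)⁻¹ : ℝ) : ℂ) := by
    rw [← integral_complex_ofReal]
    congr 1 with x
    push_cast
    ring
  have hbd : ∀ (f : EuclideanSpace ℝ (Fin d) → ℝ) (B : ℝ),
      (∀ᵐ x ∂(volume.restrict S), |f x| ≤ B * |φ x|) → |∫ x in S, f x| ≤ B * ∫ x in S, |φ x| := by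
    intro f B hf
    rw [← integral_const_mul, ← Real.norm_eq_abs]
    exact norm_integral_le_of_norm_le (hφi.const_mul B) (by simpa only [Real.norm_eq_abs] using hf)
  have hkd : ∀ x, |φ x * ((κ k x)⁻¹ ^ 2 * partialDeriv i (κ k) x)| ≤ L * b₀⁻¹ ^ 2 * |φ x| := by
    intro x
    by_cases hx : x ∈ tsupport φ
    · rw [abs_mul, abs_mul, abs_of_nonneg (by positivity : (0 : ℝ) ≤ (κ k x)⁻¹ ^ 2), mul_comm]
      have h1 := hinvle x
      have h2 := hinv0 x
      have h3 := hk i x hx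
      have : (κ k x)⁻¹ ^ 2 * |partialDeriv i (κ k) x| ≤ b₀⁻¹ ^ 2 * L := by gcongr
      rw [mul_comm L]
      gcongr
    · simp [image_eq_zero_of_notMem_tsupport hx]
  have hI1 : |∫ x in S, n x * (φ x * ((κ k x)⁻¹ ^ 2 * partialDeriv i (κ k) x))| ≤
      (M * (L * b₀⁻¹ ^ 2)) * ∫ x in S, |φ x| := by
    refine hbd _ _ ?_
    filter_upwards [hnM] with x hx
    rw [abs_mul, mul_assoc]
    exact mul_le_mul hx (hkd x) (abs_nonneg _) hM
  have hI2 : |∫ x in S, (φ x • (κ k x)⁻¹) • n' i x| ≤ (L * b₀⁻¹) * ∫ x in S, |φ x| := by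
    refine hbd _ _ ?_
    filter_upwards [hnL i] with x hx
    rw [smul_eq_mul, smul_eq_mul, abs_mul, abs_mul, abs_of_nonneg (hinv0 x)]
    have h1 := hinvle x
    calc |φ x| * (κ k x)⁻¹ * |n' i x| ≤ |φ x| * b₀⁻¹ * L := by gcongr
      _ = _ := by ring
  have hint : ∀ {f : EuclideanSpace ℝ (Fin d) → ℝ}, Continuous f → HasCompactSupport f →
      Integrable (fun x => n x * f x) (volume.restrict S) := fun {f} hf hfs => by
    have h1 : Integrable f (volume.restrict S) := (hf.integrable_of_hasCompactSupport hfs).restrict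
    exact memLp_one_iff_integrable.1 ((memLp_one_iff_integrable.2 h1).mul' hnt)
  have hi1 : Integrable (fun x => n x * (partialDeriv i φ x * (κ k x)⁻¹)) (volume.restrict S) :=
    hint (hφ'.contDiff.continuous.mul hκis.continuous) hφ'.hasCompactSupport.mul_right
  have hi2 : Integrable (fun x => n x * (φ x * ((κ k x)⁻¹ ^ 2 * partialDeriv i (κ k) x)))
      (volume.restrict S) :=
    hint (hφ.contDiff.continuous.mul ((hκis.continuous.pow 2).mul
      (contDiff_partialDeriv (hκs k) i).continuous)) hφ.hasCompactSupport.mul_right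
  have key : ∫ x in S, n x * partialDeriv i φ x * (κ k x)⁻¹ =
      (∫ x in S, n x * (φ x * ((κ k x)⁻¹ ^ 2 * partialDeriv i (κ k) x))) -
      ∫ x in S, (φ x • (κ k x)⁻¹) • n' i x := by
    have h1 := (hn i).2.2 _ hψ
    have h2 : ∀ x, partialDeriv i (fun x => φ x • (κ k x)⁻¹) x • n x =
        n x * (partialDeriv i φ x * (κ k x)⁻¹) -
        n x * (φ x * ((κ k x)⁻¹ ^ 2 * partialDeriv i (κ k) x)) := fun x => by
      rw [hdψ, smul_eq_mul]; ring
    simp_rw [h2] at h1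
    rw [integral_sub hi1 hi2] at h1
    simp_rw [mul_assoc]
    linarith
  rw [hreal, Complex.norm_real, key]
  calc _ ≤ _ := abs_sub _ _
    _ ≤ _ := add_le_add hI1 hI2
    _ = _ := by ring

end Quotient

/-! ### The Rellich identity -/

section Rellich

variable {d : ℕ} {Ω : Set (EuclideanSpace ℝ (Fin d))} {x₀ e : EuclideanSpace ℝ (Fin d)} {r : ℝ}
  {γ : EuclideanSpace ℝ (Fin d) → ℝ}

lemma partialDeriv_comm {F : Type*} [NormedAddCommGroup F] [NormedSpace ℝ F]
    {f : EuclideanSpace ℝ (Fin d) → F} (hf : ContDiff ℝ ∞ f) (i l : Fin d)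
    (x : EuclideanSpace ℝ (Fin d)) :
    partialDeriv l (partialDeriv i f) x = partialDeriv i (partialDeriv l f) x := by
  have hd : DifferentiableAt ℝ (fderiv ℝ f) x :=
    ((hf.fderiv_right (m := ∞) (by simp)).differentiable (by simp)) x
  have h : ∀ i l : Fin d, partialDeriv l (partialDeriv i f) x =
      fderiv ℝ (fderiv ℝ f) x (EuclideanSpace.single l 1) (EuclideanSpace.single i 1) := by
    intro i l
    change fderiv ℝ (fun y => fderiv ℝ f y (EuclideanSpace.single i 1)) x _ = _
    rw [fderiv_clm_apply hd (differentiableAt_const _)]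
    simp
  rw [h, h]
  exact (hf.contDiffAt.isSymmSndFDerivAt
    (by simpa using WithTop.coe_le_coe.2 (le_top : (2 : ℕ∞) ≤ ⊤))).eq _ _

/-- The field whose divergence gives the Rellich identity for a function with gradient `p`. -/
noncomputable def rellichField {d : ℕ} (e : EuclideanSpace ℝ (Fin d))
    (p : Fin d → EuclideanSpace ℝ (Fin d) → ℂ) (i : Fin d) (x : EuclideanSpace ℝ (Fin d)) : ℝ :=
  2 * inner ℝ (p i x) (∑ l, e l • p l x) - e i * ∑ l, inner ℝ (p l x) (p l x)

lemma contDiff_rellichField {p : Fin d → EuclideanSpace ℝ (Fin d) → ℂ}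
    (hp : ∀ i, ContDiff ℝ ∞ (p i)) (i : Fin d) : ContDiff ℝ ∞ (rellichField e p i) :=
  (contDiff_const.mul ((hp i).inner ℝ (ContDiff.sum fun l _ => (hp l).const_smul (e l)))).sub
    (contDiff_const.mul (ContDiff.sum fun l _ => (hp l).inner ℝ (hp l)))

lemma partialDeriv_inner {f g : EuclideanSpace ℝ (Fin d) → ℂ} {x : EuclideanSpace ℝ (Fin d)}
    (hf : DifferentiableAt ℝ f x) (hg : DifferentiableAt ℝ g x) (i : Fin d) :
    partialDeriv i (fun y => (inner ℝ (f y) (g y) : ℝ)) x =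
      inner ℝ (f x) (partialDeriv i g x) + inner ℝ (partialDeriv i f x) (g x) :=
  fderiv_inner_apply ℝ hf hg _

/-- The divergence of the Rellich field contains second derivatives only through the divergence
of `p`, because `p` is curl-free. -/
lemma sum_partialDeriv_rellichField {p : Fin d → EuclideanSpace ℝ (Fin d) → ℂ}
    (hp : ∀ i, ContDiff ℝ ∞ (p i)) {x : EuclideanSpace ℝ (Fin d)}
    (hcurl : ∀ i l, partialDeriv l (p i) x = partialDeriv i (p l) x) :
    ∑ i, partialDeriv i (rellichField e p i) x =
      2 * inner ℝ (∑ i, partialDeriv i (p i) x) (∑ l, e l • p l x) := by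
  have hd : ∀ l, DifferentiableAt ℝ (p l) x := fun l => ((hp l).differentiable (by simp)) x
  have hds : ∀ l, DifferentiableAt ℝ (fun x => e l • p l x) x := fun l => (hd l).const_smul (e l)
  have ha : DifferentiableAt ℝ (fun x => ∑ l, e l • p l x) x :=
    DifferentiableAt.fun_sum fun l _ => hds l
  have hda : ∀ i, partialDeriv i (fun x => ∑ l, e l • p l x) x =
      ∑ l, e l • partialDeriv i (p l) x := fun i => by
    rw [partialDeriv_sum _ fun l _ => hds l]
    refine Finset.sum_congr rfl fun l _ => ?_
    rw [partialDeriv, fderiv_fun_const_smul (hd l)]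
    rfl
  have hq : ∀ i, partialDeriv i (fun x => ∑ l, (inner ℝ (p l x) (p l x) : ℝ)) x =
      ∑ l, 2 * inner ℝ (p l x) (partialDeriv i (p l) x) := fun i => by
    rw [partialDeriv_sum _ fun l _ => (hd l).inner ℝ (hd l)]
    refine Finset.sum_congr rfl fun l _ => ?_
    rw [partialDeriv_inner (hd l) (hd l), real_inner_comm (p l x), two_mul]
  have hW : ∀ i, partialDeriv i (rellichField e p i) x =
      2 * (inner ℝ (p i x) (∑ l, e l • partialDeriv i (p l) x) +
        inner ℝ (partialDeriv i (p i) x) (∑ l, e l • p l x)) -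
      e i * ∑ l, 2 * inner ℝ (p l x) (partialDeriv i (p l) x) := fun i => by
    have hiq : DifferentiableAt ℝ (fun x => ∑ l, (inner ℝ (p l x) (p l x) : ℝ)) x :=
      DifferentiableAt.fun_sum fun l _ => (hd l).inner ℝ (hd l)
    have hia : DifferentiableAt ℝ (fun x => (inner ℝ (p i x) (∑ l, e l • p l x) : ℝ)) x :=
      (hd i).inner ℝ ha
    rw [← hq, ← hda, ← partialDeriv_inner (hd i) ha]
    change fderiv ℝ (fun x => 2 * inner ℝ (p i x) (∑ l, e l • p l x) -
      e i * ∑ l, inner ℝ (p l x) (p l x)) x _ = _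
    rw [fderiv_fun_sub (hia.const_mul 2) (hiq.const_mul (e i)), fderiv_const_mul hia,
      fderiv_const_mul hiq]
    rfl
  simp_rw [hW]
  rw [Finset.sum_sub_distrib, ← Finset.mul_sum, Finset.sum_add_distrib, sum_inner]
  have hswap : ∑ i, e i * ∑ l, 2 * inner ℝ (p l x) (partialDeriv i (p l) x) =
      2 * ∑ i, inner ℝ (p i x) (∑ l, e l • partialDeriv i (p l) x) := by
    simp_rw [inner_sum, Finset.mul_sum, real_inner_smul_right]
    rw [Finset.sum_comm]
    refine Finset.sum_congr rfl fun i _ => Finset.sum_congr rfl fun l _ => ?_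
    rw [hcurl]
    ring
  rw [hswap]
  ring

lemma norm_rellichField_le (he : ‖e‖ = 1) (p : Fin d → EuclideanSpace ℝ (Fin d) → ℂ) (i : Fin d)
    (x : EuclideanSpace ℝ (Fin d)) : |rellichField e p i x| ≤ 3 * ∑ l, ‖p l x‖ ^ 2 := by
  have h1 := norm_sum_smul_sq_le he fun l => p l x
  have h2 : ‖p i x‖ ^ 2 ≤ ∑ l, ‖p l x‖ ^ 2 :=
    Finset.single_le_sum (f := fun l => ‖p l x‖ ^ 2) (fun l _ => by positivity)
      (Finset.mem_univ i)
  have h3 : |e i| ≤ 1 := he ▸ PiLp.norm_apply_le e i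
  have h4 := abs_real_inner_le_norm (p i x) (∑ l, e l • p l x)
  have h5 : 2 * (‖p i x‖ * ‖∑ l, e l • p l x‖) ≤ 2 * ∑ l, ‖p l x‖ ^ 2 := by
    nlinarith [sq_nonneg (‖p i x‖ - ‖∑ l, e l • p l x‖)]
  rw [rellichField]
  simp_rw [real_inner_self_eq_norm_sq]
  have h0 : 0 ≤ ∑ l, ‖p l x‖ ^ 2 := Finset.sum_nonneg fun l _ => by positivity
  calc _ ≤ |2 * inner ℝ (p i x) (∑ l, e l • p l x)| + |e i * ∑ l, ‖p l x‖ ^ 2| := abs_sub _ _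
    _ ≤ 2 * (‖p i x‖ * ‖∑ l, e l • p l x‖) + 1 * ∑ l, ‖p l x‖ ^ 2 := by
        rw [abs_mul, abs_mul, abs_two, abs_of_nonneg h0]
        gcongr
    _ ≤ _ := by linarith

/-- The algebraic inequality behind the Rellich estimate: up to the tangential part
`p - ν ⟨e, p⟩` of the gradient, the flux of the Rellich field controls the gradient. -/
lemma sum_norm_sq_le_flux (ν : Fin d → ℝ) (p : Fin d → EuclideanSpace ℝ (Fin d) → ℂ)
    (x : EuclideanSpace ℝ (Fin d)) (hν : ∑ i, ν i * e i = 1) :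
    ∑ l, ‖p l x‖ ^ 2 ≤ 2 * ∑ i, ν i * rellichField e p i x +
      4 * ∑ i, ‖p i x - ν i • ∑ l, e l • p l x‖ ^ 2 := by
  set a : ℂ := ∑ l, e l • p l x
  have h1 : ∀ (t : ℝ) i, ‖p i x - (t * ν i) • a‖ ^ 2 =
      ‖p i x‖ ^ 2 - 2 * t * (ν i * inner ℝ (p i x) a) + t ^ 2 * (ν i ^ 2 * ‖a‖ ^ 2) := by
    intro t i
    rw [norm_sub_sq_real, real_inner_smul_right, norm_smul, mul_pow, Real.norm_eq_abs, sq_abs]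
    ring
  have h2 : ∀ t : ℝ, ∑ i, ‖p i x - (t * ν i) • a‖ ^ 2 = ∑ i, ‖p i x‖ ^ 2 -
      2 * t * ∑ i, ν i * inner ℝ (p i x) a + t ^ 2 * ∑ i, ν i ^ 2 * ‖a‖ ^ 2 := by
    intro t
    simp_rw [h1]
    rw [Finset.sum_add_distrib, Finset.sum_sub_distrib, ← Finset.mul_sum, ← Finset.mul_sum]
  have h3 : ∑ i, ν i * rellichField e p i x =
      2 * (∑ i, ν i * inner ℝ (p i x) a) - ∑ i, ‖p i x‖ ^ 2 := by
    calc ∑ i, ν i * rellichField e p i x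
        = ∑ i, (2 * (ν i * inner ℝ (p i x) a) - ν i * e i * ∑ l, ‖p l x‖ ^ 2) := by
          refine Finset.sum_congr rfl fun i _ => ?_
          rw [rellichField]
          simp_rw [real_inner_self_eq_norm_sq]
          ring
      _ = _ := by rw [Finset.sum_sub_distrib, ← Finset.sum_mul, hν, ← Finset.mul_sum, one_mul]
  have h4 := h2 1
  have h5 : 0 ≤ ∑ i, ‖p i x - (2 * ν i) • a‖ ^ 2 := Finset.sum_nonneg fun i _ => by positivity
  rw [h2 2] at h5
  simp_rw [one_mul] at h4
  rw [h3, h4]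
  linarith

lemma sum_conormal_mul_self (he : ‖e‖ = 1) (hγ : ContDiff ℝ ∞ γ)
    (hγe : ∀ x (t : ℝ), γ (x + t • e) = γ x) (x : EuclideanSpace ℝ (Fin d)) :
    ∑ i, conormal e γ i x * e i = 1 := by
  have h1 : ∑ i, e i * e i = 1 := by
    have := EuclideanSpace.real_norm_sq_eq e
    rw [he] at this
    simpa [sq] using this.symm
  have h2 := fderiv_apply_eq_sum γ x e
  rw [fderiv_apply_self hγ hγe] at h2
  simp_rw [conormal, sub_mul]
  rw [Finset.sum_sub_distrib, h1, sub_eq_self, h2]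
  exact Finset.sum_congr rfl fun i _ => by rw [smul_eq_mul, mul_comm]

/-- The Rellich estimate in a boundary chart: the gradient on the boundary is controlled by the
pairing of the Laplacian with the derivative in the direction `e`, the Dirichlet integral, and the
tangential part of the gradient on the boundary. It is the divergence theorem for the cut off
Rellich field. -/
lemma IsGraphChart.exists_rellich_le (h : IsGraphChart Ω x₀ r e γ) (hΩ : MeasurableSet Ω)
    (hb : Bornology.IsBounded Ω) {χ : EuclideanSpace ℝ (Fin d) → ℝ}
    (hχ : IsTestFunction (Metric.ball x₀ r) χ) (hχ0 : ∀ x, 0 ≤ χ x) :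
    ∃ C : ℝ, 0 ≤ C ∧ ∀ f : EuclideanSpace ℝ (Fin d) → ℂ, ContDiff ℝ ∞ f →
      ∫ x, χ x * ∑ i, ‖partialDeriv i f x‖ ^ 2 ∂graphMeasure e γ ≤
        -4 * (∫ x in Ω, χ x * inner ℝ (∑ i, partialDeriv i (partialDeriv i f) x)
          (∑ l, e l • partialDeriv l f x)) +
        C * (∑ i, ∫ x in Ω, ‖partialDeriv i f x‖ ^ 2) +
        4 * ∑ i, ∫ x, χ x * ‖partialDeriv i f x - conormal e γ i x • ∑ l, e l • partialDeriv l f x‖ ^ 2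
          ∂graphMeasure e γ := by
  have hχd := fun i => isTestFunction_partialDeriv hχ i
  choose B hB using fun i =>
    (hχd i).contDiff.continuous.bounded_above_of_compact_support (hχd i).hasCompactSupport
  have hB0 : ∀ i, 0 ≤ B i := fun i => (norm_nonneg _).trans (hB i 0)
  refine ⟨2 * ∑ i, B i * 3, mul_nonneg (by norm_num)
    (Finset.sum_nonneg fun i _ => mul_nonneg (hB0 i) (by norm_num)), fun f hf => ?_⟩
  have hp : ∀ i, ContDiff ℝ ∞ (partialDeriv i f) := fun i => contDiff_partialDeriv hf i
  have hdp : ∀ i l, ContDiff ℝ ∞ (partialDeriv l (partialDeriv i f)) := fun i l =>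
    contDiff_partialDeriv (hp i) l
  have hac : Continuous fun x => ∑ l, e l • partialDeriv l f x :=
    continuous_finsetSum _ fun l _ => ((hp l).const_smul (e l)).continuous
  have hW := fun i => contDiff_rellichField (e := e) hp i
  have hγc := h.contDiff.continuous
  have hνc := fun i => (contDiff_conormal (e := e) h.contDiff i).continuous
  have hqc : Continuous fun x => ∑ i, ‖partialDeriv i f x‖ ^ 2 :=
    continuous_finsetSum _ fun i _ => (hp i).continuous.norm.pow 2
  have hint : ∀ {G : EuclideanSpace ℝ (Fin d) → ℝ}, Continuous G →
      Integrable (fun x => χ x * G x) (graphMeasure e γ) := fun {G} hG =>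
    integrable_graphMeasure hγc (hχ.contDiff.continuous.mul hG)
      hχ.hasCompactSupport.mul_right
  -- the divergence theorem for the cut off Rellich field
  have hdiv : ∀ i, ∫ x in Ω, partialDeriv i (fun y => χ y • rellichField e
      (fun i => partialDeriv i f) i y) x =
      -∫ x, χ x * (conormal e γ i x * rellichField e (fun i => partialDeriv i f) i x)
        ∂graphMeasure e γ := fun i => by
    have := h.setIntegral_partialDeriv hΩ (G := fun y => χ y • rellichField e
      (fun i => partialDeriv i f) i y) ((hχ.contDiff.smul (hW i)).of_le (by simp))
      hχ.hasCompactSupport.smul_right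
      ((closure_mono (Function.support_smul_subset_left χ _)).trans hχ.tsupport_subset) i
    rw [this]
    congr 2 with x
    rw [smul_eq_mul, smul_eq_mul]
    ring
  have hflux : ∫ x, χ x * ∑ i, ‖partialDeriv i f x‖ ^ 2 ∂graphMeasure e γ ≤
      2 * ∑ i, ∫ x, χ x * (conormal e γ i x * rellichField e (fun i => partialDeriv i f) i x)
        ∂graphMeasure e γ +
      4 * ∑ i, ∫ x, χ x * ‖partialDeriv i f x - conormal e γ i x • ∑ l, e l • partialDeriv l f x‖ ^ 2
          ∂graphMeasure e γ := by
    have hi1 : ∀ i, Integrable (fun x => χ x * (conormal e γ i x *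
        rellichField e (fun i => partialDeriv i f) i x)) (graphMeasure e γ) := fun i =>
      hint ((hνc i).mul (hW i).continuous)
    have hi2 : ∀ i, Integrable (fun x => χ x * ‖partialDeriv i f x - conormal e γ i x •
        ∑ l, e l • partialDeriv l f x‖ ^ 2) (graphMeasure e γ) := fun i =>
      hint (((hp i).continuous.sub ((hνc i).smul hac)).norm.pow 2)
    rw [← integral_finsetSum _ fun i _ => hi1 i, ← integral_finsetSum _ fun i _ => hi2 i,
      ← integral_const_mul, ← integral_const_mul, ← integral_add
        ((integrable_finsetSum _ fun i _ => hi1 i).const_mul 2)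
        ((integrable_finsetSum _ fun i _ => hi2 i).const_mul 4)]
    refine integral_mono (hint hqc) (((integrable_finsetSum _ fun i _ => hi1 i).const_mul 2).add
        ((integrable_finsetSum _ fun i _ => hi2 i).const_mul 4)) fun x => ?_
    have h1 := mul_le_mul_of_nonneg_left (sum_norm_sq_le_flux (fun i => conormal e γ i x)
      (fun i => partialDeriv i f) x
      (sum_conormal_mul_self h.norm_eq_one h.contDiff h.add_smul x)) (hχ0 x)
    refine h1.trans_eq ?_
    simp only [← Finset.mul_sum]
    ring
  have hleib : ∀ x, ∑ i, partialDeriv i (fun y => χ y • rellichField e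
      (fun i => partialDeriv i f) i y) x =
      2 * (χ x * inner ℝ (∑ i, partialDeriv i (partialDeriv i f) x)
        (∑ l, e l • partialDeriv l f x)) +
      ∑ i, partialDeriv i χ x * rellichField e (fun i => partialDeriv i f) i x := by
    intro x
    have h1 := sum_partialDeriv_rellichField (e := e) hp (x := x)
      fun i l => partialDeriv_comm hf i l x
    have h2 : ∀ i, partialDeriv i (fun y => χ y • rellichField e (fun i => partialDeriv i f) i y) x =
        partialDeriv i χ x * rellichField e (fun i => partialDeriv i f) i x +
        χ x * partialDeriv i (rellichField e (fun i => partialDeriv i f) i) x := fun i =>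
      partialDeriv_smul ((hχ.contDiff.differentiable (by simp)) x)
        (((hW i).differentiable (by simp)) x) i
    simp_rw [h2]
    rw [Finset.sum_add_distrib, ← Finset.mul_sum, h1]
    ring
  have := isFiniteMeasure_restrict hb
  have hintΩ : ∀ {G : EuclideanSpace ℝ (Fin d) → ℝ}, Continuous G →
      Integrable G (volume.restrict Ω) := fun hG =>
    memLp_one_iff_integrable.1 (memLp_restrict hΩ hb hG 1)
  have hi3 : Integrable (fun x => 2 * (χ x * inner ℝ (∑ i, partialDeriv i (partialDeriv i f) x)
        (∑ l, e l • partialDeriv l f x))) (volume.restrict Ω) :=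
    hintΩ (continuous_const.mul (hχ.contDiff.continuous.mul
      ((continuous_finsetSum _ fun i _ => (hdp i i).continuous).inner hac)))
  have hi4 : ∀ i, Integrable (fun x => partialDeriv i χ x *
      rellichField e (fun i => partialDeriv i f) i x) (volume.restrict Ω) := fun i =>
    hintΩ ((hχd i).contDiff.continuous.mul (hW i).continuous)
  have hsum : ∑ i, ∫ x, χ x * (conormal e γ i x * rellichField e (fun i => partialDeriv i f) i x)
        ∂graphMeasure e γ =
      -(2 * (∫ x in Ω, χ x * inner ℝ (∑ i, partialDeriv i (partialDeriv i f) x)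
        (∑ l, e l • partialDeriv l f x)) +
      ∑ i, ∫ x in Ω, partialDeriv i χ x * rellichField e (fun i => partialDeriv i f) i x) := by
    have h1 : ∑ i, ∫ x in Ω, partialDeriv i (fun y => χ y • rellichField e
        (fun i => partialDeriv i f) i y) x = _ := Finset.sum_congr rfl fun i _ => hdiv i
    have hi5 : ∀ i, Integrable (fun x => partialDeriv i (fun y => χ y • rellichField e
        (fun i => partialDeriv i f) i y) x) (volume.restrict Ω) := fun i =>
      hintΩ (continuous_partialDeriv ((hχ.contDiff.smul (hW i)).of_le (by simp)) i)
    rw [← integral_finsetSum _ fun i _ => hi5 i] at h1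
    simp_rw [hleib] at h1
    rw [integral_add hi3 (integrable_finsetSum _ fun i _ => hi4 i), integral_const_mul,
      integral_finsetSum _ fun i _ => hi4 i, Finset.sum_neg_distrib] at h1
    rw [h1, neg_neg]
  have hrem : ∀ i, |∫ x in Ω, partialDeriv i χ x * rellichField e (fun i => partialDeriv i f) i x| ≤
      B i * 3 * ∑ i, ∫ x in Ω, ‖partialDeriv i f x‖ ^ 2 := fun i => by
    have hsq : ∀ i, Integrable (fun x => ‖partialDeriv i f x‖ ^ 2) (volume.restrict Ω) := fun i =>
      hintΩ ((hp i).continuous.norm.pow 2)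
    rw [← integral_finsetSum _ fun i _ => hsq i, ← integral_const_mul, ← Real.norm_eq_abs]
    refine norm_integral_le_of_norm_le ((integrable_finsetSum _ fun i _ => hsq i).const_mul _)
      (Eventually.of_forall fun x => ?_)
    rw [norm_mul, mul_assoc]
    exact mul_le_mul (hB i x) (norm_rellichField_le h.norm_eq_one _ i x) (norm_nonneg _) (hB0 i)
  have hremsum : -(∑ i, ∫ x in Ω, partialDeriv i χ x *
      rellichField e (fun i => partialDeriv i f) i x) ≤
      (∑ i, B i * 3) * ∑ i, ∫ x in Ω, ‖partialDeriv i f x‖ ^ 2 := by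
    refine (neg_le_abs _).trans ((Finset.abs_sum_le_sum_abs _ _).trans ?_)
    rw [Finset.sum_mul]
    exact Finset.sum_le_sum fun i _ => hrem i
  rw [hsum] at hflux
  linarith

/-- Tangential derivatives can be integrated by parts on the graph. Both sides come from the
divergence theorem for `∂ᵢ∂ₑ` applied to `ψ f`, in the two orders of differentiation. -/
lemma IsGraphChart.integral_tangential (h : IsGraphChart Ω x₀ r e γ) (hΩ : MeasurableSet Ω)
    {ψ : EuclideanSpace ℝ (Fin d) → ℝ} (hψ : IsTestFunction (Metric.ball x₀ r) ψ)
    {f : EuclideanSpace ℝ (Fin d) → ℂ} (hf : ContDiff ℝ ∞ f) (i : Fin d) :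
    ∫ x, ψ x • (partialDeriv i f x - conormal e γ i x • ∑ l, e l • partialDeriv l f x)
        ∂graphMeasure e γ =
      -∫ x, (partialDeriv i ψ x - conormal e γ i x * fderiv ℝ ψ x e) • f x ∂graphMeasure e γ := by
  have hF := hψ.smul_isComplexTest hf
  have hFi := hF.partialDeriv' i
  have hνc := (contDiff_conormal (e := e) h.contDiff i).continuous
  have hγc := h.contDiff.continuous
  have hFe : ContDiff ℝ ∞ (fun x => fderiv ℝ (fun x => ψ x • f x) x e) :=
    (hF.contDiff.fderiv_right (m := ∞) (by simp)).clm_apply contDiff_const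
  have hFec : HasCompactSupport (fun x => fderiv ℝ (fun x => ψ x • f x) x e) :=
    hF.hasCompactSupport.fderiv_apply (𝕜 := ℝ) _
  have hFes : tsupport (fun x => fderiv ℝ (fun x => ψ x • f x) x e) ⊆ Metric.ball x₀ r :=
    (tsupport_fderiv_apply_subset ℝ e).trans hF.tsupport_subset
  have h1 := h.setIntegral_fderiv hΩ (hFi.contDiff.of_le (by simp)) hFi.hasCompactSupport
    hFi.tsupport_subset
  have h2 := h.setIntegral_partialDeriv hΩ (hFe.of_le (by simp)) hFec hFes i
  have hcomm : ∀ x, fderiv ℝ (partialDeriv i (fun x => ψ x • f x)) x e =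
      partialDeriv i (fun x => fderiv ℝ (fun x => ψ x • f x) x e) x := by
    intro x
    have h3 : (fun x => fderiv ℝ (fun x => ψ x • f x) x e) =
        fun x => ∑ l, e l • partialDeriv l (fun x => ψ x • f x) x := by
      ext1 y; exact fderiv_apply_eq_sum _ y e
    have hdl : ∀ l, DifferentiableAt ℝ (partialDeriv l (fun x => ψ x • f x)) x := fun l =>
      ((hF.partialDeriv' l).contDiff.differentiable (by simp)) x
    have hdle : ∀ l, DifferentiableAt ℝ
        (fun x => e l • partialDeriv l (fun x => ψ x • f x) x) x := fun l => (hdl l).const_smul (e l)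
    rw [h3, partialDeriv_sum _ fun l _ => hdle l, fderiv_apply_eq_sum]
    refine Finset.sum_congr rfl fun l _ => ?_
    rw [partialDeriv_comm hF.contDiff i l x, partialDeriv, partialDeriv,
      fderiv_fun_const_smul (hdl l)]
    rfl
  simp_rw [hcomm] at h1
  have h3 := neg_injective (h1.symm.trans h2)
  have hdψ := fun x => (hψ.contDiff.differentiable (by simp)) x
  have hdf := fun x => (hf.differentiable (by simp)) x
  have hψi := isTestFunction_partialDeriv hψ i
  have hψe : Continuous fun x => fderiv ℝ ψ x e :=
    ((hψ.contDiff.fderiv_right (m := ∞) (by simp)).clm_apply contDiff_const).continuous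
  have hψec : HasCompactSupport fun x => fderiv ℝ ψ x e :=
    hψ.hasCompactSupport.fderiv_apply (𝕜 := ℝ) _
  have hfe : Continuous fun x => ∑ l, e l • partialDeriv l f x :=
    continuous_finsetSum _ fun l _ => ((contDiff_partialDeriv hf l).const_smul (e l)).continuous
  have hi1 : Integrable (fun x => ψ x • (partialDeriv i f x -
      conormal e γ i x • ∑ l, e l • partialDeriv l f x)) (graphMeasure e γ) :=
    integrable_graphMeasure hγc (hψ.contDiff.continuous.smul
      ((contDiff_partialDeriv hf i).continuous.sub (hνc.smul hfe)))
      hψ.hasCompactSupport.smul_right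
  have hi2 : Integrable (fun x => (partialDeriv i ψ x - conormal e γ i x * fderiv ℝ ψ x e) • f x)
      (graphMeasure e γ) := by
    have hc : Continuous fun x => partialDeriv i ψ x - conormal e γ i x * fderiv ℝ ψ x e :=
      hψi.contDiff.continuous.sub (hνc.mul hψe)
    have hs : HasCompactSupport fun x => partialDeriv i ψ x - conormal e γ i x * fderiv ℝ ψ x e :=
      HasCompactSupport.sub hψi.hasCompactSupport
        (HasCompactSupport.mul_left (f := fun x => conormal e γ i x) hψec)
    exact integrable_graphMeasure hγc (hc.smul hf.continuous) hs.smul_right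
  have hi3 : Integrable (partialDeriv i (fun x => ψ x • f x)) (graphMeasure e γ) :=
    integrable_graphMeasure hγc hFi.contDiff.continuous hFi.hasCompactSupport
  have hi4 : Integrable (fun x => conormal e γ i x • fderiv ℝ (fun x => ψ x • f x) x e)
      (graphMeasure e γ) :=
    integrable_graphMeasure hγc (hνc.smul hFe.continuous)
      (HasCompactSupport.smul_left (f := fun x => conormal e γ i x) hFec)
  rw [eq_neg_iff_add_eq_zero, ← integral_add hi1 hi2]
  rw [← sub_eq_zero, ← integral_sub hi3 hi4] at h3
  rw [← h3]
  congr 1 with x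
  rw [partialDeriv_smul (hdψ x) (hdf x), fderiv_fun_smul (hdψ x) (hdf x),
    ← fderiv_apply_eq_sum f x e]
  simp only [add_apply, smul_apply,
    ContinuousLinearMap.smulRight_apply, Complex.real_smul]
  push_cast
  ring

end Rellich

/-! ### Traces of the gradient -/

section Trace

variable {d : ℕ} {Ω : Set (EuclideanSpace ℝ (Fin d))} {δ : ℝ} {ι : Type} [Fintype ι]

lemma partialDeriv_sub {F : Type*} [NormedAddCommGroup F] [NormedSpace ℝ F]
    {φ ψ : EuclideanSpace ℝ (Fin d) → F} {x : EuclideanSpace ℝ (Fin d)}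
    (hφ : DifferentiableAt ℝ φ x) (hψ : DifferentiableAt ℝ ψ x) (i : Fin d) :
    partialDeriv i (fun y => φ y - ψ y) x = partialDeriv i φ x - partialDeriv i ψ x := by
  rw [partialDeriv, fderiv_fun_sub hφ hψ]
  rfl

namespace BoundaryAtlas

/-- Sequences of smooth functions that are close in `H¹(Ω)` have close boundary values. -/
lemma tendsto_surfaceMeasure (A : BoundaryAtlas Ω δ ι) (hΩ : IsOpen Ω)
    (hb : Bornology.IsBounded Ω) {φ ψ : ℕ → EuclideanSpace ℝ (Fin d) → ℂ}
    {f w : EuclideanSpace ℝ (Fin d) → ℂ} {G : Fin d → EuclideanSpace ℝ (Fin d) → ℂ}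
    (hφ : ∀ k, ContDiff ℝ ∞ (φ k)) (hψ : ∀ k, ContDiff ℝ ∞ (ψ k))
    (hφf : L2Tendsto (volume.restrict Ω) φ f)
    (hφG : ∀ i, L2Tendsto (volume.restrict Ω) (fun k => partialDeriv i (φ k)) (G i))
    (hψf : L2Tendsto (volume.restrict Ω) ψ f)
    (hψG : ∀ i, L2Tendsto (volume.restrict Ω) (fun k => partialDeriv i (ψ k)) (G i))
    (hφw : L2Tendsto (surfaceMeasure Ω) φ w) : L2Tendsto (surfaceMeasure Ω) ψ w := by
  have := A.isFiniteMeasure_surfaceMeasure hΩ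
  obtain ⟨C, hC0, hC⟩ := A.exists_trace_le hΩ hb
  have hsub : L2Tendsto (surfaceMeasure Ω) (fun k x => φ k x - ψ k x) (fun _ => 0) := by
    refine L2Tendsto.of_integral_norm_sq
      (fun k => memLp_surfaceMeasure hb ((hφ k).continuous.sub (hψ k).continuous) 2)
      MemLp.zero ?_
    have h1 := ((hφf.sub hψf).integral_norm_sq.add (tendsto_finsetSum Finset.univ fun i _ =>
      ((hφG i).sub (hψG i)).integral_norm_sq)).const_mul C
    simp only [sub_self, norm_zero, ne_eq, OfNat.ofNat_ne_zero, not_false_eq_true, zero_pow,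
      integral_zero, Finset.sum_const_zero, add_zero, mul_zero] at h1
    refine squeeze_zero (fun k => integral_nonneg fun x => by positivity) (fun k => ?_) h1
    have h2 := hC (fun x => φ k x - ψ k x) (((hφ k).sub (hψ k)).of_le (by simp))
    simp_rw [fun i x => partialDeriv_sub (((hφ k).differentiable (by simp)) x)
      (((hψ k).differentiable (by simp)) x) i] at h2
    simpa using h2
  refine (hφw.sub hsub).congr (fun k => Eventually.of_forall fun x => ?_)
    (Eventually.of_forall fun x => ?_)
  · simp
  · simp

/-- Smooth functions that converge in `H¹(Ω)` have convergent boundary values. -/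
lemma exists_tendsto_surfaceMeasure (A : BoundaryAtlas Ω δ ι) (hΩ : IsOpen Ω)
    (hb : Bornology.IsBounded Ω) {φ : ℕ → EuclideanSpace ℝ (Fin d) → ℂ}
    {f : EuclideanSpace ℝ (Fin d) → ℂ} {G : Fin d → EuclideanSpace ℝ (Fin d) → ℂ}
    (hφ : ∀ k, ContDiff ℝ ∞ (φ k))
    (hφf : L2Tendsto (volume.restrict Ω) φ f)
    (hφG : ∀ i, L2Tendsto (volume.restrict Ω) (fun k => partialDeriv i (φ k)) (G i)) :
    ∃ w, L2Tendsto (surfaceMeasure Ω) φ w := by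
  have := A.isFiniteMeasure_surfaceMeasure hΩ
  obtain ⟨C, hC0, hC⟩ := A.exists_trace_le hΩ hb
  have hm : ∀ k, MemLp (φ k) 2 (surfaceMeasure Ω) := fun k =>
    memLp_surfaceMeasure hb (hφ k).continuous 2
  have hb0 := ((hφf.tendsto_integral_norm_sub_sq).add (tendsto_finsetSum Finset.univ fun i _ =>
    (hφG i).tendsto_integral_norm_sub_sq)).const_mul (2 * C)
  simp only [Finset.sum_const_zero, add_zero, mul_zero] at hb0
  -- the squared distances of the boundary values are dominated by distances in `H¹(Ω)`
  have hdist : ∀ k l, dist ((hm k).toLp (φ k)) ((hm l).toLp (φ l)) ^ 2 ≤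
      2 * C * ((∫ x in Ω, ‖φ k x - f x‖ ^ 2) + ∑ i, ∫ x in Ω, ‖partialDeriv i (φ k) x - G i x‖ ^ 2) +
      2 * C * ((∫ x in Ω, ‖φ l x - f x‖ ^ 2) +
        ∑ i, ∫ x in Ω, ‖partialDeriv i (φ l) x - G i x‖ ^ 2) := by
    intro k l
    have h1 : dist ((hm k).toLp (φ k)) ((hm l).toLp (φ l)) ^ 2 =
        ∫ x, ‖φ k x - φ l x‖ ^ 2 ∂surfaceMeasure Ω := by
      rw [dist_eq_norm, ← MemLp.toLp_sub, Lp.norm_toLp, ← ENNReal.toReal_pow,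
        eLpNorm_two_sq ((hm k).sub (hm l)), ENNReal.toReal_ofReal
        (integral_nonneg fun x => by positivity)]
      rfl
    have hsq : ∀ {a b g : EuclideanSpace ℝ (Fin d) → ℂ}, MemLp a 2 (volume.restrict Ω) →
        MemLp b 2 (volume.restrict Ω) → MemLp g 2 (volume.restrict Ω) →
        ∫ x in Ω, ‖a x - b x‖ ^ 2 ≤ 2 * (∫ x in Ω, ‖a x - g x‖ ^ 2) +
          2 * ∫ x in Ω, ‖b x - g x‖ ^ 2 := by
      intro a b g ha hb hg
      have hi : ∀ {a b : EuclideanSpace ℝ (Fin d) → ℂ}, MemLp a 2 (volume.restrict Ω) →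
        MemLp b 2 (volume.restrict Ω) →
        Integrable (fun x => ‖a x - b x‖ ^ 2) (volume.restrict Ω) := fun ha hb =>
          (ha.sub hb).integrable_norm_pow (by norm_num)
      rw [← integral_const_mul, ← integral_const_mul,
        ← integral_add ((hi ha hg).const_mul 2) ((hi hb hg).const_mul 2)]
      refine integral_mono (hi ha hb) (((hi ha hg).const_mul 2).add ((hi hb hg).const_mul 2))
        fun x => ?_
      have h2 := norm_sub_le (a x - g x) (b x - g x)
      rw [sub_sub_sub_cancel_right] at h2
      have h3 : ‖a x - b x‖ ^ 2 ≤ (‖a x - g x‖ + ‖b x - g x‖) ^ 2 := by gcongr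
      dsimp only [Pi.add_apply]
      nlinarith [sq_nonneg (‖a x - g x‖ - ‖b x - g x‖)]
    have h2 := hC (fun x => φ k x - φ l x) (((hφ k).sub (hφ l)).of_le (by simp))
    simp_rw [fun i x => partialDeriv_sub (((hφ k).differentiable (by simp)) x)
      (((hφ l).differentiable (by simp)) x) i] at h2
    rw [h1]
    refine h2.trans ?_
    have h3 := hsq (hφf.memLp k) (hφf.memLp l) hφf.memLp_limit
    have h4 := Finset.sum_le_sum fun i (_ : i ∈ Finset.univ) =>
      hsq ((hφG i).memLp k) ((hφG i).memLp l) (hφG i).memLp_limit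
    rw [Finset.sum_add_distrib, ← Finset.mul_sum, ← Finset.mul_sum] at h4
    calc _ ≤ C * _ := mul_le_mul_of_nonneg_left (add_le_add h3 h4) hC0
      _ = _ := by ring
  have hcau : CauchySeq fun k => (hm k).toLp (φ k) := by
    refine Metric.cauchySeq_iff.2 fun ε hε => ?_
    obtain ⟨N, hN⟩ := eventually_atTop.1 (hb0.eventually_lt_const
      (show (0 : ℝ) < ε ^ 2 / 2 by positivity))
    refine ⟨N, fun k hk l hl => ?_⟩
    have h1 := hdist k l
    have h2 := hN k hk
    have h3 := hN l hl
    exact lt_of_pow_lt_pow_left₀ 2 hε.le (by linarith)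
  obtain ⟨w, hw⟩ := cauchySeq_tendsto_of_complete hcau
  refine ⟨w, hm, Lp.memLp w, ?_⟩
  have h1 := (Lp.tendsto_Lp_iff_tendsto_eLpNorm' _ _).1 hw
  refine h1.congr fun k => eLpNorm_congr_ae ?_
  filter_upwards [(hm k).coeFn_toLp] with x hx
  rw [Pi.sub_apply, hx]

/-- For functions whose boundary values tend to zero, the tangential part of the gradient tends to
zero on the boundary. -/
lemma tendsto_tangential (A : BoundaryAtlas Ω δ ι) (hΩ : IsOpen Ω)
    {φ : ℕ → EuclideanSpace ℝ (Fin d) → ℂ}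
    {w : Fin d → EuclideanSpace ℝ (Fin d) → ℂ} (hφ : ∀ k, ContDiff ℝ ∞ (φ k))
    (hφ0 : L2Tendsto (surfaceMeasure Ω) φ (fun _ => 0))
    (hw : ∀ i, L2Tendsto (surfaceMeasure Ω) (fun k => partialDeriv i (φ k)) (w i)) (j : ι)
    (i : Fin d) :
    Tendsto (fun k => ∫ x, A.χ j x * ‖partialDeriv i (φ k) x -
      conormal (A.e j) (A.γ j) i x • ∑ l, A.e j l • partialDeriv l (φ k) x‖ ^ 2
      ∂graphMeasure (A.e j) (A.γ j)) atTop (𝓝 0) := by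
  have := A.isFiniteMeasure_surfaceMeasure hΩ
  set μ := (graphMeasure (A.e j) (A.γ j)).restrict (Metric.ball (A.x j) (A.r j)) with hμ
  have hle : μ ≤ surfaceMeasure Ω := (A.chart j).graphMeasure_restrict_le
  have : IsFiniteMeasure μ := isFiniteMeasure_of_le _ hle
  have hνc := (contDiff_conormal (e := A.e j) (A.chart j).contDiff i).continuous
  have hνt : MemLp (fun x => (conormal (A.e j) (A.γ j) i x : ℂ)) ⊤ μ := by
    obtain ⟨B, hB⟩ := (isCompact_closedBall (A.x j) (A.r j)).exists_bound_of_continuousOn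
      hνc.continuousOn
    refine memLp_top_of_bound (Complex.continuous_ofReal.comp hνc).aestronglyMeasurable B ?_
    filter_upwards [ae_restrict_mem measurableSet_ball] with x hx
    simpa using hB x (Metric.ball_subset_closedBall hx)
  have hT : L2Tendsto μ (fun k x => partialDeriv i (φ k) x -
      conormal (A.e j) (A.γ j) i x • ∑ l, A.e j l • partialDeriv l (φ k) x)
      (fun x => w i x - conormal (A.e j) (A.γ j) i x • ∑ l, A.e j l • w l x) := by
    have h1 := ((hw i).mono_measure hle).sub ((L2Tendsto.sum Finset.univ fun l _ =>
      ((hw l).mono_measure hle).const_mul (A.e j l : ℂ)).mul_top hνt)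
    refine h1.congr (fun k => Eventually.of_forall fun x => ?_)
      (Eventually.of_forall fun x => ?_) <;> simp
  have hball : ∀ {F : Type} [NormedAddCommGroup F] [NormedSpace ℝ F]
      {ψ : EuclideanSpace ℝ (Fin d) → F}, (∀ x ∉ Metric.ball (A.x j) (A.r j), ψ x = 0) →
      ∫ x, ψ x ∂graphMeasure (A.e j) (A.γ j) = ∫ x, ψ x ∂μ := fun hψ =>
    (setIntegral_eq_integral_of_forall_compl_eq_zero hψ).symm
  -- the limit of the tangential parts vanishes, since its pairings with test functions do
  have hT0 : (fun x => w i x - conormal (A.e j) (A.γ j) i x • ∑ l, A.e j l • w l x) =ᵐ[μ]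
      fun _ => 0 := by
    have h0 := Metric.isOpen_ball.ae_eq_zero_of_integral_contDiff_smul_eq_zero
      (U := Metric.ball (A.x j) (A.r j)) (μ := μ)
      ((hT.memLp_limit.integrable (by norm_num)).locallyIntegrable.locallyIntegrableOn _)
      fun ψ hψ hψs hψb => by
        have ht : IsTestFunction (Metric.ball (A.x j) (A.r j)) ψ := ⟨hψ, hψs, hψb⟩
        have hbd : MemLp (fun x => ((partialDeriv i ψ x -
            conormal (A.e j) (A.γ j) i x * fderiv ℝ ψ x (A.e j) : ℝ) : ℂ)) 2 μ := by
          have hc : Continuous fun x => partialDeriv i ψ x -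
              conormal (A.e j) (A.γ j) i x * fderiv ℝ ψ x (A.e j) :=
            (isTestFunction_partialDeriv ht i).contDiff.continuous.sub (hνc.mul
              ((hψ.fderiv_right (m := ∞) (by simp)).clm_apply contDiff_const).continuous)
          have hs : HasCompactSupport fun x => partialDeriv i ψ x -
              conormal (A.e j) (A.γ j) i x * fderiv ℝ ψ x (A.e j) :=
            HasCompactSupport.sub (isTestFunction_partialDeriv ht i).hasCompactSupport
              (HasCompactSupport.mul_left (f := fun x => conormal (A.e j) (A.γ j) i x)
                (hψs.fderiv_apply (𝕜 := ℝ) _))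
          exact (memLp_top_ofReal hc hs μ).mono_exponent le_top
        have hlim1 := (L2Tendsto.const (ht.ofReal.memLp μ 2)).integral_mul hT
        have hlim2 := ((L2Tendsto.const hbd).integral_mul (hφ0.mono_measure hle)).neg
        have heq : ∀ k, ∫ x, (ψ x : ℂ) * (partialDeriv i (φ k) x -
            conormal (A.e j) (A.γ j) i x • ∑ l, A.e j l • partialDeriv l (φ k) x) ∂μ =
            -∫ x, ((partialDeriv i ψ x -
              conormal (A.e j) (A.γ j) i x * fderiv ℝ ψ x (A.e j) : ℝ) : ℂ) * φ k x ∂μ := by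
          intro k
          have h1 := (A.chart j).integral_tangential hΩ.measurableSet ht (hφ k) i
          rw [hball fun x hx => ?_, hball fun x hx => ?_] at h1
          · simpa only [Complex.real_smul] using h1
          · have h2 : x ∉ tsupport (partialDeriv i ψ) := fun h =>
              hx (hψb (tsupport_partialDeriv_subset ψ i h))
            rw [image_eq_zero_of_notMem_tsupport h2, fderiv_eq_zero_of_tsupport_subset hψb hx]
            simp
          · have h2 : x ∉ tsupport ψ := fun h => hx (hψb h)
            rw [image_eq_zero_of_notMem_tsupport h2, zero_smul]
        have h1 := tendsto_nhds_unique (hlim1.congr heq) hlim2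
        simpa only [Complex.real_smul, mul_zero, integral_zero, neg_zero] using h1
    rw [hμ] at h0 ⊢
    filter_upwards [h0, ae_restrict_mem measurableSet_ball] with x hx hxb using hx hxb
  have hsq := (hT.congr (fun k => .rfl) hT0).integral_norm_sq
  obtain ⟨B, hB⟩ := (A.test j).contDiff.continuous.bounded_above_of_compact_support
    (A.test j).hasCompactSupport
  have hB0 : 0 ≤ B := (norm_nonneg _).trans (hB 0)
  have h1 := hsq.const_mul B
  simp only [norm_zero, ne_eq, OfNat.ofNat_ne_zero, not_false_eq_true, zero_pow,
    integral_zero, mul_zero] at h1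
  refine squeeze_zero (fun k => integral_nonneg fun x => mul_nonneg (A.nonneg j x)
    (by positivity)) (fun k => ?_) h1
  rw [hball fun x hx => ?_, ← integral_const_mul]
  · refine integral_mono_of_nonneg (Eventually.of_forall fun x => mul_nonneg (A.nonneg j x)
      (by positivity)) (((hT.memLp k).integrable_norm_pow (by norm_num)).const_mul B)
      (Eventually.of_forall fun x => ?_)
    have h2 := hB x
    rw [Real.norm_of_nonneg (A.nonneg j x)] at h2
    exact mul_le_mul_of_nonneg_right h2 (by positivity)
  · have h2 : x ∉ tsupport (A.χ j) := fun h => hx ((A.test j).tsupport_subset h)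
    rw [image_eq_zero_of_notMem_tsupport h2, zero_mul]

/-- The Rellich estimate for functions in `H²(Ω)` that vanish on the boundary, stated for a smooth
approximating sequence. The tangential part of the gradient drops out in the limit. -/
theorem exists_sum_trace_sq_le (A : BoundaryAtlas Ω δ ι) (hΩ : IsOpen Ω)
    (hb : Bornology.IsBounded Ω) :
    ∃ K C : ℝ, 0 ≤ K ∧ 0 ≤ C ∧ ∀ (φ : ℕ → EuclideanSpace ℝ (Fin d) → ℂ)
      (G w : Fin d → EuclideanSpace ℝ (Fin d) → ℂ)
      (H : Fin d → Fin d → EuclideanSpace ℝ (Fin d) → ℂ), (∀ k, ContDiff ℝ ∞ (φ k)) →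
      L2Tendsto (surfaceMeasure Ω) φ (fun _ => 0) →
      (∀ i, L2Tendsto (volume.restrict Ω) (fun k => partialDeriv i (φ k)) (G i)) →
      (∀ i l, L2Tendsto (volume.restrict Ω)
        (fun k => partialDeriv l (partialDeriv i (φ k))) (H i l)) →
      (∀ i, L2Tendsto (surfaceMeasure Ω) (fun k => partialDeriv i (φ k)) (w i)) →
      ∑ i, ∫ x, ‖w i x‖ ^ 2 ∂surfaceMeasure Ω ≤
        K * ∑ j, (-4 * (∫ x in Ω, (A.χ j x : ℂ) * (starRingEnd ℂ) (∑ i, H i i x) *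
          ∑ l, (A.e j l : ℂ) * G l x).re) + C * ∑ i, ∫ x in Ω, ‖G i x‖ ^ 2 := by
  have := A.isFiniteMeasure_surfaceMeasure hΩ
  have := isFiniteMeasure_restrict hb
  have hm := hΩ.measurableSet
  obtain ⟨K, hK0, hK⟩ := A.exists_integral_surfaceMeasure_le hΩ hb
  choose C hC0 hC using fun j => (A.chart j).exists_rellich_le hm hb (A.test j) (A.nonneg j)
  refine ⟨K, K * ∑ j, C j, hK0, mul_nonneg hK0 (Finset.sum_nonneg fun j _ => hC0 j), ?_⟩
  intro φ G w H hφ hφ0 hG hH hw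
  have hχt := fun j => memLp_top_ofReal (A.test j).contDiff.continuous
    (A.test j).hasCompactSupport (volume.restrict Ω)
  have hlapl : ∀ j, L2Tendsto (volume.restrict Ω) (fun k x => (A.χ j x : ℂ) *
      (starRingEnd ℂ) (∑ i, partialDeriv i (partialDeriv i (φ k)) x))
      (fun x => (A.χ j x : ℂ) * (starRingEnd ℂ) (∑ i, H i i x)) := fun j =>
    ((L2Tendsto.sum Finset.univ fun i _ => hH i i).conj).mul_top (hχt j)
  have hdir : ∀ j, L2Tendsto (volume.restrict Ω)
      (fun k x => ∑ l, (A.e j l : ℂ) * partialDeriv l (φ k) x)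
      (fun x => ∑ l, (A.e j l : ℂ) * G l x) := fun j =>
    L2Tendsto.sum Finset.univ fun l _ => (hG l).const_mul _
  have hmain : ∀ j, Tendsto (fun k => ∫ x in Ω, A.χ j x *
      inner ℝ (∑ i, partialDeriv i (partialDeriv i (φ k)) x)
        (∑ l, A.e j l • partialDeriv l (φ k) x)) atTop
      (𝓝 (∫ x in Ω, (A.χ j x : ℂ) * (starRingEnd ℂ) (∑ i, H i i x) *
          ∑ l, (A.e j l : ℂ) * G l x).re) := by
    intro j
    have h1 := (Complex.continuous_re.tendsto _).comp ((hlapl j).integral_mul (hdir j))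
    refine h1.congr fun k => ?_
    have hi := integrable_mul_of_memLp ((hlapl j).memLp k) ((hdir j).memLp k)
    refine (integral_re hi).symm.trans ?_
    congr 1 with x
    rw [Complex.inner, mul_assoc, mul_comm (∑ l, A.e j l • partialDeriv l (φ k) x)]
    simp only [Complex.real_smul]
    exact Complex.re_ofReal_mul _ _
  have hgsq := fun i => (hG i).integral_norm_sq
  have hlhs := tendsto_finsetSum Finset.univ fun i _ => (hw i).integral_norm_sq
  have hrhs := ((tendsto_finsetSum Finset.univ fun j _ => (((hmain j).const_mul (-4)).add
    ((tendsto_finsetSum Finset.univ fun i _ => hgsq i).const_mul (C j))).add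
    ((tendsto_finsetSum Finset.univ fun i _ =>
      A.tendsto_tangential hΩ hφ hφ0 hw j i).const_mul 4))).const_mul K
  refine (le_of_tendsto_of_tendsto' hlhs hrhs fun k => ?_).trans_eq ?_
  · have hsq : ∀ i, Integrable (fun x => ‖partialDeriv i (φ k) x‖ ^ 2) (surfaceMeasure Ω) :=
      fun i => ((hw i).memLp k).integrable_norm_pow (by norm_num)
    rw [← integral_finsetSum _ fun i _ => hsq i]
    refine (hK _ (continuous_finsetSum _ fun i _ =>
      (contDiff_partialDeriv (hφ k) i).continuous.norm.pow 2)
      fun x => Finset.sum_nonneg fun i _ => sq_nonneg _).trans ?_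
    exact mul_le_mul_of_nonneg_left (Finset.sum_le_sum fun j _ => hC j (φ k) (hφ k)) hK0
  · simp only [Finset.sum_const_zero, mul_zero, add_zero]
    rw [Finset.sum_add_distrib, ← Finset.sum_mul]
    ring

end BoundaryAtlas

end Trace

/-! ### The interior terms of the Rellich estimate -/

section Interior

variable {d : ℕ} {S Ω : Set (EuclideanSpace ℝ (Fin d))}

/-- `c` and `n` are bounded functions in `S` with bounded weak partial derivatives `c'` and `n'`,
and `c` is bounded away from zero. -/
structure BoundedCoefficients {d : ℕ} (S : Set (EuclideanSpace ℝ (Fin d)))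
    (c n : EuclideanSpace ℝ (Fin d) → ℝ) (c' n' : Fin d → EuclideanSpace ℝ (Fin d) → ℝ)
    (b₀ M L : ℝ) : Prop where
  pos : 0 < b₀
  nonneg_M : 0 ≤ M
  nonneg_L : 0 ≤ L
  memLp_c : MemLp c ⊤ (volume.restrict S)
  memLp_n : MemLp n ⊤ (volume.restrict S)
  memLp_c' : ∀ i, MemLp (c' i) ⊤ (volume.restrict S)
  weak_c : ∀ i, HasWeakPartial S i c (c' i)
  weak_n : ∀ i, HasWeakPartial S i n (n' i)
  le_c : ∀ᵐ x ∂(volume.restrict S), b₀ ≤ c x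
  n_le : ∀ᵐ x ∂(volume.restrict S), |n x| ≤ M
  c'_le : ∀ i, ∀ᵐ x ∂(volume.restrict S), |c' i x| ≤ L
  n'_le : ∀ i, ∀ᵐ x ∂(volume.restrict S), |n' i x| ≤ L

lemma norm_integral_mul_mul_le {α : Type*} {m0 : MeasurableSpace α} {μ : Measure α}
    {m f g : α → ℂ} {B : ℝ} (hB : 0 ≤ B) (hm : MemLp m ⊤ μ) (hmB : ∀ᵐ x ∂μ, ‖m x‖ ≤ B)
    (hf : MemLp f 2 μ) (hg : MemLp g 2 μ) :
    ‖∫ x, m x * f x * g x ∂μ‖ ≤ B * √(∫ x, ‖f x‖ ^ 2 ∂μ) * √(∫ x, ‖g x‖ ^ 2 ∂μ) := by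
  have hmf : MemLp (fun x => m x * f x) 2 μ := hf.mul' hm
  refine (norm_integral_mul_le hmf hg).trans ?_
  gcongr
  rw [← Real.sqrt_sq hB, ← Real.sqrt_mul (sq_nonneg B), ← integral_const_mul]
  refine Real.sqrt_le_sqrt (integral_mono_ae (hmf.integrable_norm_pow (by norm_num))
    ((hf.integrable_norm_pow (by norm_num)).const_mul _) ?_)
  filter_upwards [hmB] with x hx
  rw [norm_mul, mul_pow]
  gcongr

lemma sqrt_setIntegral_norm_sq_le (hS : S ⊆ Ω) {f : EuclideanSpace ℝ (Fin d) → ℂ}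
    (hf : MemLp f 2 (volume.restrict Ω)) :
    √(∫ x in S, ‖f x‖ ^ 2) ≤ √(∫ x in Ω, ‖f x‖ ^ 2) :=
  Real.sqrt_le_sqrt (setIntegral_mono_set (hf.integrable_norm_pow (by norm_num))
    (Eventually.of_forall fun x => by positivity) hS.eventuallyLE)

lemma partialDeriv_norm_sq {w : EuclideanSpace ℝ (Fin d) → ℂ} {x : EuclideanSpace ℝ (Fin d)}
    (hw : DifferentiableAt ℝ w x) (i : Fin d) :
    partialDeriv i (fun y => ‖w y‖ ^ 2) x = 2 * ((starRingEnd ℂ) (w x) * partialDeriv i w x).re := by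
  simp_rw [← real_inner_self_eq_norm_sq]
  rw [partialDeriv_inner hw hw, real_inner_comm (w x), Complex.inner, mul_comm (partialDeriv i w x)]
  ring

section

variable {c n : EuclideanSpace ℝ (Fin d) → ℝ} {c' n' : Fin d → EuclideanSpace ℝ (Fin d) → ℝ}
  {b₀ M L : ℝ} {χ : EuclideanSpace ℝ (Fin d) → ℝ} {e : EuclideanSpace ℝ (Fin d)}
  {U : Set (EuclideanSpace ℝ (Fin d))}

/-- Since `2 Re (w̄ ∂w) = ∂|w|²`, the pairing of `w` with its derivative is of order zero. -/
lemma BoundedCoefficients.exists_abs_re_le (h : BoundedCoefficients S c n c' n' b₀ M L)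
    (hS : IsOpen S) (hb : Bornology.IsBounded S) (hχ : IsTestFunction U χ)
    (hU : U ∩ Ω ⊆ S) (he : ‖e‖ = 1) :
    ∃ C : ℝ, 0 ≤ C ∧ ∀ w : EuclideanSpace ℝ (Fin d) → ℂ, IsComplexTest Ω w →
      |(∫ x in S, ((χ x : ℂ) * (n x : ℂ) * (c x : ℂ)⁻¹) * (starRingEnd ℂ) (w x) *
        ∑ l, (e l : ℂ) * partialDeriv l w x).re| ≤ C * ∫ x in S, ‖w x‖ ^ 2 := by
  have := isFiniteMeasure_restrict hb
  have hχd := fun i => isTestFunction_partialDeriv hχ i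
  obtain ⟨B, hB⟩ := hχ.contDiff.continuous.bounded_above_of_compact_support hχ.hasCompactSupport
  choose B' hB' using fun i =>
    (hχd i).contDiff.continuous.bounded_above_of_compact_support (hχd i).hasCompactSupport
  have hB0 : 0 ≤ B := (norm_nonneg _).trans (hB 0)
  have hB0' : ∀ i, 0 ≤ B' i := fun i => (norm_nonneg _).trans (hB' i 0)
  have hM := h.nonneg_M
  have hL := h.nonneg_L
  have hb₀ := h.pos
  refine ⟨∑ l : Fin d, ((L * b₀⁻¹ + M * L * b₀⁻¹ ^ 2) * B + M * B' l * b₀⁻¹),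
    Finset.sum_nonneg fun l _ => by have := hB0' l; positivity, fun w hw => ?_⟩
  have hwd : ∀ x, DifferentiableAt ℝ w x := fun x => (hw.contDiff.differentiable (by simp)) x
  have hsm : ContDiff ℝ ∞ fun x => ‖w x‖ ^ 2 := hw.contDiff.norm_sq ℝ
  have hφ : IsTestFunction S (fun x => χ x • ‖w x‖ ^ 2) := by
    refine ⟨hχ.contDiff.smul hsm, hχ.hasCompactSupport.smul_right, fun x hx => hU ⟨?_, ?_⟩⟩
    · exact hχ.tsupport_subset (closure_mono (Function.support_smul_subset_left χ _) hx)
    · refine hw.tsupport_subset (closure_mono (fun y hy => ?_) hx)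
      exact fun hy0 => hy (by simp [hy0])
  have hwi : Integrable (fun x => ‖w x‖ ^ 2) (volume.restrict S) :=
    (hw.memLp _ 2).integrable_norm_pow (by norm_num)
  have hinv := memLp_top_inv hb₀ h.memLp_c.1 h.le_c
  have hnt := memLp_ofReal h.memLp_n
  have hreal : ∀ {ψ : EuclideanSpace ℝ (Fin d) → ℝ}, Continuous ψ → HasCompactSupport ψ →
      Integrable (fun x => (n x : ℂ) * (ψ x : ℂ) * (c x : ℂ)⁻¹) (volume.restrict S) := by
    intro ψ hψ hψs
    have h1 : MemLp (fun x => (ψ x : ℂ)) 1 (volume.restrict S) :=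
      (memLp_top_ofReal hψ hψs _).mono_exponent le_top
    have h2 : MemLp (fun x => (n x : ℂ) * (ψ x : ℂ)) 1 (volume.restrict S) := h1.mul' hnt
    exact memLp_one_iff_integrable.1 (hinv.mul' h2)
  have hterm : ∀ l, |(∫ x in S, (n x : ℂ) * ((χ x * (2 * ((starRingEnd ℂ) (w x) *
      partialDeriv l w x).re) : ℝ) : ℂ) * (c x : ℂ)⁻¹).re| ≤
      ((L * b₀⁻¹ + M * L * b₀⁻¹ ^ 2) * B + M * B' l * b₀⁻¹) * ∫ x in S, ‖w x‖ ^ 2 := by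
    intro l
    have h1 := norm_setIntegral_div_mul_partialDeriv_le hS hb h.pos h.memLp_c h.weak_c h.le_c
      h.nonneg_L h.c'_le h.memLp_n h.weak_n h.nonneg_M h.n_le h.n'_le hφ l
    have h2 : ∀ x, partialDeriv l (fun x => χ x • ‖w x‖ ^ 2) x = partialDeriv l χ x * ‖w x‖ ^ 2 +
        χ x * (2 * ((starRingEnd ℂ) (w x) * partialDeriv l w x).re) := fun x => by
      rw [partialDeriv_smul ((hχ.contDiff.differentiable (by simp)) x)
        ((hsm.differentiable (by simp)) x), partialDeriv_norm_sq (hwd x)]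
      rfl
    have hc2 : Continuous fun x => partialDeriv l χ x * ‖w x‖ ^ 2 :=
      (hχd l).contDiff.continuous.mul hsm.continuous
    have hs2 : HasCompactSupport fun x => partialDeriv l χ x * ‖w x‖ ^ 2 :=
      (hχd l).hasCompactSupport.mul_right
    have hi2 := hreal hc2 hs2
    have hi1 : Integrable (fun x => (n x : ℂ) *
        ((partialDeriv l (fun x => χ x • ‖w x‖ ^ 2) x : ℝ) : ℂ) * (c x : ℂ)⁻¹)
        (volume.restrict S) :=
      hreal (isTestFunction_partialDeriv hφ l).contDiff.continuous
        (isTestFunction_partialDeriv hφ l).hasCompactSupport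
    have h3 : ∫ x in S, (n x : ℂ) * ((χ x * (2 * ((starRingEnd ℂ) (w x) *
        partialDeriv l w x).re) : ℝ) : ℂ) * (c x : ℂ)⁻¹ =
        (∫ x in S, (n x : ℂ) * ((partialDeriv l (fun x => χ x • ‖w x‖ ^ 2) x : ℝ) : ℂ) *
          (c x : ℂ)⁻¹) -
        ∫ x in S, (n x : ℂ) * ((partialDeriv l χ x * ‖w x‖ ^ 2 : ℝ) : ℂ) * (c x : ℂ)⁻¹ := by
      rw [← integral_sub hi1 hi2]
      congr 1 with x
      rw [h2]
      push_cast
      ring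
    have h4 : ∫ x in S, |χ x • ‖w x‖ ^ 2| ≤ B * ∫ x in S, ‖w x‖ ^ 2 := by
      rw [← integral_const_mul]
      refine integral_mono_of_nonneg (Eventually.of_forall fun x => abs_nonneg _)
        (hwi.const_mul B) (Eventually.of_forall fun x => ?_)
      dsimp only
      rw [smul_eq_mul, abs_mul, abs_of_nonneg (sq_nonneg ‖w x‖)]
      exact mul_le_mul_of_nonneg_right (hB x) (sq_nonneg _)
    have h5 : ‖∫ x in S, (n x : ℂ) * ((partialDeriv l χ x * ‖w x‖ ^ 2 : ℝ) : ℂ) * (c x : ℂ)⁻¹‖ ≤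
        M * B' l * b₀⁻¹ * ∫ x in S, ‖w x‖ ^ 2 := by
      rw [← integral_const_mul]
      refine norm_integral_le_of_norm_le (hwi.const_mul _) ?_
      filter_upwards [h.n_le, h.le_c] with x hx1 hx2
      rw [norm_mul, norm_mul, Complex.norm_real, Complex.norm_real, norm_mul, norm_pow, norm_norm]
      have h6 := hB' l x
      have h7 := norm_ofReal_inv_le hb₀ hx2
      have h8 : ‖n x‖ ≤ M := hx1
      have h9 := hB0' l
      calc ‖n x‖ * (‖partialDeriv l χ x‖ * ‖w x‖ ^ 2) * ‖(c x : ℂ)⁻¹‖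
          ≤ M * (B' l * ‖w x‖ ^ 2) * b₀⁻¹ := by gcongr
        _ = _ := by ring
    refine (Complex.abs_re_le_norm _).trans ?_
    rw [h3]
    refine (norm_sub_le _ _).trans ?_
    rw [add_mul, mul_assoc _ B]
    refine add_le_add (h1.trans (mul_le_mul_of_nonneg_left h4 ?_)) h5
    positivity
  have hsplit : (∫ x in S, ((χ x : ℂ) * (n x : ℂ) * (c x : ℂ)⁻¹) * (starRingEnd ℂ) (w x) *
        ∑ l, (e l : ℂ) * partialDeriv l w x).re =
      ∑ l, (e l / 2) * (∫ x in S, (n x : ℂ) * ((χ x * (2 * ((starRingEnd ℂ) (w x) *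
        partialDeriv l w x).re) : ℝ) : ℂ) * (c x : ℂ)⁻¹).re := by
    have hi1 : ∀ l, Integrable (fun x => (n x : ℂ) * ((χ x * (2 * ((starRingEnd ℂ) (w x) *
        partialDeriv l w x).re) : ℝ) : ℂ) * (c x : ℂ)⁻¹) (volume.restrict S) := fun l =>
      hreal (hχ.contDiff.continuous.mul (continuous_const.mul (Complex.continuous_re.comp
        (hw.conj.contDiff.continuous.mul (hw.partialDeriv' l).contDiff.continuous))))
        hχ.hasCompactSupport.mul_right
    have hm : MemLp (fun x => (χ x : ℂ) * (n x : ℂ) * (c x : ℂ)⁻¹) ⊤ (volume.restrict S) :=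
      hinv.mul' (hnt.mul' (memLp_top_ofReal hχ.contDiff.continuous
        hχ.hasCompactSupport _) : MemLp (fun x => (χ x : ℂ) * (n x : ℂ)) ⊤ (volume.restrict S))
    have hi2 : Integrable (fun x => ((χ x : ℂ) * (n x : ℂ) * (c x : ℂ)⁻¹) *
        (starRingEnd ℂ) (w x) * ∑ l, (e l : ℂ) * partialDeriv l w x) (volume.restrict S) :=
      integrable_mul_of_memLp ((hw.conj.memLp _ 2).mul' hm)
        (memLp_finsetSum _ fun l _ => ((hw.partialDeriv' l).memLp _ 2).const_mul _)
    rw [show (∫ x in S, ((χ x : ℂ) * (n x : ℂ) * (c x : ℂ)⁻¹) * (starRingEnd ℂ) (w x) *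
        ∑ l, (e l : ℂ) * partialDeriv l w x).re = ∫ x in S, (((χ x : ℂ) * (n x : ℂ) *
        (c x : ℂ)⁻¹) * (starRingEnd ℂ) (w x) * ∑ l, (e l : ℂ) * partialDeriv l w x).re from
      (integral_re hi2).symm]
    have h1 : ∀ l, (∫ x in S, (n x : ℂ) * ((χ x * (2 * ((starRingEnd ℂ) (w x) *
        partialDeriv l w x).re) : ℝ) : ℂ) * (c x : ℂ)⁻¹).re = ∫ x in S, ((n x : ℂ) *
        ((χ x * (2 * ((starRingEnd ℂ) (w x) * partialDeriv l w x).re) : ℝ) : ℂ) *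
        (c x : ℂ)⁻¹).re := fun l => (integral_re (hi1 l)).symm
    have hi3 : ∀ l, Integrable (fun x => e l / 2 * ((n x : ℂ) * ((χ x * (2 *
        ((starRingEnd ℂ) (w x) * partialDeriv l w x).re) : ℝ) : ℂ) * (c x : ℂ)⁻¹).re)
        (volume.restrict S) := fun l => ((hi1 l).re).const_mul _
    simp_rw [h1, ← integral_const_mul]
    rw [← integral_finsetSum _ fun l _ => hi3 l]
    congr 1 with x
    rw [Finset.mul_sum, Complex.re_sum]
    refine Finset.sum_congr rfl fun l _ => ?_
    have h2 : (χ x : ℂ) * (n x : ℂ) * (c x : ℂ)⁻¹ * (starRingEnd ℂ) (w x) *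
        ((e l : ℂ) * partialDeriv l w x) = ((χ x * n x * (c x)⁻¹ * e l : ℝ) : ℂ) *
        ((starRingEnd ℂ) (w x) * partialDeriv l w x) := by push_cast; ring
    have h3 : ∀ t : ℝ, (n x : ℂ) * (t : ℂ) * (c x : ℂ)⁻¹ = ((n x * t * (c x)⁻¹ : ℝ) : ℂ) :=
      fun t => by push_cast; ring
    rw [h2, h3, Complex.re_ofReal_mul, Complex.ofReal_re]
    ring
  rw [hsplit, Finset.sum_mul]
  refine (Finset.abs_sum_le_sum_abs _ _).trans (Finset.sum_le_sum fun l _ => ?_)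
  rw [abs_mul]
  have h3 : |e l / 2| ≤ 1 := by
    have : |e l| ≤ 1 := he ▸ PiLp.norm_apply_le e l
    rw [abs_div, abs_two]
    linarith
  exact (mul_le_of_le_one_left (abs_nonneg _) h3).trans (hterm l)

lemma sqrt_integral_sum_smul_sq_le (hSΩ : S ⊆ Ω) (he : ‖e‖ = 1)
    {G : Fin d → EuclideanSpace ℝ (Fin d) → ℂ} (hG : ∀ i, MemLp (G i) 2 (volume.restrict Ω)) :
    √(∫ x in S, ‖∑ l, (e l : ℂ) * G l x‖ ^ 2) ≤ √(∑ i, ∫ x in Ω, ‖G i x‖ ^ 2) := by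
  have hD : MemLp (fun x => ∑ l, (e l : ℂ) * G l x) 2 (volume.restrict Ω) :=
    memLp_finsetSum _ fun l _ => (hG l).const_mul _
  refine (sqrt_setIntegral_norm_sq_le hSΩ hD).trans (Real.sqrt_le_sqrt ?_)
  have hsq : ∀ i, Integrable (fun x => ‖G i x‖ ^ 2) (volume.restrict Ω) := fun i =>
    (hG i).integrable_norm_pow (by norm_num)
  rw [← integral_finsetSum _ fun i _ => hsq i]
  refine integral_mono (hD.integrable_norm_pow (by norm_num))
    (integrable_finsetSum _ fun i _ => hsq i) fun x => ?_
  simpa using norm_sum_smul_sq_le he fun l => G l x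

/-- The bound for the principal term of the Rellich estimate in one chart, in terms of the `L²`
norms of the solution, its gradient and the right-hand side. -/
lemma BoundedCoefficients.exists_principal_le (h : BoundedCoefficients S c n c' n' b₀ M L)
    (hS : IsOpen S) (hb : Bornology.IsBounded S) (hSΩ : S ⊆ Ω) (hχ : IsTestFunction U χ)
    (hU : U ∩ Ω ⊆ S) (he : ‖e‖ = 1) (hΩ : MeasurableSet Ω) :
    ∃ C : ℝ, 0 ≤ C ∧ ∀ (η : ℝ) (z : ℂ) (u v : EuclideanSpace ℝ (Fin d) → ℂ)
      (G : Fin d → EuclideanSpace ℝ (Fin d) → ℂ) (Δ : EuclideanSpace ℝ (Fin d) → ℂ)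
      (w : ℕ → EuclideanSpace ℝ (Fin d) → ℂ), 0 < η → ‖z‖ = 1 →
      MemLp v 2 (volume.restrict Ω) →
      (∀ᵐ x ∂(volume.restrict S), (η : ℂ) ^ 2 * ((c x : ℂ) * Δ x + ∑ i, (c' i x : ℂ) * G i x) +
        z * ((n x : ℂ) * u x) = η * v x) →
      (∀ k, IsComplexTest Ω (w k)) → L2Tendsto (volume.restrict Ω) w u →
      (∀ i, L2Tendsto (volume.restrict Ω) (fun k => partialDeriv i (w k)) (G i)) →
      η ^ 2 * |(∫ x in Ω, (χ x : ℂ) * (starRingEnd ℂ) (Δ x) * ∑ l, (e l : ℂ) * G l x).re| ≤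
        C * (η * √(∫ x in Ω, ‖v x‖ ^ 2) * √(∑ i, ∫ x in Ω, ‖G i x‖ ^ 2) +
          (∫ x in Ω, ‖u x‖ ^ 2) +
          theta z * √(∫ x in Ω, ‖u x‖ ^ 2) * √(∑ i, ∫ x in Ω, ‖G i x‖ ^ 2) +
          η ^ 2 * ∑ i, ∫ x in Ω, ‖G i x‖ ^ 2) := by
  have := isFiniteMeasure_restrict hb
  have hle : (volume : Measure (EuclideanSpace ℝ (Fin d))).restrict S ≤ volume.restrict Ω :=
    Measure.restrict_mono hSΩ le_rfl
  obtain ⟨B, hB⟩ := hχ.contDiff.continuous.bounded_above_of_compact_support hχ.hasCompactSupport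
  have hB0 : 0 ≤ B := (norm_nonneg _).trans (hB 0)
  have hM := h.nonneg_M
  have hL := h.nonneg_L
  have hb₀ := h.pos
  obtain ⟨Cr, hCr0, hCr⟩ := h.exists_abs_re_le hS hb hχ hU he
  have hχt := memLp_top_ofReal hχ.contDiff.continuous hχ.hasCompactSupport
    (volume.restrict S)
  have hinv := memLp_top_inv hb₀ h.memLp_c.1 h.le_c
  -- the coefficients of the three parts of the equation
  have hm1 : MemLp (fun x => (χ x : ℂ) * (c x : ℂ)⁻¹) ⊤ (volume.restrict S) := hinv.mul' hχt
  have hmul : ∀ {b : EuclideanSpace ℝ (Fin d) → ℝ}, MemLp b ⊤ (volume.restrict S) →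
      MemLp (fun x => (χ x : ℂ) * (b x : ℂ) * (c x : ℂ)⁻¹) ⊤ (volume.restrict S) := fun hb =>
    hinv.mul' ((memLp_ofReal hb).mul' hχt : MemLp (fun x => (χ x : ℂ) * _) ⊤ (volume.restrict S))
  have hmul_le : ∀ {b : EuclideanSpace ℝ (Fin d) → ℝ} {P : ℝ}, 0 ≤ P →
      (∀ᵐ x ∂(volume.restrict S), |b x| ≤ P) →
      ∀ᵐ x ∂(volume.restrict S), ‖(χ x : ℂ) * (b x : ℂ) * (c x : ℂ)⁻¹‖ ≤ B * P * b₀⁻¹ := by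
    intro b P hP hbP
    filter_upwards [hbP, h.le_c] with x hx1 hx2
    rw [norm_mul, norm_mul, Complex.norm_real, Complex.norm_real]
    have h1 := hB x
    have h2 := norm_ofReal_inv_le hb₀ hx2
    have h3 : ‖b x‖ ≤ P := hx1
    gcongr
  have hm1_le : ∀ᵐ x ∂(volume.restrict S), ‖(χ x : ℂ) * (c x : ℂ)⁻¹‖ ≤ B * b₀⁻¹ := by
    filter_upwards [h.le_c] with x hx2
    rw [norm_mul, Complex.norm_real]
    have h1 := hB x
    have h2 := norm_ofReal_inv_le hb₀ hx2
    gcongr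
  have hCs : 0 ≤ ∑ _i : Fin d, B * L * b₀⁻¹ := Finset.sum_nonneg fun i _ => by positivity
  refine ⟨B * b₀⁻¹ + Cr + B * M * b₀⁻¹ + ∑ _i : Fin d, B * L * b₀⁻¹, by positivity, ?_⟩
  intro η z u v G Δ w hη hz hv heq hw hwu hwG
  have hG2 := fun i => (hwG i).memLp_limit
  have hu := hwu.memLp_limit
  have hconj : ∀ {f : EuclideanSpace ℝ (Fin d) → ℂ}, MemLp f 2 (volume.restrict Ω) →
      MemLp (fun x => (starRingEnd ℂ) (f x)) 2 (volume.restrict S) := fun hf =>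
    (hf.mono_measure hle).star
  have hD : MemLp (fun x => ∑ l, (e l : ℂ) * G l x) 2 (volume.restrict S) :=
    memLp_finsetSum _ fun l _ => ((hG2 l).mono_measure hle).const_mul _
  have hDY := sqrt_integral_sum_smul_sq_le hSΩ he hG2
  set X := √(∫ x in Ω, ‖u x‖ ^ 2) with hX
  set Y := √(∑ i, ∫ x in Ω, ‖G i x‖ ^ 2) with hY
  set V := √(∫ x in Ω, ‖v x‖ ^ 2) with hV
  have hX2 : ∫ x in Ω, ‖u x‖ ^ 2 = X ^ 2 :=
    (Real.sq_sqrt (integral_nonneg fun x => by positivity)).symm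
  have hY2 : ∑ i, ∫ x in Ω, ‖G i x‖ ^ 2 = Y ^ 2 :=
    (Real.sq_sqrt (Finset.sum_nonneg fun i _ => integral_nonneg fun x => by positivity)).symm
  have hpair : ∀ {m f : EuclideanSpace ℝ (Fin d) → ℂ} {P : ℝ}, 0 ≤ P →
      MemLp m ⊤ (volume.restrict S) → (∀ᵐ x ∂(volume.restrict S), ‖m x‖ ≤ P) →
      MemLp f 2 (volume.restrict Ω) →
      ‖∫ x in S, m x * (starRingEnd ℂ) (f x) * ∑ l, (e l : ℂ) * G l x‖ ≤
        P * √(∫ x in Ω, ‖f x‖ ^ 2) * Y := by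
    intro m f P hP hm hmP hf
    refine (norm_integral_mul_mul_le hP hm hmP (hconj hf) hD).trans ?_
    have h1 := sqrt_setIntegral_norm_sq_le hSΩ hf
    simp_rw [RCLike.norm_conj]
    gcongr
  have hT1 := hpair (by positivity) hm1 hm1_le hv
  have hT2 := hpair (by positivity) (hmul h.memLp_n) (hmul_le hM h.n_le) hu
  have hT3 : ∀ i, ‖∫ x in S, ((χ x : ℂ) * (c' i x : ℂ) * (c x : ℂ)⁻¹) *
      (starRingEnd ℂ) (G i x) * ∑ l, (e l : ℂ) * G l x‖ ≤ B * L * b₀⁻¹ * Y ^ 2 := fun i => by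
    refine (hpair (by positivity) (hmul (h.memLp_c' i)) (hmul_le hL (h.c'_le i)) (hG2 i)).trans ?_
    have h1 : √(∫ x in Ω, ‖G i x‖ ^ 2) ≤ Y :=
      Real.sqrt_le_sqrt (Finset.single_le_sum (f := fun i => ∫ x in Ω, ‖G i x‖ ^ 2)
        (fun i _ => integral_nonneg fun x => by positivity) (Finset.mem_univ i))
    rw [sq, ← mul_assoc]
    gcongr
  -- the real part of the zeroth order term
  have hTre : |(∫ x in S, ((χ x : ℂ) * (n x : ℂ) * (c x : ℂ)⁻¹) * (starRingEnd ℂ) (u x) *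
        ∑ l, (e l : ℂ) * G l x).re| ≤ Cr * X ^ 2 := by
    have hwS := hwu.mono_measure hle
    have h1 := (hwS.conj.mul_top (hmul h.memLp_n)).integral_mul
      (L2Tendsto.sum Finset.univ fun l _ => ((hwG l).mono_measure hle).const_mul (e l : ℂ))
    have h2 := ((Complex.continuous_re.tendsto _).comp h1).abs
    have h3 := hwS.integral_norm_sq.const_mul Cr
    refine (le_of_tendsto_of_tendsto' h2 h3 fun k => hCr (w k) (hw k)).trans ?_
    rw [← hX2]
    exact mul_le_mul_of_nonneg_left (setIntegral_mono_set (hu.integrable_norm_pow (by norm_num))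
      (Eventually.of_forall fun x => by positivity) hSΩ.eventuallyLE) hCr0
  have hint : ∀ {m f : EuclideanSpace ℝ (Fin d) → ℂ}, MemLp m ⊤ (volume.restrict S) →
      MemLp f 2 (volume.restrict Ω) →
      Integrable (fun x => m x * (starRingEnd ℂ) (f x) * ∑ l, (e l : ℂ) * G l x)
        (volume.restrict S) := fun hm hf => integrable_mul_of_memLp ((hconj hf).mul' hm) hD
  have hi1 := (hint hm1 hv).const_mul (η : ℂ)
  have hi2 := (hint (hmul h.memLp_n) hu).const_mul ((starRingEnd ℂ) z)
  have hi3 := fun i => hint (hmul (h.memLp_c' i)) (hG2 i)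
  have hi3s := (integrable_finsetSum Finset.univ fun i _ => hi3 i).const_mul ((η : ℂ) ^ 2)
  have hkey : (η : ℂ) ^ 2 * (∫ x in Ω, (χ x : ℂ) * (starRingEnd ℂ) (Δ x) *
      ∑ l, (e l : ℂ) * G l x) =
      η * (∫ x in S, ((χ x : ℂ) * (c x : ℂ)⁻¹) * (starRingEnd ℂ) (v x) *
        ∑ l, (e l : ℂ) * G l x) -
      (starRingEnd ℂ) z * (∫ x in S, ((χ x : ℂ) * (n x : ℂ) * (c x : ℂ)⁻¹) *
        (starRingEnd ℂ) (u x) * ∑ l, (e l : ℂ) * G l x) -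
      (η : ℂ) ^ 2 * ∑ i, ∫ x in S, ((χ x : ℂ) * (c' i x : ℂ) * (c x : ℂ)⁻¹) *
        (starRingEnd ℂ) (G i x) * ∑ l, (e l : ℂ) * G l x := by
    have h1 : ∫ x in Ω, (χ x : ℂ) * (starRingEnd ℂ) (Δ x) * ∑ l, (e l : ℂ) * G l x =
        ∫ x in S, (χ x : ℂ) * (starRingEnd ℂ) (Δ x) * ∑ l, (e l : ℂ) * G l x := by
      refine setIntegral_eq_of_subset_of_forall_sdiff_eq_zero hΩ hSΩ fun x hx => ?_
      have h2 : x ∉ tsupport χ := fun h => hx.2 (hU ⟨hχ.tsupport_subset h, hx.1⟩)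
      rw [image_eq_zero_of_notMem_tsupport h2]
      simp
    have hi12 : Integrable (fun x => η * (((χ x : ℂ) * (c x : ℂ)⁻¹) * (starRingEnd ℂ) (v x) *
        ∑ l, (e l : ℂ) * G l x) - (starRingEnd ℂ) z * (((χ x : ℂ) * (n x : ℂ) * (c x : ℂ)⁻¹) *
        (starRingEnd ℂ) (u x) * ∑ l, (e l : ℂ) * G l x)) (volume.restrict S) := hi1.sub hi2
    rw [h1, ← integral_finsetSum _ fun i _ => hi3 i, ← integral_const_mul, ← integral_const_mul,
      ← integral_const_mul, ← integral_const_mul, ← integral_sub hi1 hi2,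
      ← integral_sub hi12 hi3s]
    refine integral_congr_ae ?_
    filter_upwards [heq, h.le_c] with x hx hcx
    have hc0 : (c x : ℂ) ≠ 0 := Complex.ofReal_ne_zero.2 (hb₀.trans_le hcx).ne'
    have h2 := congrArg (starRingEnd ℂ) hx
    simp only [map_add, map_mul, map_sum, map_pow, Complex.conj_ofReal] at h2
    have h3 : (η : ℂ) ^ 2 * (starRingEnd ℂ) (Δ x) = (c x : ℂ)⁻¹ * (η * (starRingEnd ℂ) (v x) -
        (starRingEnd ℂ) z * ((n x : ℂ) * (starRingEnd ℂ) (u x)) -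
        (η : ℂ) ^ 2 * ∑ i, (c' i x : ℂ) * (starRingEnd ℂ) (G i x)) := by
      rw [eq_inv_mul_iff_mul_eq₀ hc0]
      linear_combination h2
    have h4 : ∀ D : ℂ, ∑ i, (χ x : ℂ) * (c' i x : ℂ) * (c x : ℂ)⁻¹ * (starRingEnd ℂ) (G i x) *
        D = (χ x : ℂ) * (c x : ℂ)⁻¹ *
        (∑ i, (c' i x : ℂ) * (starRingEnd ℂ) (G i x)) * D := fun D => by
      rw [Finset.mul_sum, Finset.sum_mul]
      refine Finset.sum_congr rfl fun i _ => ?_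
      ring
    rw [h4]
    linear_combination (χ x : ℂ) * (∑ l, (e l : ℂ) * G l x) * h3
  set J1 := ∫ x in S, ((χ x : ℂ) * (c x : ℂ)⁻¹) * (starRingEnd ℂ) (v x) *
        ∑ l, (e l : ℂ) * G l x
  set J2 := ∫ x in S, ((χ x : ℂ) * (n x : ℂ) * (c x : ℂ)⁻¹) *
        (starRingEnd ℂ) (u x) * ∑ l, (e l : ℂ) * G l x
  set J3 := ∑ i, ∫ x in S, ((χ x : ℂ) * (c' i x : ℂ) * (c x : ℂ)⁻¹) *
        (starRingEnd ℂ) (G i x) * ∑ l, (e l : ℂ) * G l x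
  have hJ3 : ‖J3‖ ≤ (∑ _i : Fin d, B * L * b₀⁻¹) * Y ^ 2 := by
    rw [Finset.sum_mul]
    exact (norm_sum_le _ _).trans (Finset.sum_le_sum fun i _ => hT3 i)
  have hzJ : |((starRingEnd ℂ) z * J2).re| ≤ Cr * X ^ 2 + theta z * (B * M * b₀⁻¹ * X * Y) := by
    have h1 : ((starRingEnd ℂ) z * J2).re = z.re * J2.re + z.im * J2.im := by
      simp [Complex.mul_re]
    rw [h1]
    refine (abs_add_le _ _).trans (add_le_add ?_ ?_)
    · rw [abs_mul]
      exact (mul_le_of_le_one_left (abs_nonneg _) (hz ▸ Complex.abs_re_le_norm z)).trans hTre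
    · rw [abs_mul]
      exact mul_le_mul (abs_im_le_theta hz) ((Complex.abs_im_le_norm _).trans hT2)
        (abs_nonneg _) ((abs_nonneg _).trans (abs_im_le_theta hz))
  have hre : η ^ 2 * |(∫ x in Ω, (χ x : ℂ) * (starRingEnd ℂ) (Δ x) *
      ∑ l, (e l : ℂ) * G l x).re| = |(η * J1).re - ((starRingEnd ℂ) z * J2).re -
        ((η : ℂ) ^ 2 * J3).re| := by
    rw [← Complex.sub_re, ← Complex.sub_re, ← hkey, ← Complex.ofReal_pow, Complex.re_ofReal_mul,
      abs_mul, abs_of_nonneg (sq_nonneg η)]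
  have hθ : 0 ≤ theta z := (abs_nonneg _).trans (abs_im_le_theta hz)
  have hn1 : |(η * J1).re| ≤ η * (B * b₀⁻¹ * V * Y) := by
    rw [Complex.re_ofReal_mul, abs_mul, abs_of_pos hη]
    exact mul_le_mul_of_nonneg_left ((Complex.abs_re_le_norm _).trans hT1) hη.le
  have hn3 : |((η : ℂ) ^ 2 * J3).re| ≤ η ^ 2 * ((∑ _i : Fin d, B * L * b₀⁻¹) * Y ^ 2) := by
    rw [← Complex.ofReal_pow, Complex.re_ofReal_mul, abs_mul, abs_of_nonneg (sq_nonneg η)]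
    exact mul_le_mul_of_nonneg_left ((Complex.abs_re_le_norm _).trans hJ3) (sq_nonneg _)
  rw [hre, hX2, hY2]
  have hY0 : 0 ≤ Y := Real.sqrt_nonneg _
  have hX0 : 0 ≤ X := Real.sqrt_nonneg _
  have hV0 : 0 ≤ V := Real.sqrt_nonneg _
  set C1 := B * b₀⁻¹
  set C3 := B * M * b₀⁻¹
  set C4 := ∑ _i : Fin d, B * L * b₀⁻¹
  have hC1 : 0 ≤ C1 := by positivity
  have hC3 : 0 ≤ C3 := by positivity
  have p1 : C1 * (η * V * Y) ≤ (C1 + Cr + C3 + C4) * (η * V * Y) := by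
    gcongr; linarith
  have p2 : Cr * X ^ 2 ≤ (C1 + Cr + C3 + C4) * X ^ 2 := by
    gcongr; linarith
  have p3 : C3 * (theta z * X * Y) ≤ (C1 + Cr + C3 + C4) * (theta z * X * Y) := by
    gcongr; linarith
  have p4 : C4 * (η ^ 2 * Y ^ 2) ≤ (C1 + Cr + C3 + C4) * (η ^ 2 * Y ^ 2) := by
    gcongr; linarith
  have h1 := abs_sub ((η * J1).re - ((starRingEnd ℂ) z * J2).re) ((η : ℂ) ^ 2 * J3).re
  have h2 := abs_sub (η * J1).re ((starRingEnd ℂ) z * J2).re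
  linarith

end

end Interior

/-! ### The normal derivative -/

section Normal

variable {d : ℕ} {Ω : Set (EuclideanSpace ℝ (Fin d))} {δ : ℝ} {ι : Type} [Fintype ι]

lemma exists_measurable_selection {κ α β : Type*} [MeasurableSpace α] [MeasurableSpace β]
    [Inhabited β] {t : κ → Set α} (ht : ∀ j, MeasurableSet (t j)) {g : κ → α → β}
    (hg : ∀ j, Measurable (g j)) (s : Finset κ) :
    ∃ f : α → β, Measurable f ∧ ∀ x, (∃ j ∈ s, x ∈ t j) → ∃ j ∈ s, x ∈ t j ∧ f x = g j x := by
  classical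
  induction s using Finset.induction_on with
  | empty => exact ⟨fun _ => default, measurable_const, fun x ⟨j, hj, _⟩ => by simp at hj⟩
  | insert a s _ ih =>
    obtain ⟨f, hf, hfs⟩ := ih
    refine ⟨(t a).piecewise (g a) f, (hg a).piecewise (ht a) hf, fun x ⟨j, hj, hx⟩ => ?_⟩
    by_cases hxa : x ∈ t a
    · exact ⟨a, Finset.mem_insert_self _ _, hxa, by simp [hxa]⟩
    · rcases Finset.mem_insert.1 hj with rfl | hjs
      · exact absurd hx hxa
      · obtain ⟨l, hl, hxl, hfl⟩ := hfs x ⟨j, hjs, hx⟩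
        exact ⟨l, Finset.mem_insert_of_mem hl, hxl, by simp [hxa, hfl]⟩

lemma IsGraphChart.sub_gradient_ne_zero {x₀ e : EuclideanSpace ℝ (Fin d)} {r : ℝ}
    {γ : EuclideanSpace ℝ (Fin d) → ℝ} (h : IsGraphChart Ω x₀ r e γ)
    (x : EuclideanSpace ℝ (Fin d)) : e - gradient γ x ≠ 0 := by
  intro h0
  have h1 : (inner ℝ (e - gradient γ x) e : ℝ) = 1 := by
    have h2 : (inner ℝ (gradient γ x) e : ℝ) = fderiv ℝ γ x e := by
      rw [gradient, InnerProductSpace.toDual_symm_apply]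
    rw [inner_sub_left, real_inner_self_eq_norm_sq, h.norm_eq_one, h2,
      fderiv_apply_self h.contDiff h.add_smul]
    norm_num
  rw [h0, inner_zero_left] at h1
  exact zero_ne_one h1

/-- The inner unit normal can be chosen measurably. -/
lemma BoundaryAtlas.exists_normal (A : BoundaryAtlas Ω δ ι) (hΩ : IsOpen Ω) :
    ∃ N : EuclideanSpace ℝ (Fin d) → EuclideanSpace ℝ (Fin d), Measurable N ∧
      ∀ x ∈ frontier Ω, IsInnerUnitNormal Ω x (N x) := by
  have hcont : ∀ j, Continuous fun x => A.e j - gradient (A.γ j) x := fun j =>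
    continuous_const.sub ((InnerProductSpace.toDual ℝ _).symm.continuous.comp
      ((A.chart j).contDiff.continuous_fderiv (by simp)))
  obtain ⟨N, hN, hsel⟩ := exists_measurable_selection (t := fun j => {x | A.χ j x ≠ 0})
    (fun j => ((A.test j).contDiff.continuous.measurable (measurableSet_singleton 0)).compl)
    (g := fun j x => ‖A.e j - gradient (A.γ j) x‖⁻¹ • (A.e j - gradient (A.γ j) x))
    (fun j => (((hcont j).norm.inv₀ fun x =>
      norm_ne_zero_iff.2 ((A.chart j).sub_gradient_ne_zero x)).smul (hcont j)).measurable)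
    Finset.univ
  refine ⟨N, hN, fun x hx => ?_⟩
  obtain ⟨j, hj, hj0⟩ := Finset.exists_ne_zero_of_sum_ne_zero
    ((A.sum_χ_frontier hΩ hx).trans_ne one_ne_zero)
  obtain ⟨l, -, hl0, hNl⟩ := hsel x ⟨j, hj, hj0⟩
  have hxl : x ∈ Metric.ball (A.x l) (A.r l) := (A.test l).tsupport_subset
    (subset_tsupport _ hl0)
  have hne := norm_ne_zero_iff.2 ((A.chart l).sub_gradient_ne_zero x)
  refine ⟨?_, A.r l - dist x (A.x l), A.e l, A.γ l, (A.chart l).recenter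
    (sub_pos.2 hxl) (by linarith), ‖A.e l - gradient (A.γ l) x‖, norm_pos_iff.2
    ((A.chart l).sub_gradient_ne_zero x), ?_⟩
  · rw [hNl, norm_smul, norm_inv, norm_norm, inv_mul_cancel₀ hne]
  · rw [hNl, smul_smul, mul_inv_cancel₀ hne, one_smul]

/-- Functions with a trace are limits of smooth functions, for each choice of the weak gradient. -/
lemma HasTrace.exists_L2Tendsto [IsFiniteMeasure (surfaceMeasure Ω)] (hΩ : IsOpen Ω)
    (hb : Bornology.IsBounded Ω) {f w : EuclideanSpace ℝ (Fin d) → ℂ}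
    {G : Fin d → EuclideanSpace ℝ (Fin d) → ℂ} (h : HasTrace Ω f w)
    (hG : HasWeakGradient Ω f G) :
    ∃ φ : ℕ → EuclideanSpace ℝ (Fin d) → ℂ, (∀ k, ContDiff ℝ ∞ (φ k)) ∧
      L2Tendsto (volume.restrict Ω) φ f ∧
      (∀ i, L2Tendsto (volume.restrict Ω) (fun k => partialDeriv i (φ k)) (G i)) ∧
      L2Tendsto (surfaceMeasure Ω) φ w := by
  obtain ⟨⟨hf, G₁, hG₁, hG₁2⟩, hw, G₂, hG₂, φ, hφ, h0, h1, h2⟩ := h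
  have hm := hΩ.measurableSet
  have he : ∀ i, G₂ i =ᵐ[volume.restrict Ω] G i := fun i => (hG₂ i).ae_unique hΩ (hG i)
  have he' : ∀ i, G₁ i =ᵐ[volume.restrict Ω] G₂ i := fun i => (hG₁ i).ae_unique hΩ (hG₂ i)
  refine ⟨φ, hφ, ⟨fun k => memLp_restrict hm hb (hφ k).continuous 2, hf, h0⟩, fun i => ?_,
    ⟨fun k => memLp_surfaceMeasure hb (hφ k).continuous 2, hw, h2⟩⟩
  exact L2Tendsto.congr ⟨fun k => memLp_restrict hm hb (contDiff_partialDeriv (hφ k) i).continuous 2,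
    (hG₁2 i).ae_eq (he' i), h1 i⟩ (fun k => .rfl) (he i)

/-- Traces are unique. -/
lemma HasTrace.ae_unique (A : BoundaryAtlas Ω δ ι) (hΩ : IsOpen Ω)
    (hb : Bornology.IsBounded Ω) {f w w' : EuclideanSpace ℝ (Fin d) → ℂ}
    (h : HasTrace Ω f w) (h' : HasTrace Ω f w') : w =ᵐ[surfaceMeasure Ω] w' := by
  have := A.isFiniteMeasure_surfaceMeasure hΩ
  obtain ⟨G, hG, -⟩ := h.1.2
  obtain ⟨φ, hφ, hφf, hφG, hφw⟩ := h.exists_L2Tendsto hΩ hb hG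
  obtain ⟨ψ, hψ, hψf, hψG, hψw⟩ := h'.exists_L2Tendsto hΩ hb hG
  exact (A.tendsto_surfaceMeasure hΩ hb hφ hψ hφf hφG hψf hψG hφw).ae_unique hψw

lemma norm_sum_mul_sq_le {N : EuclideanSpace ℝ (Fin d)} (hN : ‖N‖ = 1) (a : Fin d → ℂ) :
    ‖∑ i, (N i : ℂ) * a i‖ ^ 2 ≤ ∑ i, ‖a i‖ ^ 2 := by
  simpa using norm_sum_smul_sq_le hN a

/-- The normal derivative exists as soon as the partial derivatives have traces. -/
lemma BoundaryAtlas.exists_isNormalDerivative (A : BoundaryAtlas Ω δ ι) (hΩ : IsOpen Ω)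
    {u : EuclideanSpace ℝ (Fin d) → ℂ} {G w : Fin d → EuclideanSpace ℝ (Fin d) → ℂ}
    (hG : HasWeakGradient Ω u G) (hw : ∀ i, HasTrace Ω (G i) (w i)) :
    ∃ q, IsNormalDerivative Ω u q := by
  obtain ⟨N, hN, hNn⟩ := A.exists_normal hΩ
  have hae : ∀ᵐ x ∂surfaceMeasure Ω, x ∈ frontier Ω :=
    ae_restrict_mem isClosed_frontier.measurableSet
  refine ⟨fun x => ∑ i, (N x i : ℂ) * w i x, memLp_finsetSum _ fun i _ => ?_, G, w, hG, hw, ?_⟩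
  · have hNt : MemLp (fun x => (N x i : ℂ)) ⊤ (surfaceMeasure Ω) := by
      refine memLp_top_of_bound (C := 1) ?_ ?_
      · exact (Complex.measurable_ofReal.comp
          ((EuclideanSpace.proj i : EuclideanSpace ℝ (Fin d) →L[ℝ] ℝ).continuous.measurable.comp
            hN)).aestronglyMeasurable
      · filter_upwards [hae] with x hx
        rw [Complex.norm_real]
        exact (PiLp.norm_apply_le (N x) i).trans (hNn x hx).1.le
    exact (hw i).2.1.mul' hNt
  · filter_upwards [hae] with x hx using ⟨N x, hNn x hx, rfl⟩

/-- The normal derivative is dominated by the traces of the partial derivatives. -/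
lemma IsNormalDerivative.exists_integral_le {u q : EuclideanSpace ℝ (Fin d) → ℂ}
    (h : IsNormalDerivative Ω u q) :
    ∃ G w : Fin d → EuclideanSpace ℝ (Fin d) → ℂ, HasWeakGradient Ω u G ∧
      (∀ i, HasTrace Ω (G i) (w i)) ∧
      ∫ x, ‖q x‖ ^ 2 ∂surfaceMeasure Ω ≤ ∑ i, ∫ x, ‖w i x‖ ^ 2 ∂surfaceMeasure Ω := by
  obtain ⟨hq, G, w, hG, hw, hqw⟩ := h
  refine ⟨G, w, hG, hw, ?_⟩
  have hsq : ∀ i, Integrable (fun x => ‖w i x‖ ^ 2) (surfaceMeasure Ω) := fun i =>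
    (hw i).2.1.integrable_norm_pow (by norm_num)
  rw [← integral_finsetSum _ fun i _ => hsq i]
  refine integral_mono_ae (hq.integrable_norm_pow (by norm_num))
    (integrable_finsetSum _ fun i _ => hsq i) ?_
  filter_upwards [hqw] with x hx
  obtain ⟨N, hN, hqx⟩ := hx
  rw [hqx]
  exact norm_sum_mul_sq_le hN.1 _

end Normal

/-! ### The estimate of the normal derivative -/

section Estimate

variable {d : ℕ} {Ω : Set (EuclideanSpace ℝ (Fin d))} {δ : ℝ}

/-- Every term of the Rellich estimate is of order `h / θ`. -/
lemma rellich_terms_le {h θ X Y V a E : ℝ} (hh : 0 < h) (hθ : h ≤ θ)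
    (hE : 0 ≤ E) (hX0 : 0 ≤ X) (hV0 : 0 ≤ V) (hX : X ≤ a * (h / θ) * V)
    (hY : Y ^ 2 ≤ E * (V / θ) ^ 2) :
    h * V * Y + X ^ 2 + θ * X * Y + h ^ 2 * Y ^ 2 ≤
      (√E + a ^ 2 + a * √E + E) * (h / θ * V ^ 2) ∧
    h ^ 2 * Y ^ 2 ≤ E * (h / θ * V ^ 2) := by
  have hθ0 : 0 < θ := hh.trans_le hθ
  have ht1 : h / θ ≤ 1 := (div_le_one hθ0).2 hθ
  have ht0 : 0 ≤ h / θ := by positivity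
  have ht2 : (h / θ) ^ 2 ≤ h / θ := by nlinarith
  have hY1 : Y ≤ √E * (V / θ) := by
    refine le_of_sq_le_sq ?_ (by positivity)
    rwa [mul_pow, Real.sq_sqrt hE]
  have h1 : h * V * Y ≤ √E * (h / θ * V ^ 2) := by
    calc h * V * Y ≤ h * V * (√E * (V / θ)) := by gcongr
      _ = _ := by field_simp
  have h2 : X ^ 2 ≤ a ^ 2 * (h / θ * V ^ 2) := by
    calc X ^ 2 ≤ (a * (h / θ) * V) ^ 2 := by gcongr
      _ = a ^ 2 * ((h / θ) ^ 2 * V ^ 2) := by ring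
      _ ≤ _ := by gcongr
  have h3 : θ * X * Y ≤ a * √E * (h / θ * V ^ 2) := by
    calc θ * X * Y ≤ θ * X * (√E * (V / θ)) := by gcongr
      _ ≤ θ * (a * (h / θ) * V) * (√E * (V / θ)) := by gcongr
      _ = _ := by field_simp
  have h4 : h ^ 2 * Y ^ 2 ≤ E * (h / θ * V ^ 2) := by
    calc h ^ 2 * Y ^ 2 ≤ h ^ 2 * (E * (V / θ) ^ 2) := by gcongr
      _ = E * ((h / θ) ^ 2 * V ^ 2) := by ring
      _ ≤ _ := by gcongr
  exact ⟨by linarith, h4⟩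

/-- The estimate of the traces of the gradient of a solution of the Dirichlet problem. -/
theorem exists_trace_gradient_le (hΩ : IsSmoothBoundedDomain Ω)
    {c n : EuclideanSpace ℝ (Fin d) → ℝ}
    (hc : MemLp c ⊤ (volume.restrict Ω)) (hn : MemLp n ⊤ (volume.restrict Ω))
    {b₀ : ℝ} (hb₀ : 0 < b₀)
    (hcb : ∀ᵐ x ∂(volume.restrict Ω), b₀ ≤ c x) (hnb : ∀ᵐ x ∂(volume.restrict Ω), b₀ ≤ n x)
    {ι : Type} [Fintype ι] (A : BoundaryAtlas Ω δ ι)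
    (hc1 : HasBoundedWeakPartials (collar Ω δ) c) (hn1 : HasBoundedWeakPartials (collar Ω δ) n) :
    ∃ C : ℝ, 0 < C ∧ ∀ (h : ℝ) (z : ℂ), 0 < h → ‖z‖ = 1 → h ≤ theta z →
      ∀ u v : EuclideanSpace ℝ (Fin d) → ℂ, MemLp u 2 (volume.restrict Ω) →
        MemLp v 2 (volume.restrict Ω) → SolvesEquation Ω c n h z u v →
        HasTrace Ω u (fun _ => 0) → ∀ G : Fin d → EuclideanSpace ℝ (Fin d) → ℂ,
        HasWeakGradient Ω u G → (∀ i, MemH1 Ω (G i)) →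
        ∃ w : Fin d → EuclideanSpace ℝ (Fin d) → ℂ, (∀ i, HasTrace Ω (G i) (w i)) ∧
          h ^ 2 * ∑ i, ∫ x, ‖w i x‖ ^ 2 ∂surfaceMeasure Ω ≤
            C * (h / theta z) * ∫ x in Ω, ‖v x‖ ^ 2 := by
  have hΩo := hΩ.isOpen
  have hΩm := hΩo.measurableSet
  have hb := hΩ.isBounded
  have hS := isOpen_collar hΩo δ
  have hSΩ : collar Ω δ ⊆ Ω := collar_subset
  have hle : (volume : Measure (EuclideanSpace ℝ (Fin d))).restrict (collar Ω δ) ≤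
    volume.restrict Ω := Measure.restrict_mono hSΩ le_rfl
  have := A.isFiniteMeasure_surfaceMeasure hΩo
  obtain ⟨M, hM0, hM⟩ := exists_bound_of_memLp_top hn
  choose c' hc' hc't using hc1
  choose n' hn' hn't using hn1
  choose Lc hLc0 hLc using fun i => exists_bound_of_memLp_top (hc't i)
  choose Ln hLn0 hLn using fun i => exists_bound_of_memLp_top (hn't i)
  have hL : ∀ i, Lc i + Ln i ≤ ∑ i, (Lc i + Ln i) := fun i =>
    Finset.single_le_sum (f := fun i => Lc i + Ln i) (fun i _ => add_nonneg (hLc0 i) (hLn0 i))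
      (Finset.mem_univ i)
  have hco : BoundedCoefficients (collar Ω δ) c n c' n' b₀ M (∑ i, (Lc i + Ln i)) :=
    { pos := hb₀
      nonneg_M := hM0
      nonneg_L := Finset.sum_nonneg fun i _ => add_nonneg (hLc0 i) (hLn0 i)
      memLp_c := hc.mono_measure hle
      memLp_n := hn.mono_measure hle
      memLp_c' := hc't
      weak_c := hc'
      weak_n := hn'
      le_c := ae_mono hle hcb
      n_le := ae_mono hle hM
      c'_le := fun i => by
        filter_upwards [hLc i] with x hx
        linarith [hL i, hLn0 i]
      n'_le := fun i => by
        filter_upwards [hLn i] with x hx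
        linarith [hL i, hLc0 i] }
  obtain ⟨K, C₁, hK0, hC₁0, hrel⟩ := A.exists_sum_trace_sq_le hΩo hb
  choose C₂ hC₂0 hC₂ using fun j => hco.exists_principal_le hS (hb.subset hSΩ) hSΩ (A.test j)
    (A.ball_inter_subset_collar j) (A.chart j).norm_eq_one hΩm
  set E := 4 * M / b₀ ^ 3 + 2 / b₀ ^ 2 with hE
  have hE0 : 0 ≤ E := by positivity
  have hC₂s : 0 ≤ ∑ j, C₂ j := Finset.sum_nonneg fun j _ => hC₂0 j
  set E' := √E + (2 / b₀) ^ 2 + 2 / b₀ * √E + E with hE'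
  have hE'0 : 0 ≤ E' := by positivity
  refine ⟨K * (4 * ((∑ j, C₂ j) * E')) + C₁ * E + 1, by positivity, ?_⟩
  intro h z hh hz hθ u v hu hv hs htr G hG hGH
  choose hG2 H hH hH2 using hGH
  obtain ⟨φ, hφ, hφu, hφG, hφH⟩ := A.exists_smooth_approx hΩo hu hG hG2 hH hH2
  obtain ⟨ψ, hψ, hψu, hψG, hψ0⟩ := htr.exists_L2Tendsto hΩo hb hG
  have hφ0 := A.tendsto_surfaceMeasure hΩo hb hψ hφ hψu hψG hφu hφG hψ0
  choose w hw using fun i => A.exists_tendsto_surfaceMeasure hΩo hb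
    (fun k => contDiff_partialDeriv (hφ k) i) (hφG i) (hφH i)
  refine ⟨w, fun i => ⟨⟨hG2 i, H i, hH i, hH2 i⟩, (hw i).memLp_limit, H i, hH i,
    fun k => partialDeriv i (φ k), fun k => contDiff_partialDeriv (hφ k) i, (hφG i).tendsto,
    fun l => (hφH i l).tendsto, (hw i).tendsto⟩, ?_⟩
  obtain ⟨κ, hκ, hκc, hκs, hκu, hκG⟩ := A.exists_test_approx hΩo hb hu hG2 fun i ψ' hψ' hψs =>
    A.setIntegral_partialDeriv_smul_of_hasTrace_zero hΩo hb hψ hψu hψG hψ0 i hψ' hψs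
  have hκt : ∀ k, IsComplexTest Ω (κ k) := fun k => ⟨hκ k, hκc k, hκs k⟩
  obtain ⟨hX, hY⟩ := energy_estimate hΩo hb hc hn hb₀ hcb hnb hM0 hM hs hh hz hθ hu hv hG hG2 hκt
    hκu hκG
  have hae := hs.ae_eq hΩo hb hS hSΩ hc hn hu hv hG hφ hφG hφH hc' hc't
  have hae' : ∀ᵐ x ∂(volume.restrict (collar Ω δ)), (h : ℂ) ^ 2 * ((c x : ℂ) * (∑ i, H i i x) +
      ∑ i, (c' i x : ℂ) * G i x) + z * ((n x : ℂ) * u x) = h * v x := by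
    filter_upwards [hae] with x hx
    rw [← hx, Finset.sum_add_distrib, Finset.mul_sum]
  have hprin := fun j => hC₂ j h z u v G (fun x => ∑ i, H i i x) κ hh hz hv hae' hκt hκu hκG
  have hrel' := hrel φ G w H hφ hφ0 hφG hφH hw
  set X := √(∫ x in Ω, ‖u x‖ ^ 2)
  set V := √(∫ x in Ω, ‖v x‖ ^ 2)
  have hX2 : ∫ x in Ω, ‖u x‖ ^ 2 = X ^ 2 :=
    (Real.sq_sqrt (integral_nonneg fun x => by positivity)).symm
  have hV2 : ∫ x in Ω, ‖v x‖ ^ 2 = V ^ 2 :=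
    (Real.sq_sqrt (integral_nonneg fun x => by positivity)).symm
  set Y := √(∑ i, ∫ x in Ω, ‖G i x‖ ^ 2)
  have hY2 : ∑ i, ∫ x in Ω, ‖G i x‖ ^ 2 = Y ^ 2 :=
    (Real.sq_sqrt (Finset.sum_nonneg fun i _ => integral_nonneg fun x => by positivity)).symm
  rw [hY2] at hY hrel'
  simp_rw [hX2, hY2] at hprin
  obtain ⟨hall, hgrad⟩ := rellich_terms_le hh hθ hE0
    (Real.sqrt_nonneg _) (Real.sqrt_nonneg _) hX hY
  rw [hV2]
  set I : ι → ℝ := fun j => (∫ x in Ω, (A.χ j x : ℂ) * (starRingEnd ℂ) (∑ i, H i i x) *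
          ∑ l, (A.e j l : ℂ) * G l x).re
  have hI : ∀ j, h ^ 2 * |I j| ≤ C₂ j * (E' * (h / theta z * V ^ 2)) := fun j =>
    (hprin j).trans (mul_le_mul_of_nonneg_left hall (hC₂0 j))
  have hsumI : h ^ 2 * ∑ j, (-4 * I j) ≤ 4 * ((∑ j, C₂ j) * (E' * (h / theta z * V ^ 2))) := by
    rw [Finset.mul_sum, Finset.sum_mul, Finset.mul_sum]
    refine Finset.sum_le_sum fun j _ => ?_
    have h1 := mul_le_mul_of_nonneg_left (neg_abs_le (I j)) (sq_nonneg h)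
    nlinarith [hI j]
  have hθ0 : 0 < theta z := hh.trans_le hθ
  calc h ^ 2 * ∑ i, ∫ x, ‖w i x‖ ^ 2 ∂surfaceMeasure Ω
      ≤ h ^ 2 * (K * ∑ j, (-4 * I j) + C₁ * Y ^ 2) := by gcongr
    _ = K * (h ^ 2 * ∑ j, (-4 * I j)) + C₁ * (h ^ 2 * Y ^ 2) := by ring
    _ ≤ K * (4 * ((∑ j, C₂ j) * (E' * (h / theta z * V ^ 2)))) +
        C₁ * (E * (h / theta z * V ^ 2)) := by gcongr
    _ = (K * (4 * ((∑ j, C₂ j) * E')) + C₁ * E) * (h / theta z) * V ^ 2 := by ring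
    _ ≤ _ := mul_le_mul_of_nonneg_right (mul_le_mul_of_nonneg_right
        (le_add_of_nonneg_right zero_le_one) (by positivity)) (sq_nonneg V)

end Estimate

end SemiclassicalDirichlet

theorem theorem3p1 (d : ℕ) (hd : 2 ≤ d) (Ω : Set (EuclideanSpace ℝ (Fin d)))
    (hΩ : SemiclassicalDirichlet.IsSmoothBoundedDomain Ω)
    (c n : EuclideanSpace ℝ (Fin d) → ℝ)
    (hc : MemLp c ⊤ (volume.restrict Ω)) (hn : MemLp n ⊤ (volume.restrict Ω))
    (b₀ : ℝ) (hb₀ : 0 < b₀)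
    (hcb : ∀ᵐ x ∂(volume.restrict Ω), b₀ ≤ c x) (hnb : ∀ᵐ x ∂(volume.restrict Ω), b₀ ≤ n x)
    (δ : ℝ) (hδ : 0 < δ)
    (hc1 : SemiclassicalDirichlet.HasBoundedWeakPartials (SemiclassicalDirichlet.collar Ω δ) c)
    (hn1 : SemiclassicalDirichlet.HasBoundedWeakPartials (SemiclassicalDirichlet.collar Ω δ) n) :
    ∃ C : ℝ, 0 < C ∧
      ∀ (h : ℝ) (z : ℂ), 0 < h → ‖z‖ = 1 → h ≤ SemiclassicalDirichlet.theta z →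
      ∀ u v : EuclideanSpace ℝ (Fin d) → ℂ,
        SemiclassicalDirichlet.MemH2 Ω u → MemLp v 2 (volume.restrict Ω) →
        SemiclassicalDirichlet.SolvesEquation Ω c n h z u v →
        SemiclassicalDirichlet.HasTrace Ω u (fun _ => 0) →
        (∃ q, SemiclassicalDirichlet.IsNormalDerivative Ω u q) ∧
        ∀ q, SemiclassicalDirichlet.IsNormalDerivative Ω u q →
          eLpNorm (fun x => (h : ℂ) * q x) 2 (SemiclassicalDirichlet.surfaceMeasure Ω) ≤
            ENNReal.ofReal (C * h ^ (1 / 2 : ℝ) * SemiclassicalDirichlet.theta z ^ (-1 / 2 : ℝ)) *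
              eLpNorm v 2 (volume.restrict Ω) := by
  obtain ⟨ι, _, ⟨A⟩⟩ := hΩ.exists_boundaryAtlas hδ
  obtain ⟨C, hC0, hC⟩ := SemiclassicalDirichlet.exists_trace_gradient_le hΩ hc hn hb₀ hcb hnb A
    hc1 hn1
  refine ⟨√C, Real.sqrt_pos.2 hC0, fun h z hh hz hθ u v hu hv hs htr => ⟨?_, fun q hq => ?_⟩⟩
  · obtain ⟨hu2, G, hG, hGH⟩ := hu
    obtain ⟨w, hw, -⟩ := hC h z hh hz hθ u v hu2 hv hs htr G hG hGH
    exact A.exists_isNormalDerivative hΩ.isOpen hG hw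
  · obtain ⟨G, w, hG, hw, hqw⟩ := hq.exists_integral_le
    obtain ⟨w', hw', hle⟩ := hC h z hh hz hθ u v hu.1 hv hs htr G hG fun i => (hw i).1
    have hww : ∀ i, ∫ x, ‖w i x‖ ^ 2 ∂SemiclassicalDirichlet.surfaceMeasure Ω =
        ∫ x, ‖w' i x‖ ^ 2 ∂SemiclassicalDirichlet.surfaceMeasure Ω := fun i => by
      refine integral_congr_ae ?_
      filter_upwards [(hw i).ae_unique A hΩ.isOpen hΩ.isBounded (hw' i)] with x hx
      rw [hx]
    simp_rw [hww] at hqw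
    have hθ0 : 0 < SemiclassicalDirichlet.theta z := hh.trans_le hθ
    have hconst : (√C * h ^ (1 / 2 : ℝ) * SemiclassicalDirichlet.theta z ^ (-1 / 2 : ℝ)) ^ 2 =
        C * (h / SemiclassicalDirichlet.theta z) := by
      rw [neg_div, Real.rpow_neg hθ0.le, ← Real.sqrt_eq_rpow, ← Real.sqrt_eq_rpow, mul_pow, mul_pow,
        inv_pow, Real.sq_sqrt hC0.le, Real.sq_sqrt hh.le, Real.sq_sqrt hθ0.le]
      ring
    rw [← ENNReal.pow_le_pow_left_iff two_ne_zero, mul_pow,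
      SemiclassicalDirichlet.eLpNorm_two_sq (hq.1.const_mul _),
      SemiclassicalDirichlet.eLpNorm_two_sq hv, ← ENNReal.ofReal_pow (by positivity), hconst,
      ← ENNReal.ofReal_mul (by positivity)]
    refine ENNReal.ofReal_le_ofReal ?_
    simp_rw [norm_mul, mul_pow]
    rw [integral_const_mul, Complex.norm_real, Real.norm_eq_abs, sq_abs]
    exact (mul_le_mul_of_nonneg_left hqw (sq_nonneg h)).trans hle
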